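/- Let $\overline{M}$ be a compact smooth manifold with boundary of dimension $n \geq 3$, with boundary $\partial M$ and interior $M = \overline{M} \setminus \partial M$. Let $g$ be a $C^{l,\beta}$-asymptotically hyperbolic metric on $M$, with $l \geq 2$ an integer and $\beta \in [0,1)$: there is a smooth function $\rho \geq 0$ on $\overline{M}$ with $\rho^{-1}(0) = \partial M$ and $d\rho \neq 0$ on $\partial M$ such that $\overline{g} := \rho^2 g$ extends to a $C^{l,\beta}$ metric on $\overline{M}$ with $|d\rho|^2_{\overline{g}} = 1$ on $\partial M$. (It is enough that $\overline{g}$ extends to a metric of class $C^2$.) Let $\mu^g$ be the Riemannian volume measure of $g$, $\mathrm{Scal}$ its scalar curvature and $N := 2n/(n-2)$. Let $W^{1,2}(M)$ be the space of functions $u \in W^{1,2}_{loc}(M,\mathbb{R})$ such that $\int_M (|du|_g^2 + u^2)\, d\mu^g < \infty$, where $du$ is the weak differential of $u$; functions that agree almost everywhere are identified. For a measurable set $V \subset M$, let $\mathcal{F}(V)$ be the space of all $u \in W^{1,2}(M)$ with $u = 0$ almost everywhere on $M \setminus V$. Set \[ G_g(u) := \int_M \left[\frac{4(n-1)}{n-2}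 |du|_g^2 + \mathrm{Scal}\, u^2\right] d\mu^g, \] \[ \lambda_g(V) := \inf_{u \in \mathcal{F}(V)\setminus\{0\}} \frac{G_g(u)}{\|u\|_{L^2(M)}^2}, \qquad \mathcal{Y}_g(V) := \inf_{u \in \mathcal{F}(V)\setminus\{0\}} \frac{G_g(u)}{\|u\|_{L^N(M)}^2}, \] with $\lambda_g(V) = \mathcal{Y}_g(V) = \infty$ if $\mathcal{F}(V) = \{0\}$. Then for every measurable set $V \subset M$, the local first conformal eigenvalue $\lambda_g(V)$ and the local Yamabe invariant $\mathcal{Y}_g(V)$ have the same sign: they are both positive, both negative, or both zero. -/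

import Mathlib

open Set MeasureTheory
open scoped Manifold ContDiff ENNReal

noncomputable section

namespace AHYamabe

/-! Throughout, `M` is a smooth manifold with boundary of dimension `n` (it plays the role of
`M̄`), and the open manifold under study is its interior `(𝓡∂ n).interior M`. -/

variable {n : ℕ} [NeZero n] {M : Type*} [TopologicalSpace M]
  [ChartedSpace (EuclideanHalfSpace n) M]

/-- A field of bilinear forms on the tangent spaces.  It represents a metric tensor on the interior
of `M`; its values at boundary points are irrelevant and are never used below. -/
abbrev BilinField (n : ℕ) [NeZero n] (M : Type*) [TopologicalSpace M]
    [ChartedSpace (EuclideanHalfSpace n) M] :=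
  ∀ p : M, TangentSpace (𝓡∂ n) p →L[ℝ] TangentSpace (𝓡∂ n) p →L[ℝ] ℝ

/-- A (rough) field of covectors on `M`; its values at boundary points are irrelevant. -/
abbrev CovectorField (n : ℕ) [NeZero n] (M : Type*) [TopologicalSpace M]
    [ChartedSpace (EuclideanHalfSpace n) M] :=
  ∀ p : M, TangentSpace (𝓡∂ n) p →L[ℝ] ℝ

/-- The `i`-th vector of the standard basis of the model space `ℝⁿ`, which is also the `i`-th vector
of a basis of the tangent space at `p`. -/
def stdVec (p : M) (i : Fin n) : TangentSpace (𝓡∂ n) p :=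
  (EuclideanSpace.single i (1 : ℝ) : EuclideanSpace ℝ (Fin n))

/-- The squared norm `|α|²_b = ∑ bⁱʲ αᵢ αⱼ` of a covector `α` at `p` for the inner product `b`,
where `(bⁱʲ)` is the inverse of the Gram matrix of `b` in a basis of the tangent space. -/
def covectorNormSq (p : M) (b : TangentSpace (𝓡∂ n) p →L[ℝ] TangentSpace (𝓡∂ n) p →L[ℝ] ℝ)
    (α : TangentSpace (𝓡∂ n) p →L[ℝ] ℝ) : ℝ :=
  ∑ i : Fin n, ∑ j : Fin n,
    (Matrix.of fun k l : Fin n => b (stdVec p k) (stdVec p l))⁻¹ i j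
      * α (stdVec p i) * α (stdVec p j)

/-! ### Asymptotically hyperbolic metrics -/

/-- Defining functions of the boundary of `M`. -/
structure IsDefiningFunction (ρ : M → ℝ) : Prop where
  smooth : ContMDiff (𝓡∂ n) 𝓘(ℝ, ℝ) ∞ ρ
  nonneg : ∀ p, 0 ≤ ρ p
  eq_zero_iff : ∀ p, ρ p = 0 ↔ p ∈ (𝓡∂ n).boundary M
  mfderiv_ne_zero : ∀ p ∈ (𝓡∂ n).boundary M, mfderiv (𝓡∂ n) 𝓘(ℝ, ℝ) ρ p ≠ 0

/-- The metric `g` on the interior of `M` is `C²`-asymptotically hyperbolic: for some defining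
function `ρ`, the tensor `ρ² g` extends to a metric `gbar` of class `C²` on `M`, up to the boundary,
such that `|dρ|²_gbar = 1` along the boundary. -/
def IsAsymptoticallyHyperbolic [IsManifold (𝓡∂ n) ∞ M] (g : BilinField n M) : Prop :=
  ∃ ρ : M → ℝ, IsDefiningFunction (n := n) ρ ∧
    ∃ gbar : Bundle.ContMDiffRiemannianMetric (𝓡∂ n) 2 (EuclideanSpace ℝ (Fin n))
        (fun p : M => TangentSpace (𝓡∂ n) p),
      (∀ p ∈ (𝓡∂ n).interior M, gbar.inner p = ρ p ^ 2 • g p) ∧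
      ∀ p ∈ (𝓡∂ n).boundary M,
        covectorNormSq p (gbar.inner p) (mfderiv (𝓡∂ n) 𝓘(ℝ, ℝ) ρ p) = 1

/-! ### Coordinates, volume measure and scalar curvature -/

/-- The open set of `ℝⁿ` which is the image of the interior of `M` in the chart around `c`. -/
def chartDomain (c : M) : Set (EuclideanSpace ℝ (Fin n)) :=
  interior (extChartAt (𝓡∂ n) c).target

/-- The coordinate vector `∂ᵢ` of the chart around `c`, at the point of coordinates `y`. -/
def coordVec (c : M) (y : EuclideanSpace ℝ (Fin n)) (i : Fin n) :
    TangentSpace (𝓡∂ n) ((extChartAt (𝓡∂ n) c).symm y) :=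
  mfderivWithin 𝓘(ℝ, EuclideanSpace ℝ (Fin n)) (𝓡∂ n) (extChartAt (𝓡∂ n) c).symm
    (range (𝓡∂ n)) y (EuclideanSpace.single i (1 : ℝ) : EuclideanSpace ℝ (Fin n))

/-- The matrix `(gᵢⱼ)` of the metric in the chart around `c`, at the point of coordinates `y`. -/
def metricMatrix (g : BilinField n M) (c : M) (y : EuclideanSpace ℝ (Fin n)) :
    Matrix (Fin n) (Fin n) ℝ :=
  Matrix.of fun i j => g ((extChartAt (𝓡∂ n) c).symm y) (coordVec c y i) (coordVec c y j)

/-- The partial derivative `∂ᵢ f` on `ℝⁿ`. -/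
def partialD (i : Fin n) (f : EuclideanSpace ℝ (Fin n) → ℝ) (y : EuclideanSpace ℝ (Fin n)) : ℝ :=
  fderiv ℝ f y (EuclideanSpace.single i (1 : ℝ))

/-- The measure `√(det gᵢⱼ) dx` of the chart around `c`, transported to `M`. -/
def chartVolume [MeasurableSpace M] (g : BilinField n M) (c : M) : Measure M :=
  Measure.map (extChartAt (𝓡∂ n) c).symm
    ((volume.restrict (chartDomain (n := n) c)).withDensity fun y =>
      ENNReal.ofReal (Real.sqrt (metricMatrix g c y).det))

/-- The Riemannian volume measure `dμ^g`, the boundary having measure zero.  The measure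
`chartVolume g c` is the restriction of `dμ^g` to the domain of the chart around `c`, so that `dμ^g`
is the least measure which dominates all of them. -/
def riemVolume [MeasurableSpace M] (g : BilinField n M) : Measure M :=
  ⨆ c : M, chartVolume g c

/-- The Christoffel symbol
`Γᵏᵢⱼ = ½ ∑ₗ gᵏˡ (∂ᵢ gⱼₗ + ∂ⱼ gᵢₗ - ∂ₗ gᵢⱼ)` in the chart around `c`. -/
def christoffel (g : BilinField n M) (c : M) (k i j : Fin n) (y : EuclideanSpace ℝ (Fin n)) : ℝ :=
  (1 / 2) * ∑ l, (metricMatrix g c y)⁻¹ k l *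
    (partialD i (fun z => metricMatrix g c z j l) y
      + partialD j (fun z => metricMatrix g c z i l) y
      - partialD l (fun z => metricMatrix g c z i j) y)

/-- The Ricci curvature
`Rⱼₖ = ∑ᵢ (∂ᵢ Γⁱⱼₖ - ∂ⱼ Γⁱᵢₖ) + ∑ᵢₘ (Γⁱᵢₘ Γᵐⱼₖ - Γⁱⱼₘ Γᵐᵢₖ)` in the chart around `c`. -/
def ricci (g : BilinField n M) (c : M) (j k : Fin n) (y : EuclideanSpace ℝ (Fin n)) : ℝ :=
  (∑ i, (partialD i (christoffel g c i j k) y - partialD j (christoffel g c i i k) y))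
    + ∑ i, ∑ m, (christoffel g c i i m y * christoffel g c m j k y
      - christoffel g c i j m y * christoffel g c m i k y)

/-- The scalar curvature of `g` at an interior point `p`, computed in the chart around `p`. -/
def scal (g : BilinField n M) (p : M) : ℝ :=
  ∑ j, ∑ k, (metricMatrix g p (extChartAt (𝓡∂ n) p p))⁻¹ j k
    * ricci g p j k (extChartAt (𝓡∂ n) p p)

/-! ### Sobolev functions -/

/-- `u` belongs to `W^{1,2}_loc` of the interior of `M` and `α` is its weak differential: in every
chart, `u` and the components of `α` are locally square integrable, and the components of `α` are
the distributional partial derivatives of `u`. -/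
def HasWeakDifferential (u : M → ℝ) (α : CovectorField n M) : Prop :=
  ∀ c : M,
    (∀ K ⊆ chartDomain (n := n) c, IsCompact K →
      MemLp (fun y => u ((extChartAt (𝓡∂ n) c).symm y)) 2 (volume.restrict K) ∧
      ∀ i, MemLp (fun y => α ((extChartAt (𝓡∂ n) c).symm y) (coordVec c y i)) 2
        (volume.restrict K)) ∧
    ∀ ψ : EuclideanSpace ℝ (Fin n) → ℝ, ContDiff ℝ ∞ ψ → HasCompactSupport ψ →
      tsupport ψ ⊆ chartDomain (n := n) c → ∀ i,
        ∫ y in chartDomain (n := n) c, u ((extChartAt (𝓡∂ n) c).symm y) * partialD i ψ y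
          = - ∫ y in chartDomain (n := n) c,
              α ((extChartAt (𝓡∂ n) c).symm y) (coordVec c y i) * ψ y

open Classical in
/-- The weak differential `du` of `u` (unique up to a null set), or `0` if there is none. -/
def weakDifferential (u : M → ℝ) : CovectorField n M :=
  if h : ∃ α : CovectorField n M, HasWeakDifferential u α then h.choose else 0

/-- The function `|du|²_g`. -/
def gradNormSq (g : BilinField n M) (u : M → ℝ) (p : M) : ℝ :=
  covectorNormSq p (g p) (weakDifferential u p)

/-- The Sobolev space `W^{1,2}` (with weight `δ = 0`) of the interior of `M`: functions in
`W^{1,2}_loc` such that `u` and `du` are square integrable for `g`. -/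
def MemW12 [MeasurableSpace M] (g : BilinField n M) (u : M → ℝ) : Prop :=
  (∃ α : CovectorField n M, HasWeakDifferential u α) ∧
    MemLp u 2 (riemVolume g) ∧ Integrable (gradNormSq g u) (riemVolume g)

/-- The space `𝓕(V)` of functions of `W^{1,2}` vanishing almost everywhere outside `V`. -/
def sobolevOn [MeasurableSpace M] (g : BilinField n M) (V : Set M) : Set (M → ℝ) :=
  {u | MemW12 g u ∧ ∀ᵐ p ∂(riemVolume g), p ∉ V → u p = 0}

/-- The set `𝓕(V) \ {0}`, functions being identified when they agree almost everywhere. -/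
def nonzeroSobolevOn [MeasurableSpace M] (g : BilinField n M) (V : Set M) : Set (M → ℝ) :=
  {u | u ∈ sobolevOn g V ∧ ¬ u =ᵐ[riemVolume g] 0}

/-! ### The first conformal eigenvalue and the Yamabe invariant -/

/-- The functional `G_g(u) = ∫ (4(n-1)/(n-2) |du|² + Scal u²) dμ^g`. -/
def energy [MeasurableSpace M] (g : BilinField n M) (u : M → ℝ) : ℝ :=
  ∫ p, (4 * ((n : ℝ) - 1) / ((n : ℝ) - 2) * gradNormSq g u p + scal g p * u p ^ 2)
    ∂(riemVolume g)

/-- The critical exponent `N = 2n/(n-2)`. -/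
def critExp (n : ℕ) : ℝ≥0∞ := ENNReal.ofReal (2 * (n : ℝ) / ((n : ℝ) - 2))

/-- The Rayleigh quotient. -/
def rayleighQuotient [MeasurableSpace M] (g : BilinField n M) (u : M → ℝ) : ℝ :=
  energy g u / (eLpNorm u 2 (riemVolume g)).toReal ^ 2

/-- The Yamabe quotient. -/
def yamabeQuotient [MeasurableSpace M] (g : BilinField n M) (u : M → ℝ) : ℝ :=
  energy g u / (eLpNorm u (critExp n) (riemVolume g)).toReal ^ 2

/-- The local first conformal eigenvalue `λ_g(V)`; it is `⊤` if `𝓕(V) = {0}`. -/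
def firstConformalEigenvalue [MeasurableSpace M] (g : BilinField n M) (V : Set M) : EReal :=
  ⨅ u ∈ nonzeroSobolevOn g V, (rayleighQuotient g u : EReal)

/-- The local Yamabe invariant `𝓨_g(V)`; it is `⊤` if `𝓕(V) = {0}`. -/
def yamabeInvariant [MeasurableSpace M] (g : BilinField n M) (V : Set M) : EReal :=
  ⨅ u ∈ nonzeroSobolevOn g V, (yamabeQuotient g u : EReal)

end AHYamabe

end

noncomputable section

namespace AHYamabe

open Filter Topology
open scoped Convolution

/-! ### Mollification in `L²` -/

/-! Write E for the energy G_g. Negative signs agree at once: for a nonzero admissible u both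
denominators are positive and finite, so either invariant is negative exactly when E(u) < 0 for some
u. It remains to show that λ > 0 and 𝓨 > 0 are equivalent (`biInf_div_sign_eq`). This needs three
inequalities, each with constants independent of u.

(1) E(u) ≥ κ‖du‖² - K‖u‖₂² with κ = 4(n-1)/(n-2), because Scal is bounded (`exists_energy_ge_grad`).
(2) The Sobolev inequality ‖u‖_N² ≤ C(‖u‖₂² + ‖du‖²) on the whole complete manifold
(`exists_sobolev`). (3) E(u) ≥ ε‖u‖₂² - L‖u‖_N² (`exists_energy_ge_sq`). If λ > 0, then E dominates
‖u‖₂², hence ‖du‖² by (1), hence ‖u‖_N² by (2). If 𝓨 > 0, then E dominates ‖u‖_N², hence ‖u‖₂² by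
(3).

The heart is (3), coercivity at infinity. A conformal computation gives Scal = -n(n-1)|dρ|² + O(ρ),
the norm being that of ρ²g. Integrating the divergence of u² ∇ρ against the weight ρ^(1-n) gives the
Hardy inequality (n-1)²/4 ∫|dρ|²u² ≤ ∫|du|² + O(∫ρu²). Multiplied by κ and added to the curvature
term, it leaves the coefficient (n-1)/(n-2), which is positive since (n-1)² - n(n-2) = 1. As |dρ| =
1 on the boundary, the resulting integrand is bounded below by a positive multiple of u² near the
boundary. Away from it the set {ρ ≥ δ} has finite volume, and Hölder's inequality bounds the L² norm
there by the L^N norm.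

For (2), the substitution v = ρ^(-(n-2)/2) u in a boundary chart turns the weighted norms into
Lebesgue ones, and the Euclidean Gagliardo–Nirenberg–Sobolev inequality applies.

Since functions are only weakly differentiable and live up to infinity, both analytic inequalities
are proved for cutoffs near the boundary, after local mollification, and then passed to the limit.
Since `scal` is computed at each point in the chart centred there and `riemVolume` is a supremum of
chart measures, both are first shown to be computable in any chart. -/

theorem sq_eLpNorm_two {α : Type*} [MeasurableSpace α] {μ : Measure α} (f : α → ℝ) :
    eLpNorm f 2 μ ^ 2 = ∫⁻ x, ‖f x‖ₑ ^ 2 ∂μ := by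
  have := eLpNorm_nnreal_pow_eq_lintegral (p := 2) (f := f) (μ := μ) (by norm_num)
  simpa using this

/-- Almost everywhere convergence without increase of the norm implies convergence in `L²`. -/
theorem tendsto_eLpNorm_two_sub_of_ae {α : Type*} [MeasurableSpace α] {μ : Measure α}
    {f : ℕ → α → ℝ} {g : α → ℝ} (hf : ∀ k, AEStronglyMeasurable (f k) μ) (hg : MemLp g 2 μ)
    (hle : ∀ k, eLpNorm (f k) 2 μ ≤ eLpNorm g 2 μ)
    (hlim : ∀ᵐ x ∂μ, Tendsto (fun k => f k x) atTop (𝓝 (g x))) :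
    Tendsto (fun k => eLpNorm (fun x => f k x - g x) 2 μ) atTop (𝓝 0) := by
  have hpt : ∀ k x, ‖f k x - g x‖ₑ ^ 2 ≤ 2 * ‖f k x‖ₑ ^ 2 + 2 * ‖g x‖ₑ ^ 2 := by
    intro k x
    have h2 : (2 : ℝ≥0∞) = ENNReal.ofReal 2 := by simp
    rw [← ofReal_norm, ← ofReal_norm, ← ofReal_norm, h2, ← ENNReal.ofReal_pow (norm_nonneg _),
      ← ENNReal.ofReal_pow (norm_nonneg _), ← ENNReal.ofReal_pow (norm_nonneg _),
      ← ENNReal.ofReal_mul (by norm_num), ← ENNReal.ofReal_mul (by norm_num),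
      ← ENNReal.ofReal_add (by positivity) (by positivity)]
    apply ENNReal.ofReal_le_ofReal
    simp only [Real.norm_eq_abs, sq_abs]
    nlinarith [sq_nonneg (f k x + g x)]
  set A : ℝ≥0∞ := ∫⁻ x, ‖g x‖ₑ ^ 2 ∂μ with hA
  have hAfin : A ≠ ⊤ := by
    rw [hA, ← sq_eLpNorm_two]; exact ENNReal.pow_ne_top hg.2.ne
  have hfk : ∀ k, ∫⁻ x, ‖f k x‖ₑ ^ 2 ∂μ ≤ A := by
    intro k
    rw [hA, ← sq_eLpNorm_two, ← sq_eLpNorm_two]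
    gcongr
    exact hle k
  -- Fatou's lemma for the nonnegative functions h k, which tend to 4g²: their integrals have lower
  -- limit at least 4A. The norm bound makes the sum of the integrals of h k and |f k - g|² at most
  -- 4A, so the second one tends to 0.
  set h : ℕ → α → ℝ≥0∞ := fun k x => 2 * ‖f k x‖ₑ ^ 2 + 2 * ‖g x‖ₑ ^ 2 - ‖f k x - g x‖ₑ ^ 2
    with hh
  have hmd : ∀ k, AEMeasurable (fun x => ‖f k x - g x‖ₑ ^ 2) μ := fun k =>
    ((hf k).sub hg.1).enorm.pow_const 2
  have hmf : ∀ k, AEMeasurable (fun x => 2 * ‖f k x‖ₑ ^ 2) μ := fun k =>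
    ((hf k).enorm.pow_const 2).const_mul 2
  have hmg : AEMeasurable (fun x => 2 * ‖g x‖ₑ ^ 2) μ := (hg.1.enorm.pow_const 2).const_mul 2
  have hmh : ∀ k, AEMeasurable (h k) μ := fun k => ((hmf k).add hmg).sub (hmd k)
  have hsum : ∀ k, ∫⁻ x, h k x ∂μ + ∫⁻ x, ‖f k x - g x‖ₑ ^ 2 ∂μ ≤ 4 * A := by
    intro k
    rw [← lintegral_add_left' (hmh k)]
    have : ∀ x, h k x + ‖f k x - g x‖ₑ ^ 2 = 2 * ‖f k x‖ₑ ^ 2 + 2 * ‖g x‖ₑ ^ 2 := fun x =>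
      tsub_add_cancel_of_le (hpt k x)
    simp_rw [this]
    rw [lintegral_add_left' (hmf k), lintegral_const_mul'' _ ((hf k).enorm.pow_const 2),
      lintegral_const_mul'' _ (hg.1.enorm.pow_const 2)]
    calc _ ≤ 2 * A + 2 * A := by gcongr; exact hfk k
      _ = 4 * A := by ring
  have hlim' : ∀ᵐ x ∂μ, Tendsto (fun k => h k x) atTop (𝓝 (4 * ‖g x‖ₑ ^ 2)) := by
    filter_upwards [hlim] with x hx
    have h1 : Tendsto (fun k => ‖f k x‖ₑ ^ 2) atTop (𝓝 (‖g x‖ₑ ^ 2)) :=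
      ((ENNReal.continuous_pow 2).comp continuous_enorm).continuousAt.tendsto.comp hx
    have h2 : Tendsto (fun k => ‖f k x - g x‖ₑ ^ 2) atTop (𝓝 0) := by
      have : Tendsto (fun k => f k x - g x) atTop (𝓝 0) := by
        simpa using hx.sub_const (g x)
      simpa [Function.comp_def] using (((ENNReal.continuous_pow 2).comp continuous_enorm).tendsto (0 : ℝ)).comp this
    have h3 : Tendsto (fun k => 2 * ‖f k x‖ₑ ^ 2 + 2 * ‖g x‖ₑ ^ 2) atTop
        (𝓝 (2 * ‖g x‖ₑ ^ 2 + 2 * ‖g x‖ₑ ^ 2)) :=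
      (ENNReal.Tendsto.const_mul h1 (Or.inr (by simp))).add tendsto_const_nhds
    have h4 := ENNReal.Tendsto.sub h3 h2 (Or.inr (by simp))
    convert h4 using 2
    rw [tsub_zero]; ring
  have hfatou : 4 * A ≤ liminf (fun k => ∫⁻ x, h k x ∂μ) atTop := by
    calc 4 * A = ∫⁻ x, liminf (fun k => h k x) atTop ∂μ := by
          rw [hA, ← lintegral_const_mul'' _ (hg.1.enorm.pow_const 2)]
          refine lintegral_congr_ae ?_
          filter_upwards [hlim'] with x hx using hx.liminf_eq.symm
      _ ≤ _ := lintegral_liminf_le' hmh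
  have hh_tendsto : Tendsto (fun k => ∫⁻ x, h k x ∂μ) atTop (𝓝 (4 * A)) := by
    refine tendsto_of_le_liminf_of_limsup_le hfatou ?_
    refine limsup_le_of_le (h := Eventually.of_forall fun k => ?_)
    exact le_self_add.trans (hsum k)
  have h4A : 4 * A ≠ ⊤ := ENNReal.mul_ne_top (by simp) hAfin
  have hd : Tendsto (fun k => ∫⁻ x, ‖f k x - g x‖ₑ ^ 2 ∂μ) atTop (𝓝 0) := by
    have hb : Tendsto (fun k => 4 * A - ∫⁻ x, h k x ∂μ) atTop (𝓝 0) := by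
      have := ENNReal.Tendsto.sub (tendsto_const_nhds (x := 4 * A)) hh_tendsto (Or.inl h4A)
      simpa using this
    refine tendsto_of_tendsto_of_tendsto_of_le_of_le tendsto_const_nhds hb
      (fun _ => zero_le) fun k => ?_
    have hk : ∫⁻ x, h k x ∂μ ≠ ⊤ := ne_top_of_le_ne_top h4A (le_self_add.trans (hsum k))
    exact ENNReal.le_sub_of_add_le_left hk (hsum k)
  have : ∀ k, eLpNorm (fun x => f k x - g x) 2 μ
      = (∫⁻ x, ‖f k x - g x‖ₑ ^ 2 ∂μ) ^ (1 / 2 : ℝ) := by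
    intro k
    rw [← sq_eLpNorm_two (fun x => f k x - g x), ← ENNReal.rpow_natCast, ← ENNReal.rpow_mul]
    norm_num
  simp_rw [this]
  have := (ENNReal.continuous_rpow_const (y := (1 / 2 : ℝ))).tendsto (0 : ℝ≥0∞)
  rw [ENNReal.zero_rpow_of_pos (by norm_num)] at this
  exact this.comp hd

variable {E : Type*} [NormedAddCommGroup E] [NormedSpace ℝ E] [FiniteDimensional ℝ E]
  [HasContDiffBump E] [MeasurableSpace E] [BorelSpace E] {μ : Measure E} [μ.IsAddHaarMeasure]

/-- Mollification does not increase the `L²` norm. -/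
theorem eLpNorm_two_normed_convolution_le (φ : ContDiffBump (0 : E)) {f : E → ℝ}
    (hf : AEStronglyMeasurable f μ) :
    eLpNorm (φ.normed μ ⋆[ContinuousLinearMap.lsmul ℝ ℝ, μ] f) 2 μ ≤ eLpNorm f 2 μ := by
  -- Mollification is averaging of translates over the probability measure ν. Jensen's inequality
  -- appears as L¹ ≤ L² for ν; Tonelli and translation invariance then finish.
  set ν : Measure E := μ.withDensity fun t => ENNReal.ofReal (φ.normed μ t) with hν
  have hmeas : Measurable fun t => ENNReal.ofReal (φ.normed μ t) :=
    φ.continuous_normed.measurable.ennreal_ofReal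
  have hprob : IsProbabilityMeasure ν := by
    constructor
    rw [hν, withDensity_apply _ MeasurableSet.univ, Measure.restrict_univ,
      ← ofReal_integral_eq_lintegral_ofReal φ.integrable_normed
        (Eventually.of_forall φ.nonneg_normed), φ.integral_normed, ENNReal.ofReal_one]
  -- As f is only almost everywhere strongly measurable, (x, t) ↦ f (x - t) is measurable for the
  -- product because subtraction pulls null sets back to null sets.
  have hqmp := quasiMeasurePreserving_sub_of_right_invariant μ ν
  have hpt : ∀ x, AEStronglyMeasurable (fun t => f (x - t)) ν → 
      ‖(φ.normed μ ⋆[ContinuousLinearMap.lsmul ℝ ℝ, μ] f) x‖ₑ ^ 2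
        ≤ ∫⁻ t, ‖f (x - t)‖ₑ ^ 2 ∂ν := by
    intro x hx
    rw [← sq_eLpNorm_two]
    gcongr
    calc ‖(φ.normed μ ⋆[ContinuousLinearMap.lsmul ℝ ℝ, μ] f) x‖ₑ
        ≤ ∫⁻ t, ‖φ.normed μ t • f (x - t)‖ₑ ∂μ := enorm_integral_le_lintegral_enorm _
      _ = eLpNorm (fun t => f (x - t)) 1 ν := by
          rw [eLpNorm_one_eq_lintegral_enorm, hν,
            lintegral_withDensity_eq_lintegral_mul_non_measurable _ hmeas
              (Eventually.of_forall fun _ => ENNReal.ofReal_lt_top)]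
          refine lintegral_congr fun t => ?_
          rw [enorm_smul, Pi.mul_apply, Real.enorm_of_nonneg (φ.nonneg_normed t)]
      _ ≤ eLpNorm (fun t => f (x - t)) 2 ν :=
          eLpNorm_le_eLpNorm_of_exponent_le (by norm_num) hx
  have hprod : AEStronglyMeasurable (fun p : E × E => f (p.1 - p.2)) (μ.prod ν) :=
    hf.comp_quasiMeasurePreserving hqmp
  have hsec : ∀ᵐ x ∂μ, AEStronglyMeasurable (fun t => f (x - t)) ν := hprod.prodMk_left
  have key : eLpNorm (φ.normed μ ⋆[ContinuousLinearMap.lsmul ℝ ℝ, μ] f) 2 μ ^ 2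
      ≤ eLpNorm f 2 μ ^ 2 := by
    rw [sq_eLpNorm_two, sq_eLpNorm_two]
    calc _ ≤ ∫⁻ x, ∫⁻ t, ‖f (x - t)‖ₑ ^ 2 ∂ν ∂μ := by
          refine lintegral_mono_ae ?_
          filter_upwards [hsec] with x hx using hpt x hx
      _ = ∫⁻ t, ∫⁻ x, ‖f (x - t)‖ₑ ^ 2 ∂μ ∂ν :=
          lintegral_lintegral_swap (hprod.enorm.pow_const 2)
      _ = ∫⁻ t, ∫⁻ x, ‖f x‖ₑ ^ 2 ∂μ ∂ν := by
          refine lintegral_congr fun t => ?_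
          exact lintegral_sub_right_eq_self (fun x => ‖f x‖ₑ ^ 2) t
      _ = _ := by simp
  exact (ENNReal.pow_le_pow_left_iff two_ne_zero).1 key

/-- A sequence of bump functions whose supports shrink to the origin. -/
def shrinkingBump (E : Type*) [NormedAddCommGroup E] (k : ℕ) : ContDiffBump (0 : E) where
  rIn := 1 / ((k : ℝ) + 1)
  rOut := 2 / ((k : ℝ) + 1)
  rIn_pos := by positivity
  rIn_lt_rOut := by gcongr; norm_num

/-- This is Lebesgue differentiation; it needs the ratio of outer to inner radius to stay bounded,
and here it is always 2. -/
theorem ae_tendsto_mollify {f : E → ℝ} (hf : LocallyIntegrable f μ) :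
    ∀ᵐ x ∂μ, Tendsto
      (fun k => ((shrinkingBump E k).normed μ ⋆[ContinuousLinearMap.lsmul ℝ ℝ, μ] f) x)
      atTop (𝓝 (f x)) := by
  refine ContDiffBump.ae_convolution_tendsto_right_of_locallyIntegrable (K := 2) ?_ ?_ hf
  · exact tendsto_const_div_atTop_nhds_zero_nat (2 : ℝ) |>.comp (tendsto_add_atTop_nat 1)
      |>.congr fun k => by simp [shrinkingBump]
  · refine Eventually.of_forall fun k => le_of_eq ?_
    simp only [shrinkingBump]; ring

theorem tendsto_eLpNorm_two_mollify_sub {f : E → ℝ} (hf : MemLp f 2 μ) :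
    Tendsto (fun k => eLpNorm (fun x =>
      ((shrinkingBump E k).normed μ ⋆[ContinuousLinearMap.lsmul ℝ ℝ, μ] f) x - f x) 2 μ)
      atTop (𝓝 0) := by
  have hloc : LocallyIntegrable f μ := hf.locallyIntegrable (by norm_num)
  refine tendsto_eLpNorm_two_sub_of_ae (fun k => ?_) hf
    (fun k => eLpNorm_two_normed_convolution_le _ hf.1) (ae_tendsto_mollify hloc)
  exact ((shrinkingBump E k).hasCompactSupport_normed.continuous_convolution_left
    _ (shrinkingBump E k).continuous_normed hloc).aestronglyMeasurable

end AHYamabe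
end

noncomputable section

namespace AHYamabe

open Filter Topology
open scoped Convolution

/-! ### Weak gradients on open subsets of `ℝⁿ` -/

variable {n : ℕ}

/-- On the open set `D`, the function `f` is locally in `W^{1,2}`, with weak gradient `a`. -/
structure IsWeakGradient (D : Set (EuclideanSpace ℝ (Fin n))) (f : EuclideanSpace ℝ (Fin n) → ℝ)
    (a : Fin n → EuclideanSpace ℝ (Fin n) → ℝ) : Prop where
  memLp : ∀ K ⊆ D, IsCompact K → MemLp f 2 (volume.restrict K)
  memLp_grad : ∀ K ⊆ D, IsCompact K → ∀ i, MemLp (a i) 2 (volume.restrict K)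
  integral_eq : ∀ ψ : EuclideanSpace ℝ (Fin n) → ℝ, ContDiff ℝ ∞ ψ → HasCompactSupport ψ →
    tsupport ψ ⊆ D → ∀ i, ∫ y in D, f y * partialD i ψ y = - ∫ y in D, a i y * ψ y

theorem partialD_mul {f g : EuclideanSpace ℝ (Fin n) → ℝ} {y : EuclideanSpace ℝ (Fin n)}
    (hf : DifferentiableAt ℝ f y) (hg : DifferentiableAt ℝ g y) (i : Fin n) :
    partialD i (fun z => f z * g z) y = f y * partialD i g y + g y * partialD i f y := by
  simp [partialD, fderiv_fun_mul hf hg]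

theorem exists_cutoff {D K : Set (EuclideanSpace ℝ (Fin n))} (hD : IsOpen D) (hK : IsCompact K)
    (hKD : K ⊆ D) : ∃ ξ : EuclideanSpace ℝ (Fin n) → ℝ, ContDiff ℝ ∞ ξ ∧ HasCompactSupport ξ ∧
      tsupport ξ ⊆ D ∧ (∀ x ∈ K, ξ x = 1) ∧ ∀ x, ξ x ∈ Icc (0 : ℝ) 1 := by
  obtain ⟨L, hL, hKL, hLD⟩ := exists_compact_between hK hD hKD
  obtain ⟨ξ, h1, h0, h01⟩ := exists_contMDiffMap_one_nhds_of_subset_interior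
    (n := ⊤) 𝓘(ℝ, EuclideanSpace ℝ (Fin n)) hK.isClosed hKL
  have hsupp : tsupport ξ ⊆ L := by
    refine closure_minimal (fun x hx => ?_) hL.isClosed
    by_contra hxL
    exact hx (h0 x hxL)
  refine ⟨ξ, ξ.contMDiff.contDiff, hL.of_isClosed_subset (isClosed_tsupport _) hsupp,
    hsupp.trans hLD, fun x hx => ?_, h01⟩
  exact (h1.self_of_nhdsSet) x hx

theorem memLp_mul_of_hasCompactSupport {ξ f : EuclideanSpace ℝ (Fin n) → ℝ} (hξ : Continuous ξ)
    (hc : HasCompactSupport ξ) (hf : MemLp f 2 (volume.restrict (tsupport ξ))) :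
    MemLp (fun y => ξ y * f y) 2 volume := by
  obtain ⟨C, hC⟩ := hc.exists_bound_of_continuous hξ
  have h1 : MemLp (fun y => ξ y * f y) 2 (volume.restrict (tsupport ξ)) :=
    MemLp.of_le_mul (c := C) hf (hξ.aestronglyMeasurable.mul hf.1)
      (Eventually.of_forall fun y => by
        rw [norm_mul]; exact mul_le_mul_of_nonneg_right (hC y) (norm_nonneg _))
  have h2 := (memLp_indicator_iff_restrict (isClosed_tsupport ξ).measurableSet).2 h1
  have h3 : (fun y => ξ y * f y) = (tsupport ξ).indicator fun y => ξ y * f y := by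
    funext y
    by_cases hy : y ∈ tsupport ξ
    · simp [hy]
    · simp [hy, image_eq_zero_of_notMem_tsupport hy]
  rw [h3]
  exact h2

theorem continuous_partialD {ξ : EuclideanSpace ℝ (Fin n) → ℝ} (hξ : ContDiff ℝ 1 ξ) (i : Fin n) :
    Continuous (partialD i ξ) :=
  (hξ.continuous_fderiv one_ne_zero).clm_apply continuous_const

theorem tsupport_partialD_subset (ξ : EuclideanSpace ℝ (Fin n) → ℝ) (i : Fin n) :
    tsupport (partialD i ξ) ⊆ tsupport ξ := by
  refine closure_minimal (fun x hx => ?_) (isClosed_tsupport _)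
  refine support_fderiv_subset ℝ (f := ξ) ?_
  intro h0
  exact hx (by simp [partialD, h0])

theorem hasCompactSupport_partialD {ξ : EuclideanSpace ℝ (Fin n) → ℝ} (hξ : HasCompactSupport ξ)
    (i : Fin n) : HasCompactSupport (partialD i ξ) :=
  hξ.of_isClosed_subset (isClosed_tsupport _) (tsupport_partialD_subset ξ i)

theorem setIntegral_eq_of_tsupport {D : Set (EuclideanSpace ℝ (Fin n))} {h : EuclideanSpace ℝ (Fin n) → ℝ}
    (hD : ∀ y, y ∉ D → h y = 0) : ∫ y in D, h y = ∫ y, h y :=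
  setIntegral_eq_integral_of_forall_compl_eq_zero hD

/-- The partial derivatives of the mollification of a function with global weak gradient. -/
theorem partialD_mollify (φ : ContDiffBump (0 : EuclideanSpace ℝ (Fin n)))
    {w b : EuclideanSpace ℝ (Fin n) → ℝ} {i : Fin n} (hw : LocallyIntegrable w volume)
    (hb : ∀ ψ : EuclideanSpace ℝ (Fin n) → ℝ, ContDiff ℝ ∞ ψ → HasCompactSupport ψ →
      ∫ y, w y * partialD i ψ y = - ∫ y, b y * ψ y) (x : EuclideanSpace ℝ (Fin n)) :
    partialD i (φ.normed volume ⋆[ContinuousLinearMap.lsmul ℝ ℝ, volume] w) x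
      = (φ.normed volume ⋆[ContinuousLinearMap.lsmul ℝ ℝ, volume] b) x := by
  set η := φ.normed (volume : Measure (EuclideanSpace ℝ (Fin n))) with hη
  have hηs : ContDiff ℝ ∞ η := φ.contDiff_normed
  have hηc : HasCompactSupport η := φ.hasCompactSupport_normed
  have hd := hηc.hasFDerivAt_convolution_left (ContinuousLinearMap.lsmul ℝ ℝ)
    (hηs.of_le (by simp)) hw x
  have hex : ConvolutionExistsAt (fderiv ℝ η) w x
      ((ContinuousLinearMap.lsmul ℝ ℝ : ℝ →L[ℝ] ℝ →L[ℝ] ℝ).precompL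
        (EuclideanSpace ℝ (Fin n))) volume :=
    (hηc.fderiv ℝ).convolutionExists_left _ (hηs.continuous_fderiv (by simp)) hw x
  rw [partialD, hd.fderiv, convolution_def,
    ContinuousLinearMap.integral_apply hex.integrable]
  -- The test function is the reflected translate y ↦ η (x - y). Its derivative carries a minus
  -- sign, which cancels the one in the definition of the weak derivative.
  have hψ : ContDiff ℝ ∞ (fun y => η (x - y)) := hηs.comp (contDiff_const.sub contDiff_id)
  have hψc : HasCompactSupport (fun y => η (x - y)) :=
    hηc.comp_homeomorph (Homeomorph.subLeft x)
  have hpd : ∀ y, partialD i (fun y => η (x - y)) y = - partialD i η (x - y) := by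
    intro y
    have h1 : HasFDerivAt (fun y => η (x - y)) ((fderiv ℝ η (x - y)).comp
        (-ContinuousLinearMap.id ℝ _)) y :=
      ((hηs.differentiable (by simp)) (x - y)).hasFDerivAt.comp y
        ((hasFDerivAt_id y).const_sub x)
    simp [partialD, h1.fderiv]
  have h1 := hb _ hψ hψc
  simp_rw [hpd] at h1
  rw [convolution_lsmul_swap]
  have h2 : ∫ t, ((ContinuousLinearMap.lsmul ℝ ℝ : ℝ →L[ℝ] ℝ →L[ℝ] ℝ).precompL
        (EuclideanSpace ℝ (Fin n)) (fderiv ℝ η t) (w (x - t))) (EuclideanSpace.single i 1)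
      = ∫ y, w y * partialD i η (x - y) := by
    rw [← integral_sub_left_eq_self _ volume x]
    refine integral_congr_ae (Eventually.of_forall fun y => ?_)
    simp [partialD, mul_comm]
  rw [h2]
  simp_rw [mul_neg, integral_neg, neg_inj] at h1
  rw [h1]
  refine integral_congr_ae (Eventually.of_forall fun y => ?_)
  simp [mul_comm]

/-- Local approximation of `W^{1,2}` functions by smooth functions. -/
theorem IsWeakGradient.exists_smooth_approx {D : Set (EuclideanSpace ℝ (Fin n))} (hD : IsOpen D)
    {f : EuclideanSpace ℝ (Fin n) → ℝ} {a : Fin n → EuclideanSpace ℝ (Fin n) → ℝ}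
    (h : IsWeakGradient D f a) {K : Set (EuclideanSpace ℝ (Fin n))} (hK : IsCompact K)
    (hKD : K ⊆ D) :
    ∃ w : ℕ → EuclideanSpace ℝ (Fin n) → ℝ, (∀ k, ContDiff ℝ ∞ (w k)) ∧
      Tendsto (fun k => eLpNorm (fun x => w k x - f x) 2 (volume.restrict K)) atTop (𝓝 0) ∧
      (∀ i, Tendsto (fun k => eLpNorm (fun x => partialD i (w k) x - a i x) 2
        (volume.restrict K)) atTop (𝓝 0)) ∧
      ∀ᵐ x ∂(volume.restrict K), Tendsto (fun k => w k x) atTop (𝓝 (f x)) := by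
  obtain ⟨ξ, hξ, hξc, hξD, hξ1, hξ01⟩ := exists_cutoff hD hK hKD
  -- Points of K are maxima of ξ, so its gradient vanishes there, even if K has empty interior.
  have hξd : ∀ x ∈ K, ∀ i, partialD i ξ x = 0 := by
    intro x hx i
    have : IsLocalMax ξ x := Eventually.of_forall fun y => by
      rw [hξ1 x hx]; exact (hξ01 y).2
    simp [partialD, this.fderiv_eq_zero]
  -- The cutoff makes ξ f a function of W^{1,2} on all of ℝⁿ, with gradient b given by the product
  -- rule. It can be mollified globally, and v = f, b = a on K.
  set v : EuclideanSpace ℝ (Fin n) → ℝ := fun y => ξ y * f y with hv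
  set b : Fin n → EuclideanSpace ℝ (Fin n) → ℝ :=
    fun i y => ξ y * a i y + partialD i ξ y * f y with hb
  have hvL : MemLp v 2 volume :=
    memLp_mul_of_hasCompactSupport hξ.continuous hξc (h.memLp _ hξD hξc)
  have hbL : ∀ i, MemLp (b i) 2 volume := fun i =>
    (memLp_mul_of_hasCompactSupport hξ.continuous hξc (h.memLp_grad _ hξD hξc i)).add
      (memLp_mul_of_hasCompactSupport (continuous_partialD (hξ.of_le (by simp)) i)
        (hasCompactSupport_partialD hξc i)
        (h.memLp _ ((tsupport_partialD_subset ξ i).trans hξD) (hasCompactSupport_partialD hξc i)))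
  have hvloc : LocallyIntegrable v volume := hvL.locallyIntegrable (by norm_num)
  have hweak : ∀ i, ∀ ψ : EuclideanSpace ℝ (Fin n) → ℝ, ContDiff ℝ ∞ ψ → HasCompactSupport ψ →
      ∫ y, v y * partialD i ψ y = - ∫ y, b i y * ψ y := by
    intro i ψ hψ hψc
    have hts : tsupport (fun y => ξ y * ψ y) ⊆ D := (tsupport_mul_subset_left).trans hξD
    have h1 := h.integral_eq (fun y => ξ y * ψ y) (hξ.mul hψ) hξc.mul_right hts i
    have hz : ∀ y, y ∉ D → ξ y = 0 := fun y hy =>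
      image_eq_zero_of_notMem_tsupport fun hy' => hy (hξD hy')
    have hz' : ∀ y, y ∉ D → partialD i ξ y = 0 := fun y hy =>
      image_eq_zero_of_notMem_tsupport fun hy' => hy (hξD (tsupport_partialD_subset ξ i hy'))
    have hpm : ∀ y, partialD i (fun y => ξ y * ψ y) y
        = ξ y * partialD i ψ y + ψ y * partialD i ξ y := fun y =>
      partialD_mul (hξ.differentiable (by simp) y) (hψ.differentiable (by simp) y) i
    simp_rw [hpm] at h1
    rw [setIntegral_eq_of_tsupport (fun y hy => by simp [hz y hy, hz' y hy]),
      setIntegral_eq_of_tsupport (fun y hy => by simp [hz y hy])] at h1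
    have hψL : MemLp ψ 2 volume := hψ.continuous.memLp_of_hasCompactSupport hψc
    have hpψL : MemLp (partialD i ψ) 2 volume :=
      (continuous_partialD (hψ.of_le (by simp)) i).memLp_of_hasCompactSupport
        (hasCompactSupport_partialD hψc i)
    have hfξ : MemLp (fun y => partialD i ξ y * f y) 2 volume :=
      memLp_mul_of_hasCompactSupport (continuous_partialD (hξ.of_le (by simp)) i)
        (hasCompactSupport_partialD hξc i)
        (h.memLp _ ((tsupport_partialD_subset ξ i).trans hξD) (hasCompactSupport_partialD hξc i))
    have haξ : MemLp (fun y => ξ y * a i y) 2 volume :=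
      memLp_mul_of_hasCompactSupport hξ.continuous hξc (h.memLp_grad _ hξD hξc i)
    have i1 : Integrable (fun y => v y * partialD i ψ y) := hvL.integrable_mul hpψL
    have i2 : Integrable (fun y => (partialD i ξ y * f y) * ψ y) := hfξ.integrable_mul hψL
    have i3 : Integrable (fun y => (ξ y * a i y) * ψ y) := haξ.integrable_mul hψL
    have e1 : ∫ y, f y * (ξ y * partialD i ψ y + ψ y * partialD i ξ y)
        = (∫ y, v y * partialD i ψ y) + ∫ y, (partialD i ξ y * f y) * ψ y := by
      rw [← integral_add i1 i2]
      refine integral_congr_ae (Eventually.of_forall fun y => ?_)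
      simp only [hv]; ring
    have e2 : ∫ y, b i y * ψ y
        = (∫ y, (ξ y * a i y) * ψ y) + ∫ y, (partialD i ξ y * f y) * ψ y := by
      rw [← integral_add i3 i2]
      refine integral_congr_ae (Eventually.of_forall fun y => ?_)
      simp only [hb]; ring
    have e3 : ∫ y, a i y * (ξ y * ψ y) = ∫ y, (ξ y * a i y) * ψ y := by
      refine integral_congr_ae (Eventually.of_forall fun y => ?_)
      simp only []; ring
    rw [e1, e3] at h1
    rw [e2]
    linarith
  have hKm : MeasurableSet K := hK.isClosed.measurableSet
  have restr : ∀ {F : ℕ → EuclideanSpace ℝ (Fin n) → ℝ} {p q : EuclideanSpace ℝ (Fin n) → ℝ},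
      (∀ x ∈ K, p x = q x) →
      Tendsto (fun k => eLpNorm (fun x => F k x - p x) 2 volume) atTop (𝓝 0) →
      Tendsto (fun k => eLpNorm (fun x => F k x - q x) 2 (volume.restrict K)) atTop (𝓝 0) := by
    intro F p q hpq ht
    refine tendsto_of_tendsto_of_tendsto_of_le_of_le tendsto_const_nhds ht
      (fun _ => zero_le) fun k => ?_
    calc eLpNorm (fun x => F k x - q x) 2 (volume.restrict K)
        = eLpNorm (fun x => F k x - p x) 2 (volume.restrict K) := by
          refine eLpNorm_congr_ae ?_
          filter_upwards [ae_restrict_mem hKm] with x hx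
          rw [hpq x hx]
      _ ≤ _ := eLpNorm_mono_measure _ Measure.restrict_le_self
  refine ⟨fun k => (shrinkingBump _ k).normed volume ⋆[ContinuousLinearMap.lsmul ℝ ℝ, volume] v,
    fun k => ?_, ?_, fun i => ?_, ?_⟩
  · exact (shrinkingBump _ k).hasCompactSupport_normed.contDiff_convolution_left _
      (shrinkingBump _ k).contDiff_normed hvloc
  · exact restr (fun x hx => by simp [hv, hξ1 x hx]) (tendsto_eLpNorm_two_mollify_sub hvL)
  · refine restr (p := b i) (fun x hx => by simp [hb, hξ1 x hx, hξd x hx]) ?_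
    simp_rw [partialD_mollify _ hvloc (hweak i)]
    exact tendsto_eLpNorm_two_mollify_sub (hbL i)
  · filter_upwards [ae_restrict_of_ae (ae_tendsto_mollify hvloc), ae_restrict_mem hKm] with x hx hxK
    simpa [hv, hξ1 x hxK] using hx

end AHYamabe
end

/-! ### Integration by parts and the Sobolev inequality for local W^{1,2} functions on open sets -/

noncomputable section

namespace AHYamabe

open Filter Topology
open scoped Convolution

/-- Continuity of the inner product of L². -/
theorem tendsto_integral_mul_of_tendsto_eLpNorm_two {α : Type*} [MeasurableSpace α] {μ : Measure α}
    {p q : ℕ → α → ℝ} {p' q' : α → ℝ} (hp : ∀ k, MemLp (p k) 2 μ) (hq : ∀ k, MemLp (q k) 2 μ)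
    (hp' : MemLp p' 2 μ) (hq' : MemLp q' 2 μ)
    (hpt : Tendsto (fun k => eLpNorm (fun x => p k x - p' x) 2 μ) atTop (𝓝 0))
    (hqt : Tendsto (fun k => eLpNorm (fun x => q k x - q' x) 2 μ) atTop (𝓝 0)) :
    Tendsto (fun k => ∫ x, p k x * q k x ∂μ) atTop (𝓝 (∫ x, p' x * q' x ∂μ)) := by
  have h1 : Tendsto (fun k => (hp k).toLp (p k)) atTop (𝓝 (hp'.toLp p')) :=
    (Lp.tendsto_Lp_iff_tendsto_eLpNorm'' _ hp _ hp').2 hpt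
  have h2 : Tendsto (fun k => (hq k).toLp (q k)) atTop (𝓝 (hq'.toLp q')) :=
    (Lp.tendsto_Lp_iff_tendsto_eLpNorm'' _ hq _ hq').2 hqt
  have key : ∀ {u v : α → ℝ} (hu : MemLp u 2 μ) (hv : MemLp v 2 μ),
      inner ℝ (hu.toLp u) (hv.toLp v) = ∫ x, u x * v x ∂μ := by
    intro u v hu hv
    rw [L2.inner_def]
    refine integral_congr_ae ?_
    filter_upwards [hu.coeFn_toLp, hv.coeFn_toLp] with x hx hy
    simp [hx, hy, mul_comm]
  have := h1.inner (𝕜 := ℝ) h2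
  simpa [key] using this

theorem tendsto_eLpNorm_mul_sub_of_bounded {α : Type*} [MeasurableSpace α] {μ : Measure α}
    {p : ℕ → α → ℝ} {p' b : α → ℝ} {C : ℝ} (hb : ∀ x, ‖b x‖ ≤ C)
    (h : Tendsto (fun k => eLpNorm (fun x => p k x - p' x) 2 μ) atTop (𝓝 0)) :
    Tendsto (fun k => eLpNorm (fun x => b x * p k x - b x * p' x) 2 μ) atTop (𝓝 0) := by
  have h2 : Tendsto (fun k => ENNReal.ofReal C * eLpNorm (fun x => p k x - p' x) 2 μ) atTop
      (𝓝 0) := by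
    simpa using ENNReal.Tendsto.const_mul h (Or.inr ENNReal.ofReal_ne_top)
  refine tendsto_of_tendsto_of_tendsto_of_le_of_le tendsto_const_nhds h2 (fun _ => zero_le)
    fun k => ?_
  refine eLpNorm_le_mul_eLpNorm_of_ae_le_mul (Eventually.of_forall fun x => ?_) 2
  rw [← mul_sub, norm_mul]
  exact mul_le_mul_of_nonneg_right (hb x) (norm_nonneg _)

variable {n : ℕ} {D : Set (EuclideanSpace ℝ (Fin n))} {f : EuclideanSpace ℝ (Fin n) → ℝ}
  {a : Fin n → EuclideanSpace ℝ (Fin n) → ℝ}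

theorem memLp_restrict_of_isCompact {K : Set (EuclideanSpace ℝ (Fin n))} (hK : IsCompact K)
    {g : EuclideanSpace ℝ (Fin n) → ℝ} (hg : Continuous g) (p : ℝ≥0∞) :
    MemLp g p (volume.restrict K) := by
  obtain ⟨C, hC⟩ := hK.exists_bound_of_continuousOn hg.continuousOn
  have : IsFiniteMeasure (volume.restrict K) := ⟨by simpa using hK.measure_lt_top⟩
  refine MemLp.of_bound hg.aestronglyMeasurable C ?_
  filter_upwards [ae_restrict_mem hK.isClosed.measurableSet] with x hx using hC x hx

/-- Integration by parts of the square of a `W^{1,2}` function against a `C¹` function. -/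
theorem IsWeakGradient.integral_sq_mul_partialD (h : IsWeakGradient D f a) (hD : IsOpen D)
    {Z : EuclideanSpace ℝ (Fin n) → ℝ} (hZ : ContDiff ℝ 1 Z) (hZc : HasCompactSupport Z)
    (hZD : tsupport Z ⊆ D) (i : Fin n) :
    ∫ y, f y ^ 2 * partialD i Z y = - 2 * ∫ y, f y * a i y * Z y := by
  obtain ⟨w, hw, hw0, hw1, -⟩ := h.exists_smooth_approx hD hZc hZD
  set K := tsupport Z with hK
  have hKc : IsCompact K := hZc
  have hw1c : ∀ k, Continuous (partialD i (w k)) := fun k =>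
    continuous_partialD ((hw k).of_le (by simp)) i
  have hZ1c : Continuous (partialD i Z) := continuous_partialD hZ i
  have hwL : ∀ k, MemLp (w k) 2 (volume.restrict K) := fun k =>
    memLp_restrict_of_isCompact hKc (hw k).continuous 2
  have hfL := h.memLp K hZD hKc
  have haL := h.memLp_grad K hZD hKc i
  obtain ⟨C, hC⟩ := hZc.exists_bound_of_continuous hZ.continuous
  obtain ⟨C', hC'⟩ := (hasCompactSupport_partialD hZc i).exists_bound_of_continuous hZ1c
  have hbdL : ∀ {g b : EuclideanSpace ℝ (Fin n) → ℝ} {c : ℝ}, MemLp g 2 (volume.restrict K) →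
      Continuous b → (∀ x, ‖b x‖ ≤ c) → MemLp (fun x => b x * g x) 2 (volume.restrict K) := by
    intro g b c hg hb hc
    exact MemLp.of_le_mul (c := c) hg (hb.aestronglyMeasurable.mul hg.1)
      (Eventually.of_forall fun y => by
        rw [norm_mul]; exact mul_le_mul_of_nonneg_right (hc y) (norm_nonneg _))
  -- The identity is classical for the smooth approximants w k. Both sides are L² pairings over the
  -- support of Z and converge there.
  have lim1 : Tendsto (fun k => ∫ y in K, (partialD i Z y * w k y) * w k y) atTop
      (𝓝 (∫ y in K, (partialD i Z y * f y) * f y)) :=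
    tendsto_integral_mul_of_tendsto_eLpNorm_two (fun k => hbdL (hwL k) hZ1c hC') hwL
      (hbdL hfL hZ1c hC') hfL (tendsto_eLpNorm_mul_sub_of_bounded hC' hw0) hw0
  have lim2 : Tendsto (fun k => ∫ y in K, (Z y * w k y) * partialD i (w k) y) atTop
      (𝓝 (∫ y in K, (Z y * f y) * a i y)) :=
    tendsto_integral_mul_of_tendsto_eLpNorm_two (fun k => hbdL (hwL k) hZ.continuous hC)
      (fun k => memLp_restrict_of_isCompact hKc (hw1c k) 2)
      (hbdL hfL hZ.continuous hC) haL (tendsto_eLpNorm_mul_sub_of_bounded hC hw0) (hw1 i)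
  have hz : ∀ y, y ∉ K → Z y = 0 := fun y hy => image_eq_zero_of_notMem_tsupport hy
  have hz' : ∀ y, y ∉ K → partialD i Z y = 0 := fun y hy =>
    image_eq_zero_of_notMem_tsupport fun hy' => hy (tsupport_partialD_subset Z i hy')
  have hk : ∀ k, ∫ y in K, (partialD i Z y * w k y) * w k y
      = - 2 * ∫ y in K, (Z y * w k y) * partialD i (w k) y := by
    intro k
    rw [setIntegral_eq_of_tsupport (fun y hy => by simp [hz' y hy]),
      setIntegral_eq_of_tsupport (fun y hy => by simp [hz y hy])]
    have hsq : ∀ y, fderiv ℝ (fun y => w k y * w k y) y (EuclideanSpace.single i 1)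
        = 2 * (w k y * partialD i (w k) y) := by
      intro y
      have hd := (hw k).differentiable (by simp) y
      rw [fderiv_fun_mul hd hd]
      simp only [partialD, add_apply, smul_apply, smul_eq_mul]
      ring
    have hsqd : Differentiable ℝ (fun y => w k y * w k y) :=
      ((hw k).differentiable (by simp)).mul ((hw k).differentiable (by simp))
    have := integral_mul_fderiv_eq_neg_fderiv_mul_of_integrable (μ := volume)
      (f := fun y => w k y * w k y) (g := Z) (v := EuclideanSpace.single i 1) ?_ ?_ ?_
      (fun y _ => hsqd y) (fun y _ => hZ.differentiable one_ne_zero y)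
    · simp_rw [hsq] at this
      calc _ = ∫ y, w k y * w k y * fderiv ℝ Z y (EuclideanSpace.single i 1) := by
            refine integral_congr_ae (Eventually.of_forall fun y => ?_)
            simp only [partialD]; ring
        _ = _ := by
            rw [this, neg_mul, ← integral_const_mul]
            congr 1
            refine integral_congr_ae (Eventually.of_forall fun y => ?_)
            simp only []; ring
    · simp_rw [hsq]
      exact (((hw k).continuous.mul (hw1c k)).const_mul 2 |>.mul hZ.continuous
        |>.integrable_of_hasCompactSupport hZc.mul_left)
    · exact ((hw k).continuous.mul (hw k).continuous |>.mul hZ1c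
        |>.integrable_of_hasCompactSupport (hasCompactSupport_partialD hZc i).mul_left)
    · exact ((hw k).continuous.mul (hw k).continuous |>.mul hZ.continuous
        |>.integrable_of_hasCompactSupport hZc.mul_left)
  have lim3 := lim2.const_mul (-2)
  simp_rw [← hk] at lim3
  have := tendsto_nhds_unique lim1 lim3
  rw [setIntegral_eq_of_tsupport (fun y hy => by simp [hz' y hy]),
      setIntegral_eq_of_tsupport (fun y hy => by simp [hz y hy])] at this
  calc _ = ∫ y, (partialD i Z y * f y) * f y := by
        refine integral_congr_ae (Eventually.of_forall fun y => ?_)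
        simp only []; ring
    _ = _ := by
        rw [this]
        congr 1
        refine integral_congr_ae (Eventually.of_forall fun y => ?_)
        simp only []; ring

theorem norm_fderiv_le_sum_partialD (g : EuclideanSpace ℝ (Fin n) → ℝ)
    (y : EuclideanSpace ℝ (Fin n)) : ‖fderiv ℝ g y‖ ≤ ∑ i, ‖partialD i g y‖ := by
  refine ContinuousLinearMap.opNorm_le_bound _ (Finset.sum_nonneg fun _ _ => norm_nonneg _)
    fun v => ?_
  have hv : v = ∑ i, v i • EuclideanSpace.single i (1 : ℝ) := by
    ext j
    simp [Finset.sum_apply, Pi.single_apply]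
  conv_lhs => rw [hv]
  rw [map_sum, Finset.sum_mul]
  refine (norm_sum_le _ _).trans (Finset.sum_le_sum fun i _ => ?_)
  rw [map_smul, norm_smul, mul_comm]
  exact mul_le_mul_of_nonneg_left (PiLp.norm_apply_le v i) (norm_nonneg _)

/-- The Sobolev inequality for a `W^{1,2}` function multiplied by a `C¹` cutoff function. -/
theorem exists_sobolev_const (hn : 3 ≤ n) : ∃ C : NNReal,
    ∀ (D : Set (EuclideanSpace ℝ (Fin n))) (f : EuclideanSpace ℝ (Fin n) → ℝ)
      (a : Fin n → EuclideanSpace ℝ (Fin n) → ℝ), IsOpen D → IsWeakGradient D f a →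
      ∀ ζ : EuclideanSpace ℝ (Fin n) → ℝ, ContDiff ℝ 1 ζ → HasCompactSupport ζ → tsupport ζ ⊆ D →
        eLpNorm (fun y => ζ y * f y) (critExp n) volume
          ≤ C * ∑ i, eLpNorm (fun y => ζ y * a i y + f y * partialD i ζ y) 2 volume := by
  have hn' : (3 : ℝ) ≤ n := by exact_mod_cast hn
  refine ⟨SNormLESNormFDerivOfEqConst ℝ (volume : Measure (EuclideanSpace ℝ (Fin n))) 2,
    fun D f a hD h ζ hζ hζc hζD => ?_⟩
  set C := SNormLESNormFDerivOfEqConst ℝ (volume : Measure (EuclideanSpace ℝ (Fin n))) 2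
  obtain ⟨w, hw, hw0, hw1, hwae⟩ := h.exists_smooth_approx hD hζc hζD
  set K := tsupport ζ with hK
  have hKc : IsCompact K := hζc
  have hz : ∀ y, y ∉ K → ζ y = 0 := fun y hy => image_eq_zero_of_notMem_tsupport hy
  have hz' : ∀ i, ∀ y, y ∉ K → partialD i ζ y = 0 := fun i y hy =>
    image_eq_zero_of_notMem_tsupport fun hy' => hy (tsupport_partialD_subset ζ i hy')
  have hKm : MeasurableSet K := hKc.isClosed.measurableSet
  have hwm : ∀ k, ContDiff ℝ 1 (fun y => ζ y * w k y) := fun k => hζ.mul ((hw k).of_le (by simp))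
  have hgns : ∀ k, eLpNorm (fun y => ζ y * w k y) (critExp n) volume
      ≤ C * ∑ i, eLpNorm (fun y => partialD i (fun z => ζ z * w k z) y) 2 volume := by
    intro k
    -- The exponents satisfy 1/N = 1/2 - 1/n, the relation required by the
    -- Gagliardo–Nirenberg–Sobolev inequality.
    have h1 := eLpNorm_le_eLpNorm_fderiv_of_eq (volume : Measure (EuclideanSpace ℝ (Fin n)))
      (u := fun y => ζ y * w k y) (hwm k) hζc.mul_right (p := 2)
      (p' := (2 * (n : ℝ) / ((n : ℝ) - 2)).toNNReal) (by norm_num) (by simp; omega) (by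
        rw [Real.coe_toNNReal _ (div_nonneg (by positivity) (by linarith))]
        simp only [finrank_euclideanSpace, Fintype.card_fin]
        have : (n : ℝ) - 2 ≠ 0 := by linarith
        have : (n : ℝ) ≠ 0 := by linarith
        push_cast
        field_simp)
    refine (h1 : eLpNorm _ (critExp n) _ ≤ _).trans ?_
    refine mul_le_mul_right ?_ _
    calc eLpNorm (fderiv ℝ fun y => ζ y * w k y) 2 volume
        ≤ eLpNorm (fun y => ∑ i, ‖partialD i (fun z => ζ z * w k z) y‖) 2 volume :=
          eLpNorm_mono_real fun y => norm_fderiv_le_sum_partialD _ y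
      _ ≤ ∑ i, eLpNorm (fun y => ‖partialD i (fun z => ζ z * w k z) y‖) 2 volume := by
          have := eLpNorm_sum_le (μ := (volume : Measure (EuclideanSpace ℝ (Fin n)))) (p := 2)
            (s := Finset.univ)
            (f := fun (i : Fin n) y => ‖partialD i (fun z => ζ z * w k z) y‖)
            (fun i _ => (continuous_partialD (hwm k) i).norm.aestronglyMeasurable) (by norm_num)
          convert this using 2
          ext y; simp
      _ = _ := by simp_rw [eLpNorm_norm]
  obtain ⟨B, hB⟩ := hζc.exists_bound_of_continuous hζ.continuous
  have hlim : ∀ i, Tendsto (fun k => eLpNorm (fun y => ζ y * a i y + f y * partialD i ζ y) 2 volume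
      + (eLpNorm (fun y => ζ y * partialD i (w k) y - ζ y * a i y) 2 (volume.restrict K)
        + eLpNorm (fun y => partialD i ζ y * w k y - partialD i ζ y * f y) 2
          (volume.restrict K))) atTop
      (𝓝 (eLpNorm (fun y => ζ y * a i y + f y * partialD i ζ y) 2 volume)) := by
    intro i
    obtain ⟨B', hB'⟩ := (hasCompactSupport_partialD hζc i).exists_bound_of_continuous
      (continuous_partialD hζ i)
    have h1 := tendsto_eLpNorm_mul_sub_of_bounded hB (hw1 i)
    have h2 := tendsto_eLpNorm_mul_sub_of_bounded hB' hw0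
    simpa using tendsto_const_nhds.add (h1.add h2)
  have hle : ∀ i k, eLpNorm (fun y => partialD i (fun z => ζ z * w k z) y) 2 volume
      ≤ eLpNorm (fun y => ζ y * a i y + f y * partialD i ζ y) 2 volume
      + (eLpNorm (fun y => ζ y * partialD i (w k) y - ζ y * a i y) 2 (volume.restrict K)
        + eLpNorm (fun y => partialD i ζ y * w k y - partialD i ζ y * f y) 2
          (volume.restrict K)) := by
    intro i k
    have hrK : eLpNorm (fun y => partialD i (fun z => ζ z * w k z) y) 2 volume
        = eLpNorm (fun y => partialD i (fun z => ζ z * w k z) y) 2 (volume.restrict K) := by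
      rw [← eLpNorm_indicator_eq_eLpNorm_restrict hKm]
      congr 1
      refine (indicator_eq_self.2 fun y hy => ?_).symm
      exact tsupport_mul_subset_left (tsupport_partialD_subset _ i (subset_tsupport _ hy))
    have hfL := h.memLp K hζD hKc
    have haL := h.memLp_grad K hζD hKc i
    have hpz := (continuous_partialD hζ i)
    have hpw := (continuous_partialD ((hw k).of_le (by simp) : ContDiff ℝ 1 (w k)) i)
    have m1 : AEStronglyMeasurable (fun y => ζ y * a i y + f y * partialD i ζ y)
        (volume.restrict K) :=
      (hζ.continuous.aestronglyMeasurable.mul haL.1).add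
        (hfL.1.mul hpz.aestronglyMeasurable)
    have m2 : AEStronglyMeasurable (fun y => ζ y * partialD i (w k) y - ζ y * a i y)
        (volume.restrict K) :=
      (hζ.continuous.mul hpw).aestronglyMeasurable.sub
        (hζ.continuous.aestronglyMeasurable.mul haL.1)
    have m3 : AEStronglyMeasurable (fun y => partialD i ζ y * w k y - partialD i ζ y * f y)
        (volume.restrict K) :=
      (hpz.mul (hw k).continuous).aestronglyMeasurable.sub (hpz.aestronglyMeasurable.mul hfL.1)
    rw [hrK]
    have hsplit : (fun y => partialD i (fun z => ζ z * w k z) y)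
        = (fun y => ζ y * a i y + f y * partialD i ζ y)
          + ((fun y => ζ y * partialD i (w k) y - ζ y * a i y)
            + fun y => partialD i ζ y * w k y - partialD i ζ y * f y) := by
      funext y
      rw [partialD_mul (hζ.differentiable one_ne_zero y) ((hw k).differentiable (by simp) y)]
      simp only [Pi.add_apply]
      ring
    rw [hsplit]
    refine (eLpNorm_add_le m1 (m2.add m3) (by norm_num)).trans ?_
    refine add_le_add (eLpNorm_mono_measure _ Measure.restrict_le_self) ?_
    exact eLpNorm_add_le m2 m3 (by norm_num)
  have hlim2 : Tendsto (fun k => (C : ℝ≥0∞) * ∑ i,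
      (eLpNorm (fun y => ζ y * a i y + f y * partialD i ζ y) 2 volume
      + (eLpNorm (fun y => ζ y * partialD i (w k) y - ζ y * a i y) 2 (volume.restrict K)
        + eLpNorm (fun y => partialD i ζ y * w k y - partialD i ζ y * f y) 2
          (volume.restrict K)))) atTop
      (𝓝 (C * ∑ i, eLpNorm (fun y => ζ y * a i y + f y * partialD i ζ y) 2 volume)) :=
    ENNReal.Tendsto.const_mul (tendsto_finsetSum _ fun i _ => hlim i)
      (Or.inr ENNReal.coe_ne_top)
  have hae : ∀ᵐ y ∂(volume : Measure (EuclideanSpace ℝ (Fin n))),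
      Tendsto (fun k => ζ y * w k y) atTop (𝓝 (ζ y * f y)) := by
    filter_upwards [(ae_restrict_iff' hKm).1 hwae] with y hy
    by_cases hyK : y ∈ K
    · exact (hy hyK).const_mul _
    · simp [hz y hyK]
  -- Fatou's lemma along the almost everywhere convergent approximants; in particular ζ f is not
  -- assumed to lie in L^N beforehand.
  refine (Lp.eLpNorm_lim_le_liminf_eLpNorm
    (fun k => (hwm k).continuous.aestronglyMeasurable) _ hae).trans ?_
  rw [← hlim2.liminf_eq]
  refine liminf_le_liminf (Eventually.of_forall fun k => ?_)
  refine (hgns k).trans (mul_le_mul_right (Finset.sum_le_sum fun i _ => hle i k) _)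

end AHYamabe
end

noncomputable section

namespace AHYamabe

open Filter Topology

/-! ### Curvature of metrics on open subsets of `ℝⁿ` -/

theorem contDiffWithinAt_det {ι F : Type*} [Fintype ι] [DecidableEq ι] [NormedAddCommGroup F]
    [NormedSpace ℝ F] {k : WithTop ℕ∞} {A : F → Matrix ι ι ℝ} {s : Set F} {y : F}
    (hA : ∀ i j, ContDiffWithinAt ℝ k (fun z => A z i j) s y) :
    ContDiffWithinAt ℝ k (fun z => (A z).det) s y := by
  simp_rw [Matrix.det_apply']
  exact ContDiffWithinAt.sum fun σ _ => contDiffWithinAt_const.mul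
    (contDiffWithinAt_prod fun i _ => hA _ _)

/-- By Cramer's rule each entry of the inverse is a quotient of determinants, so it is as regular as
the matrix, also at boundary points of `s`. -/
theorem contDiffWithinAt_matrix_inv {ι F : Type*} [Fintype ι] [DecidableEq ι]
    [NormedAddCommGroup F] [NormedSpace ℝ F] {k : WithTop ℕ∞} {A : F → Matrix ι ι ℝ} {s : Set F}
    {y : F} (hA : ∀ i j, ContDiffWithinAt ℝ k (fun z => A z i j) s y) (hdet : (A y).det ≠ 0)
    (i j : ι) : ContDiffWithinAt ℝ k (fun z => (A z)⁻¹ i j) s y := by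
  have h : ∀ z, (A z)⁻¹ i j = ((A z).det)⁻¹ * ((A z).updateRow j (Pi.single i 1)).det := by
    intro z
    rw [Matrix.inv_def, Matrix.smul_apply, Ring.inverse_eq_inv', Matrix.adjugate_apply,
      smul_eq_mul]
  simp_rw [h]
  refine ((contDiffWithinAt_det hA).inv hdet).mul (contDiffWithinAt_det fun a b => ?_)
  by_cases hab : a = j
  · subst hab
    simp only [Matrix.updateRow_self]
    exact contDiffWithinAt_const
  · simp only [Matrix.updateRow_ne hab]
    exact hA a b

/-- The contraction `∑ Gʲᵏ Rⱼₖ`. -/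
def contract {ι : Type*} [Fintype ι] [DecidableEq ι] (G R : Matrix ι ι ℝ) : ℝ :=
  ∑ j, ∑ k, G⁻¹ j k * R j k

theorem contract_eq_trace {ι : Type*} [Fintype ι] [DecidableEq ι] (G R : Matrix ι ι ℝ) :
    contract G R = (G⁻¹ * R.transpose).trace := by
  simp [contract, Matrix.trace, Matrix.mul_apply]

/-- The contraction is a trace, and J cancels by cyclicity. This is the invariance of a metric
contraction under change of frame, used for Scal and for |α|². -/
theorem contract_congr {ι : Type*} [Fintype ι] [DecidableEq ι] (G R J : Matrix ι ι ℝ)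
    (hJ : IsUnit J.det) :
    contract (J.transpose * G * J) (J.transpose * R * J) = contract G R := by
  rw [contract_eq_trace, contract_eq_trace]
  have hJt : IsUnit J.transpose.det := by rwa [Matrix.det_transpose]
  rw [Matrix.mul_inv_rev, Matrix.mul_inv_rev]
  simp only [Matrix.transpose_mul, Matrix.transpose_transpose]
  calc (J⁻¹ * (G⁻¹ * J.transpose⁻¹) * (J.transpose * (R.transpose * J))).trace
      = (J⁻¹ * (G⁻¹ * ((J.transpose⁻¹ * J.transpose) * R.transpose)) * J).trace := by
        simp only [Matrix.mul_assoc]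
    _ = (G⁻¹ * R.transpose * (J * J⁻¹)).trace := by
        rw [Matrix.nonsing_inv_mul _ hJt, Matrix.one_mul, Matrix.mul_assoc, Matrix.trace_mul_comm,
          Matrix.mul_assoc]
    _ = _ := by rw [Matrix.mul_nonsing_inv _ hJ, Matrix.mul_one]

theorem differentiableAt_sum_smul_const {κ E F : Type*} [Fintype κ] [NormedAddCommGroup E]
    [NormedSpace ℝ E] [NormedAddCommGroup F] [NormedSpace ℝ F] {c : κ → κ → κ → E → ℝ}
    (B : κ → κ → κ → F) {y : E} (h : ∀ k i j, DifferentiableAt ℝ (c k i j) y) :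
    DifferentiableAt ℝ (fun z => ∑ k, ∑ i, ∑ j, c k i j z • B k i j) y :=
  DifferentiableAt.fun_sum fun k _ => DifferentiableAt.fun_sum fun i _ =>
    DifferentiableAt.fun_sum fun j _ => (h k i j).smul_const _

variable {ι E : Type*} [Fintype ι] [DecidableEq ι] [NormedAddCommGroup E] [NormedSpace ℝ E]

theorem isLinearMap_ext (b : Module.Basis ι ℝ E) {F : Type*} [AddCommGroup F] [Module ℝ F]
    {f g : E → F} (hf : IsLinearMap ℝ f) (hg : IsLinearMap ℝ g)
    (h : ∀ i, f (b i) = g (b i)) (v : E) : f v = g v := by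
  have : hf.mk' f = hg.mk' g := b.ext fun i => by simpa using h i
  exact congrArg (fun L : E →ₗ[ℝ] F => L v) this

/-- The Gram matrix, in the basis `b`, of a field of bilinear forms. -/
def gram (b : Module.Basis ι ℝ E) (H : E → E →L[ℝ] E →L[ℝ] ℝ) (y : E) : Matrix ι ι ℝ :=
  Matrix.of fun i j => H y (b i) (b j)

/-- The Christoffel symbols of a field of matrices, in the coordinates of the basis `b`. -/
def chr (b : Module.Basis ι ℝ E) (G : E → Matrix ι ι ℝ) (k i j : ι) (y : E) : ℝ :=
  (1 / 2) * ∑ l, (G y)⁻¹ k l *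
    (fderiv ℝ (fun z => G z j l) y (b i) + fderiv ℝ (fun z => G z i l) y (b j)
      - fderiv ℝ (fun z => G z i j) y (b l))

/-- The Ricci curvature of a field of matrices, in the coordinates of the basis `b`. -/
def ricciMatrix (b : Module.Basis ι ℝ E) (G : E → Matrix ι ι ℝ) (y : E) : Matrix ι ι ℝ :=
  Matrix.of fun j k =>
    (∑ i, (fderiv ℝ (chr b G i j k) y (b i) - fderiv ℝ (chr b G i i k) y (b j)))
    + ∑ i, ∑ m, (chr b G i i m y * chr b G m j k y - chr b G i j m y * chr b G m i k y)

variable [FiniteDimensional ℝ E]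

/-- The bilinear map `(v, w) ↦ vᵢ wⱼ bₖ`. -/
def elementaryBilin (b : Module.Basis ι ℝ E) (k i j : ι) : E →L[ℝ] E →L[ℝ] E :=
  (LinearMap.toContinuousLinearMap (b.coord i)).smulRight
    ((LinearMap.toContinuousLinearMap (b.coord j)).smulRight (b k))

/-- The Christoffel symbols as a bilinear map. -/
def chrMap (b : Module.Basis ι ℝ E) (G : E → Matrix ι ι ℝ) (y : E) : E →L[ℝ] E →L[ℝ] E :=
  ∑ k, ∑ i, ∑ j, chr b G k i j y • elementaryBilin b k i j

variable {b : Module.Basis ι ℝ E}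

theorem chrMap_basis (G : E → Matrix ι ι ℝ) (y : E) (i j : ι) :
    chrMap b G y (b i) (b j) = ∑ k, chr b G k i j y • b k := by
  simp only [chrMap, elementaryBilin, sum_apply, smul_apply, ContinuousLinearMap.smulRight_apply]
  refine Finset.sum_congr rfl fun k _ => ?_
  rw [Finset.sum_eq_single i, Finset.sum_eq_single j]
  · simp
  · intro c _ hc; simp [hc.symm]
  · simp
  · intro c _ hc; simp [hc.symm]
  · simp

theorem repr_chrMap_basis (G : E → Matrix ι ι ℝ) (y : E) (k i j : ι) :
    b.repr (chrMap b G y (b i) (b j)) k = chr b G k i j y := by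
  rw [chrMap_basis]
  simp [Finsupp.single_apply]

theorem fderiv_gram {H : E → E →L[ℝ] E →L[ℝ] ℝ} {y : E} (hH : DifferentiableAt ℝ H y)
    (j l : ι) (v : E) :
    fderiv ℝ (fun z => gram b H z j l) y v = fderiv ℝ H y v (b j) (b l) := by
  have h1 : HasFDerivAt (fun z => H z (b j) (b l)) _ y :=
    (hH.hasFDerivAt.clm_apply (hasFDerivAt_const (b j) y)).clm_apply (hasFDerivAt_const (b l) y)
  have h2 : (fun z => gram b H z j l) = fun z => H z (b j) (b l) := rfl
  rw [h2, h1.fderiv]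
  simp

/-- The characterization of the Christoffel symbols. -/
theorem apply_chrMap {H : E → E →L[ℝ] E →L[ℝ] ℝ} {y : E}
    (hH : DifferentiableAt ℝ H y) (hsymm : ∀ v w, H y v w = H y w v)
    (hdet : IsUnit (gram b H y).det) (u v w : E) :
    H y (chrMap b (gram b H) y u v) w = (1 / 2) * (fderiv ℝ H y u v w + fderiv ℝ H y v u w
      - fderiv ℝ H y w u v) := by
  -- Both sides are linear in u, v and w, so basis vectors suffice. On these, multiplication by the
  -- Gram matrix undoes its inverse in the Christoffel symbols.
  refine isLinearMap_ext b (f := fun u => H y (chrMap b (gram b H) y u v) w)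
    (g := fun u => (1 / 2) * (fderiv ℝ H y u v w + fderiv ℝ H y v u w - fderiv ℝ H y w u v))
    ⟨by simp, by simp⟩ ⟨by intros; simp; ring, by intros; simp; ring⟩ (fun i => ?_) u
  refine isLinearMap_ext b (f := fun v => H y (chrMap b (gram b H) y (b i) v) w)
    (g := fun v => (1 / 2) * (fderiv ℝ H y (b i) v w + fderiv ℝ H y v (b i) w
      - fderiv ℝ H y w (b i) v))
    ⟨by simp, by simp⟩ ⟨by intros; simp; ring, by intros; simp; ring⟩ (fun j => ?_) v
  refine isLinearMap_ext b (f := fun w => H y (chrMap b (gram b H) y (b i) (b j)) w)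
    (g := fun w => (1 / 2) * (fderiv ℝ H y (b i) (b j) w
      + fderiv ℝ H y (b j) (b i) w - fderiv ℝ H y w (b i) (b j)))
    ⟨by simp, by simp⟩ ⟨by intros; simp; ring, by intros; simp; ring⟩ (fun m => ?_) w
  simp only [chrMap_basis, map_sum, map_smul, sum_apply, smul_apply, smul_eq_mul, chr,
    fderiv_gram hH]
  set c : ι → ℝ := fun l => fderiv ℝ H y (b i) (b j) (b l) + fderiv ℝ H y (b j) (b i) (b l)
    - fderiv ℝ H y (b l) (b i) (b j) with hc
  have h1 : ∀ k, H y (b k) (b m) = gram b H y m k := fun k => hsymm _ _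
  have h2 : (gram b H y).mulVec ((gram b H y)⁻¹.mulVec c) m = c m := by
    rw [Matrix.mulVec_mulVec, Matrix.mul_nonsing_inv _ hdet, Matrix.one_mulVec]
  simp only [Matrix.mulVec, dotProduct] at h2
  calc _ = (1 / 2) * ∑ k, gram b H y m k * ∑ l, (gram b H y)⁻¹ k l * c l := by
        rw [Finset.mul_sum]
        refine Finset.sum_congr rfl fun k _ => ?_
        rw [h1]; ring
    _ = _ := by rw [h2]

/-- The curvature tensor. -/
def curv (b : Module.Basis ι ℝ E) (G : E → Matrix ι ι ℝ) (y u v w : E) : E :=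
  fderiv ℝ (chrMap b G) y u v w - fderiv ℝ (chrMap b G) y v u w
    + chrMap b G y u (chrMap b G y v w) - chrMap b G y v (chrMap b G y u w)

theorem differentiableAt_chrMap {G : E → Matrix ι ι ℝ} {y : E}
    (h : ∀ k i j, DifferentiableAt ℝ (chr b G k i j) y) :
    DifferentiableAt ℝ (chrMap b G) y :=
  differentiableAt_sum_smul_const (F := E →L[ℝ] E →L[ℝ] E) (elementaryBilin b) h

theorem repr_fderiv_chrMap_basis {G : E → Matrix ι ι ℝ} {y : E}
    (h : DifferentiableAt ℝ (chrMap b G) y) (k i j : ι) (v : E) :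
    b.repr (fderiv ℝ (chrMap b G) y v (b i) (b j)) k = fderiv ℝ (chr b G k i j) y v := by
  have h1 : HasFDerivAt (fun z => chrMap b G z (b i) (b j)) _ y :=
    (h.hasFDerivAt.clm_apply (hasFDerivAt_const (b i) y)).clm_apply (hasFDerivAt_const (b j) y)
  have h2 := (LinearMap.toContinuousLinearMap (b.coord k)).hasFDerivAt.comp y h1
  have h3 : (LinearMap.toContinuousLinearMap (b.coord k)) ∘ (fun z => chrMap b G z (b i) (b j))
      = chr b G k i j := by
    funext z
    exact repr_chrMap_basis G z k i j
  rw [← h3, h2.fderiv]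
  simp

theorem isLinearMap_curv (G : E → Matrix ι ι ℝ) (y v w : E) :
    IsLinearMap ℝ fun u => curv b G y u v w :=
  ⟨by intros; simp [curv]; abel, by intros; simp [curv, smul_sub, smul_add]⟩

theorem isLinearMap_curv₂ (G : E → Matrix ι ι ℝ) (y u w : E) :
    IsLinearMap ℝ fun v => curv b G y u v w :=
  ⟨by intros; simp [curv]; abel, by intros; simp [curv, smul_sub, smul_add]⟩

theorem isLinearMap_curv₃ (G : E → Matrix ι ι ℝ) (y u v : E) :
    IsLinearMap ℝ fun w => curv b G y u v w :=
  ⟨by intros; simp [curv]; abel, by intros; simp [curv, smul_sub, smul_add]⟩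

/-- The Ricci curvature as a trace of the curvature tensor. -/
def ricciForm (b : Module.Basis ι ℝ E) (G : E → Matrix ι ι ℝ) (y v w : E) : ℝ :=
  LinearMap.trace ℝ _ ((isLinearMap_curv (b := b) G y v w).mk' _)

theorem ricciForm_eq_sum (G : E → Matrix ι ι ℝ) (y v w : E) :
    ricciForm b G y v w = ∑ i, b.repr (curv b G y (b i) v w) i := by
  rw [ricciForm, LinearMap.trace_eq_matrix_trace ℝ b]
  simp [Matrix.trace, LinearMap.toMatrix_apply]

/-- Identifies the coordinate formula with the trace of u ↦ R(u, v)w, whose behaviour under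
diffeomorphisms follows from that of the curvature tensor. -/
theorem ricciMatrix_eq {G : E → Matrix ι ι ℝ} {y : E}
    (h : ∀ k i j, DifferentiableAt ℝ (chr b G k i j) y) (j k : ι) :
    ricciMatrix b G y j k = ricciForm b G y (b j) (b k) := by
  have hd := differentiableAt_chrMap h
  have hlin : ∀ (i j : ι) (v : E),
      b.repr (chrMap b G y (b i) v) j = ∑ m, chr b G j i m y * b.repr v m := by
    intro i j v
    conv_lhs => rw [← b.sum_repr v]
    simp only [map_sum, map_smul, Finsupp.coe_finsetSum, Finset.sum_apply, Finsupp.smul_apply,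
      smul_eq_mul, repr_chrMap_basis]
    exact Finset.sum_congr rfl fun m _ => mul_comm _ _
  rw [ricciForm_eq_sum, ricciMatrix, Matrix.of_apply, ← Finset.sum_add_distrib]
  refine Finset.sum_congr rfl fun i _ => ?_
  simp only [curv, map_sub, map_add, Finsupp.sub_apply, Finsupp.add_apply,
    repr_fderiv_chrMap_basis hd]
  rw [hlin, hlin]
  simp only [repr_chrMap_basis, Finset.sum_sub_distrib]
  ring

end AHYamabe
end

/-! ### Transformation of the curvature under local diffeomorphisms -/

noncomputable section

namespace AHYamabe

open Filter Topology

variable {ι E : Type*} [Fintype ι] [DecidableEq ι] [NormedAddCommGroup E] [NormedSpace ℝ E]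
  {b : Module.Basis ι ℝ E}

theorem posDef_of_bilin (b : Module.Basis ι ℝ E) {B : E → E → ℝ} (hl : ∀ w, IsLinearMap ℝ fun v => B v w)
    (hsymm : ∀ v w, B v w = B w v) (hpos : ∀ v, v ≠ 0 → 0 < B v v) :
    (Matrix.of fun i j => B (b i) (b j)).PosDef := by
  refine Matrix.PosDef.of_dotProduct_mulVec_pos ?_ fun x hx => ?_
  · ext i j
    simp [Matrix.conjTranspose_apply, hsymm]
  · have hr : ∀ v, IsLinearMap ℝ fun w => B v w := fun v => by
      have := hl v
      simpa only [hsymm _ v] using this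
    set v := ∑ i, x i • b i with hv
    have hv0 : v ≠ 0 := by
      intro h0
      apply hx
      funext i
      have := congrArg (fun w => b.repr w i) h0
      simpa [hv, Finsupp.single_apply] using this
    have h1 : ∀ w, B v w = ∑ i, x i * B (b i) w := by
      intro w
      have : (hl w).mk' _ v = ∑ i, x i * B (b i) w := by
        rw [hv, map_sum]
        simp
      exact this
    have h2 : ∀ u, B u v = ∑ i, x i * B u (b i) := by
      intro u
      have : (hr u).mk' _ v = ∑ i, x i * B u (b i) := by
        rw [hv, map_sum]
        simp
      exact this
    have h3 := hpos v hv0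
    rw [h1] at h3
    simp only [h2] at h3
    refine h3.trans_eq ?_
    simp only [dotProduct, Matrix.mulVec, Matrix.of_apply, Pi.star_apply, star_trivial, mul_comm]

theorem gram_posDef {H : E → E →L[ℝ] E →L[ℝ] ℝ} {y : E} (hsymm : ∀ v w, H y v w = H y w v)
    (hpos : ∀ v, v ≠ 0 → 0 < H y v v) : (gram b H y).PosDef :=
  posDef_of_bilin b (B := fun v w => H y v w) (fun w => ⟨by simp, by simp⟩) hsymm hpos

theorem isUnit_det_gram {H : E → E →L[ℝ] E →L[ℝ] ℝ} {y : E} (hsymm : ∀ v w, H y v w = H y w v)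
    (hpos : ∀ v, v ≠ 0 → 0 < H y v v) : IsUnit (gram b H y).det :=
  (gram_posDef hsymm hpos).det_pos.ne'.isUnit

theorem contDiffAt_chr {G : E → Matrix ι ι ℝ} {y : E} (hG : ∀ i j, ContDiffAt ℝ 2 (fun z => G z i j) y)
    (hdet : (G y).det ≠ 0) (k i j : ι) : ContDiffAt ℝ 1 (chr b G k i j) y := by
  have h1 : ∀ i j v, ContDiffAt ℝ 1 (fun z => fderiv ℝ (fun x => G x i j) z v) y := fun i j v =>
    ((hG i j).fderiv_right (m := 1) (by norm_num)).clm_apply contDiffAt_const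
  refine contDiffAt_const.mul (ContDiffAt.sum fun l _ => ContDiffAt.mul ?_ ?_)
  · have := contDiffWithinAt_matrix_inv (s := univ) (k := 1)
      (fun i j => ((hG i j).of_le (by norm_num)).contDiffWithinAt) hdet k l
    exact contDiffWithinAt_univ.1 this
  · exact ((h1 _ _ _).add (h1 _ _ _)).sub (h1 _ _ _)

theorem contDiffAt_gram {H : E → E →L[ℝ] E →L[ℝ] ℝ} {y : E} {k : WithTop ℕ∞}
    (hH : ContDiffAt ℝ k H y) (i j : ι) : ContDiffAt ℝ k (fun z => gram b H z i j) y :=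
  (hH.clm_apply contDiffAt_const).clm_apply contDiffAt_const

variable [FiniteDimensional ℝ E]

/-- `G` is, on the open set `U`, the pullback under the local diffeomorphism `φ` of the `C²`
metric `H`. -/
structure IsPullbackMetric (U : Set E) (φ : E → E) (G H : E → E →L[ℝ] E →L[ℝ] ℝ) : Prop where
  isOpen : IsOpen U
  contDiffAt : ∀ y ∈ U, ContDiffAt ℝ 3 φ y
  bijective : ∀ y ∈ U, Function.Bijective (fderiv ℝ φ y)
  contDiffAt_left : ∀ y ∈ U, ContDiffAt ℝ 2 G y
  contDiffAt_right : ∀ y ∈ U, ContDiffAt ℝ 2 H (φ y)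
  symm : ∀ y ∈ U, ∀ v w, H (φ y) v w = H (φ y) w v
  pos : ∀ y ∈ U, ∀ v, v ≠ 0 → 0 < H (φ y) v v
  pullback : ∀ y ∈ U, ∀ v w, G y v w = H (φ y) (fderiv ℝ φ y v) (fderiv ℝ φ y w)

namespace IsPullbackMetric

variable {U : Set E} {φ : E → E} {G H : E → E →L[ℝ] E →L[ℝ] ℝ} {y : E}

theorem symm_left (h : IsPullbackMetric U φ G H) (hy : y ∈ U) (v w : E) : G y v w = G y w v := by
  rw [h.pullback y hy, h.pullback y hy, h.symm y hy]

theorem pos_left (h : IsPullbackMetric U φ G H) (hy : y ∈ U) (v : E) (hv : v ≠ 0) :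
    0 < G y v v := by
  rw [h.pullback y hy]
  refine h.pos y hy _ fun h0 => hv ?_
  exact (h.bijective y hy).1 (by rw [h0, map_zero])

/-- The pullback identity holds near y because U is open, so it may be differentiated. The second
derivatives of φ created here produce the inhomogeneous term in the law of the Christoffel symbols.
-/
theorem fderiv_left (h : IsPullbackMetric U φ G H) (hy : y ∈ U) (u v w : E) :
    fderiv ℝ G y u v w
      = fderiv ℝ H (φ y) (fderiv ℝ φ y u) (fderiv ℝ φ y v) (fderiv ℝ φ y w)
        + H (φ y) (fderiv ℝ (fderiv ℝ φ) y u v) (fderiv ℝ φ y w)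
        + H (φ y) (fderiv ℝ φ y v) (fderiv ℝ (fderiv ℝ φ) y u w) := by
  have hφ : HasFDerivAt φ (fderiv ℝ φ y) y :=
    ((h.contDiffAt y hy).differentiableAt (by norm_num)).hasFDerivAt
  have hA : HasFDerivAt (fderiv ℝ φ) (fderiv ℝ (fderiv ℝ φ) y) y :=
    (((h.contDiffAt y hy).fderiv_right (m := 2) (by norm_num)).differentiableAt
      (by norm_num)).hasFDerivAt
  have hH : HasFDerivAt H (fderiv ℝ H (φ y)) (φ y) :=
    ((h.contDiffAt_right y hy).differentiableAt (by norm_num)).hasFDerivAt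
  have hG : HasFDerivAt G (fderiv ℝ G y) y :=
    ((h.contDiffAt_left y hy).differentiableAt (by norm_num)).hasFDerivAt
  have h1 : HasFDerivAt (fun z => H (φ z) (fderiv ℝ φ z v) (fderiv ℝ φ z w)) _ y :=
    ((hH.comp y hφ).clm_apply (hA.clm_apply (hasFDerivAt_const v y))).clm_apply
      (hA.clm_apply (hasFDerivAt_const w y))
  have h2 : HasFDerivAt (fun z => G z v w) _ y :=
    (hG.clm_apply (hasFDerivAt_const v y)).clm_apply (hasFDerivAt_const w y)
  have h3 : (fun z => G z v w) =ᶠ[𝓝 y] fun z => H (φ z) (fderiv ℝ φ z v) (fderiv ℝ φ z w) := by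
    filter_upwards [h.isOpen.mem_nhds hy] with z hz using h.pullback z hz v w
  have h4 := h2.unique (h1.congr_of_eventuallyEq h3)
  have h5 := congrArg (fun L : E →L[ℝ] ℝ => L u) h4
  simp at h5
  rw [h5]
  ring

/-- The transformation law of the Christoffel symbols. -/
theorem chrMap_eq (h : IsPullbackMetric U φ G H) (hy : y ∈ U) (u v : E) :
    fderiv ℝ φ y (chrMap b (gram b G) y u v)
      = chrMap b (gram b H) (φ y) (fderiv ℝ φ y u) (fderiv ℝ φ y v)
        + fderiv ℝ (fderiv ℝ φ) y u v := by
  have hsy : ∀ u v, fderiv ℝ (fderiv ℝ φ) y u v = fderiv ℝ (fderiv ℝ φ) y v u := fun u v =>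
    (h.contDiffAt y hy).isSymmSndFDerivAt (by simp; norm_num) |>.eq u v
  rw [← sub_eq_zero]
  by_contra hne
  -- The difference of the two sides has the form dφ(w). Pairing it with dφ(w) gives 0, by
  -- `apply_chrMap` for both metrics, which contradicts positivity of H if the difference is
  -- nonzero.
  obtain ⟨w, hw⟩ := (h.bijective y hy).2 (fderiv ℝ φ y (chrMap b (gram b G) y u v)
      - (chrMap b (gram b H) (φ y) (fderiv ℝ φ y u) (fderiv ℝ φ y v)
        + fderiv ℝ (fderiv ℝ φ) y u v))
  have hp := h.pos y hy _ hne
  conv at hp => rhs; arg 2; rw [← hw]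
  refine absurd hp (not_lt.2 (le_of_eq ?_))
  rw [map_sub, map_add, sub_apply, add_apply, ← h.pullback y hy,
    apply_chrMap ((h.contDiffAt_left y hy).differentiableAt (by norm_num)) (h.symm_left hy)
      (isUnit_det_gram (h.symm_left hy) (h.pos_left hy)),
    apply_chrMap ((h.contDiffAt_right y hy).differentiableAt (by norm_num)) (h.symm y hy)
      (isUnit_det_gram (h.symm y hy) (h.pos y hy)),
    h.fderiv_left hy, h.fderiv_left hy, h.fderiv_left hy, hsy v u, hsy w u, hsy w v]
  rw [h.symm y hy (fderiv ℝ φ y v) (fderiv ℝ (fderiv ℝ φ) y u w)]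
  ring

theorem differentiableAt_chrMap_left (h : IsPullbackMetric U φ G H) (hy : y ∈ U) :
    DifferentiableAt ℝ (chrMap b (gram b G)) y :=
  differentiableAt_chrMap fun k i j => (contDiffAt_chr
    (fun i j => contDiffAt_gram (h.contDiffAt_left y hy) i j)
    (isUnit_det_gram (h.symm_left hy) (h.pos_left hy)).ne_zero k i j).differentiableAt one_ne_zero

theorem differentiableAt_chrMap_right (h : IsPullbackMetric U φ G H) (hy : y ∈ U) :
    DifferentiableAt ℝ (chrMap b (gram b H)) (φ y) :=
  differentiableAt_chrMap fun k i j => (contDiffAt_chr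
    (fun i j => contDiffAt_gram (h.contDiffAt_right y hy) i j)
    (isUnit_det_gram (h.symm y hy) (h.pos y hy)).ne_zero k i j).differentiableAt one_ne_zero

/-- The law `chrMap_eq` differentiated in the direction u. The third derivative of φ enters, whence
the hypothesis that φ is C³. -/
theorem fderiv_chrMap_eq (h : IsPullbackMetric U φ G H) (hy : y ∈ U) (u v w : E) :
    fderiv ℝ (fderiv ℝ φ) y u (chrMap b (gram b G) y v w)
        + fderiv ℝ φ y (fderiv ℝ (chrMap b (gram b G)) y u v w)
      = fderiv ℝ (chrMap b (gram b H)) (φ y) (fderiv ℝ φ y u) (fderiv ℝ φ y v) (fderiv ℝ φ y w)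
        + chrMap b (gram b H) (φ y) (fderiv ℝ (fderiv ℝ φ) y u v) (fderiv ℝ φ y w)
        + chrMap b (gram b H) (φ y) (fderiv ℝ φ y v) (fderiv ℝ (fderiv ℝ φ) y u w)
        + fderiv ℝ (fderiv ℝ (fderiv ℝ φ)) y u v w := by
  have hφ : HasFDerivAt φ (fderiv ℝ φ y) y :=
    ((h.contDiffAt y hy).differentiableAt (by norm_num)).hasFDerivAt
  have hA2 := (h.contDiffAt y hy).fderiv_right (m := 2) (by norm_num)
  have hA : HasFDerivAt (fderiv ℝ φ) (fderiv ℝ (fderiv ℝ φ) y) y :=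
    (hA2.differentiableAt (by norm_num)).hasFDerivAt
  have hA' : HasFDerivAt (fderiv ℝ (fderiv ℝ φ)) (fderiv ℝ (fderiv ℝ (fderiv ℝ φ)) y) y :=
    ((hA2.fderiv_right (m := 1) (by norm_num)).differentiableAt (by norm_num)).hasFDerivAt
  have hG := (h.differentiableAt_chrMap_left (b := b) hy).hasFDerivAt
  have hH := (h.differentiableAt_chrMap_right (b := b) hy).hasFDerivAt
  have hHφ : HasFDerivAt (fun z => chrMap b (gram b H) (φ z))
      ((fderiv ℝ (chrMap b (gram b H)) (φ y)).comp (fderiv ℝ φ y)) y :=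
    HasFDerivAt.comp (g := chrMap b (gram b H)) y hH hφ
  have h1 : HasFDerivAt (fun z => fderiv ℝ φ z (chrMap b (gram b G) z v w)) _ y :=
    hA.clm_apply ((hG.clm_apply (hasFDerivAt_const v y)).clm_apply (hasFDerivAt_const w y))
  have h2 : HasFDerivAt (fun z => chrMap b (gram b H) (φ z) (fderiv ℝ φ z v) (fderiv ℝ φ z w)
      + fderiv ℝ (fderiv ℝ φ) z v w) _ y :=
    ((hHφ.clm_apply (hA.clm_apply (hasFDerivAt_const v y))).clm_apply
      (hA.clm_apply (hasFDerivAt_const w y))).add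
      ((hA'.clm_apply (hasFDerivAt_const v y)).clm_apply (hasFDerivAt_const w y))
  have h3 : (fun z => fderiv ℝ φ z (chrMap b (gram b G) z v w)) =ᶠ[𝓝 y]
      fun z => chrMap b (gram b H) (φ z) (fderiv ℝ φ z v) (fderiv ℝ φ z w)
        + fderiv ℝ (fderiv ℝ φ) z v w := by
    filter_upwards [h.isOpen.mem_nhds hy] with z hz using h.chrMap_eq hz v w
  have h4 := h1.unique (h2.congr_of_eventuallyEq h3)
  have h5 := congrArg (fun L : E →L[ℝ] E => L u) h4
  simp at h5
  rw [add_comm, h5]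
  abel

/-- The curvature tensor is a tensor. -/
theorem curv_eq (h : IsPullbackMetric U φ G H) (hy : y ∈ U) (u v w : E) :
    fderiv ℝ φ y (curv b (gram b G) y u v w)
      = curv b (gram b H) (φ y) (fderiv ℝ φ y u) (fderiv ℝ φ y v) (fderiv ℝ φ y w) := by
  have hsy : fderiv ℝ (fderiv ℝ φ) y v u = fderiv ℝ (fderiv ℝ φ) y u v :=
    (h.contDiffAt y hy).isSymmSndFDerivAt (by simp; norm_num) |>.eq v u
  have hsy3 : fderiv ℝ (fderiv ℝ (fderiv ℝ φ)) y v u w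
      = fderiv ℝ (fderiv ℝ (fderiv ℝ φ)) y u v w := by
    have := ((h.contDiffAt y hy).fderiv_right (m := 2) (by norm_num)).isSymmSndFDerivAt (by simp)
      |>.eq v u
    rw [this]
  -- On antisymmetrizing in u and v the third derivatives cancel by symmetry. The remaining second
  -- derivatives of φ cancel against those which the Christoffel law, in t1 to t4, produces in the
  -- quadratic terms.
  have e1 := h.fderiv_chrMap_eq (b := b) hy u v w
  have e2 := h.fderiv_chrMap_eq (b := b) hy v u w
  have t1 := h.chrMap_eq (b := b) hy u (chrMap b (gram b G) y v w)
  have t2 := h.chrMap_eq (b := b) hy v (chrMap b (gram b G) y u w)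
  have t3 := h.chrMap_eq (b := b) hy v w
  have t4 := h.chrMap_eq (b := b) hy u w
  rw [hsy, hsy3] at e2
  rw [t3, map_add] at t1
  rw [t4, map_add] at t2
  simp only [curv, map_add, map_sub]
  rw [eq_sub_of_add_eq' e1, eq_sub_of_add_eq' e2, t1, t2]
  abel

/-- By `curv_eq` the two endomorphisms are conjugate under dφ, so their traces agree. -/
theorem ricciForm_eq (h : IsPullbackMetric U φ G H) (hy : y ∈ U) (v w : E) :
    ricciForm b (gram b G) y v w
      = ricciForm b (gram b H) (φ y) (fderiv ℝ φ y v) (fderiv ℝ φ y w) := by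
  set e : E ≃ₗ[ℝ] E := LinearEquiv.ofBijective (fderiv ℝ φ y : E →ₗ[ℝ] E) (h.bijective y hy)
    with he
  have hea : ∀ x, e x = fderiv ℝ φ y x := fun x => rfl
  rw [ricciForm, ricciForm, ← LinearMap.trace_conj' _ e]
  congr 1
  ext x
  rw [LinearEquiv.conj_apply_apply]
  simp only [IsLinearMap.mk'_apply]
  rw [hea, h.curv_eq hy, ← hea (e.symm x), e.apply_symm_apply]

/-- The Gram and Ricci matrices both transform by Jᵀ · J, and `contract_congr` applies. -/
theorem contract_ricciMatrix_eq (h : IsPullbackMetric U φ G H) (hy : y ∈ U) :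
    contract (gram b G y) (ricciMatrix b (gram b G) y)
      = contract (gram b H (φ y)) (ricciMatrix b (gram b H) (φ y)) := by
  set J : Matrix ι ι ℝ := LinearMap.toMatrix b b (fderiv ℝ φ y : E →ₗ[ℝ] E) with hJ
  have hJb : ∀ i, fderiv ℝ φ y (b i) = ∑ a, J a i • b a := by
    intro i
    rw [← b.sum_repr (fderiv ℝ φ y (b i))]
    simp [hJ, LinearMap.toMatrix_apply]
  have hJu : IsUnit J.det := by
    set e : E ≃ₗ[ℝ] E := LinearEquiv.ofBijective (fderiv ℝ φ y : E →ₗ[ℝ] E) (h.bijective y hy)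
    have := LinearEquiv.isUnit_det e b b
    exact this
  have key : ∀ {B : E → E → ℝ}, (∀ w, IsLinearMap ℝ fun v => B v w) →
      (∀ v, IsLinearMap ℝ fun w => B v w) → ∀ i j,
      B (fderiv ℝ φ y (b i)) (fderiv ℝ φ y (b j))
        = (J.transpose * (Matrix.of fun i j => B (b i) (b j)) * J) i j := by
    intro B hl hr i j
    have h1 : ∀ w, B (fderiv ℝ φ y (b i)) w = ∑ a, J a i * B (b a) w := by
      intro w
      have : (hl w).mk' _ (fderiv ℝ φ y (b i)) = ∑ a, J a i * B (b a) w := by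
        rw [hJb, map_sum]; simp
      exact this
    have h2 : ∀ u, B u (fderiv ℝ φ y (b j)) = ∑ c, J c j * B u (b c) := by
      intro u
      have : (hr u).mk' _ (fderiv ℝ φ y (b j)) = ∑ c, J c j * B u (b c) := by
        rw [hJb, map_sum]; simp
      exact this
    rw [h2]
    simp only [h1, Matrix.mul_apply, Matrix.transpose_apply, Matrix.of_apply]
    exact Finset.sum_congr rfl fun c _ => mul_comm _ _
  have hG : gram b G y = J.transpose * gram b H (φ y) * J := by
    ext i j
    rw [gram, Matrix.of_apply, h.pullback y hy]
    exact key (B := fun v w => H (φ y) v w) (fun w => ⟨by simp, by simp⟩)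
      (fun w => ⟨by simp, by simp⟩) i j
  have dG : ∀ k i j, DifferentiableAt ℝ (chr b (gram b G) k i j) y := fun k i j =>
    (contDiffAt_chr (fun i j => contDiffAt_gram (h.contDiffAt_left y hy) i j)
      (isUnit_det_gram (h.symm_left hy) (h.pos_left hy)).ne_zero k i j).differentiableAt
      one_ne_zero
  have dH : ∀ k i j, DifferentiableAt ℝ (chr b (gram b H) k i j) (φ y) := fun k i j =>
    (contDiffAt_chr (fun i j => contDiffAt_gram (h.contDiffAt_right y hy) i j)
      (isUnit_det_gram (h.symm y hy) (h.pos y hy)).ne_zero k i j).differentiableAt one_ne_zero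
  have hR : ricciMatrix b (gram b G) y = J.transpose * ricciMatrix b (gram b H) (φ y) * J := by
    have hRH : ricciMatrix b (gram b H) (φ y)
        = Matrix.of fun i j => ricciForm b (gram b H) (φ y) (b i) (b j) := by
      ext i j
      rw [ricciMatrix_eq dH, Matrix.of_apply]
    ext i j
    rw [ricciMatrix_eq dG, h.ricciForm_eq hy, hRH]
    refine key (B := fun v w => ricciForm b (gram b H) (φ y) v w) (fun w => ?_) (fun v => ?_) i j
    · constructor
      · intro v v'
        simp only [ricciForm_eq_sum]
        rw [← Finset.sum_add_distrib]
        refine Finset.sum_congr rfl fun i _ => ?_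
        rw [(isLinearMap_curv₂ (b := b) _ _ _ _).map_add]
        simp
      · intro c v
        simp only [ricciForm_eq_sum, smul_eq_mul, Finset.mul_sum]
        refine Finset.sum_congr rfl fun i _ => ?_
        rw [(isLinearMap_curv₂ (b := b) _ _ _ _).map_smul]
        simp
    · constructor
      · intro v v'
        simp only [ricciForm_eq_sum]
        rw [← Finset.sum_add_distrib]
        refine Finset.sum_congr rfl fun i _ => ?_
        rw [(isLinearMap_curv₃ (b := b) _ _ _ _).map_add]
        simp
      · intro c v
        simp only [ricciForm_eq_sum, smul_eq_mul, Finset.mul_sum]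
        refine Finset.sum_congr rfl fun i _ => ?_
        rw [(isLinearMap_curv₃ (b := b) _ _ _ _).map_smul]
        simp
  rw [hG, hR, contract_congr _ _ _ hJu]

end IsPullbackMetric

end AHYamabe
end

noncomputable section

namespace AHYamabe

open Filter Topology

/-! ### Conformal change of the scalar curvature -/

section Algebra

variable {ι : Type*} [Fintype ι] [DecidableEq ι]

/-- The tensor `Tᵏᵢⱼ` such that the Christoffel symbols of `r⁻² P` and `P` differ by `r⁻¹ T`, where
`w` is the differential of `r` and `V` its gradient. -/
def conformalTensor (P : Matrix ι ι ℝ) (w V : ι → ℝ) (k i j : ι) : ℝ :=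
  P i j * V k - w i * (if k = j then 1 else 0) - w j * (if k = i then 1 else 0)

variable {P : Matrix ι ι ℝ} {w V : ι → ℝ}

theorem sum_conformalTensor_trace (hs : ∀ i j, P i j = P j i) (hV : ∀ k, ∑ i, P k i * V i = w k)
    (k : ι) : ∑ i, conformalTensor P w V i i k = - (Fintype.card ι) * w k := by
  simp only [conformalTensor, Finset.sum_sub_distrib]
  have h1 : ∑ i, P i k * V i = w k := by rw [← hV k]; simp_rw [hs k]
  rw [h1]
  simp

theorem sum_mul_conformalTensor (j k : ι) :
    ∑ i, w i * conformalTensor P w V i j k = P j k * (∑ i, w i * V i) - 2 * w j * w k := by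
  have : ∀ i, w i * conformalTensor P w V i j k = P j k * (w i * V i)
      - w j * (if i = k then w i else 0) - w k * (if i = j then w i else 0) := by
    intro i
    simp only [conformalTensor]
    split_ifs <;> ring
  simp_rw [this, Finset.sum_sub_distrib, ← Finset.mul_sum]
  simp
  ring

theorem sum_metric_mul_conformalTensor (hV : ∀ k, ∑ i, P k i * V i = w k)
    (i j k : ι) : ∑ m, P j m * conformalTensor P w V m i k
      = P i k * w j - w i * P j k - w k * P j i := by
  have : ∀ m, P j m * conformalTensor P w V m i k = P i k * (P j m * V m)
      - w i * (if m = k then P j m else 0) - w k * (if m = i then P j m else 0) := by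
    intro m
    simp only [conformalTensor]
    split_ifs <;> ring
  simp_rw [this, Finset.sum_sub_distrib, ← Finset.mul_sum, hV]
  simp

theorem sum_conformalTensor_mul (hs : ∀ i j, P i j = P j i) (hV : ∀ k, ∑ i, P k i * V i = w k)
    (j k : ι) :
    ∑ i, ∑ m, conformalTensor P w V i j m * conformalTensor P w V m i k
      = (Fintype.card ι + 2) * w j * w k - 2 * P j k * ∑ i, w i * V i := by
  have h1 : ∀ i, ∑ m, conformalTensor P w V i j m * conformalTensor P w V m i k
      = V i * (P i k * w j - w i * P j k - w k * P j i)
        - w j * conformalTensor P w V i i k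
        - (if i = j then (P j k * (∑ i, w i * V i) - 2 * w j * w k) else 0) := by
    intro i
    have : ∀ m, conformalTensor P w V i j m * conformalTensor P w V m i k
        = V i * (P j m * conformalTensor P w V m i k)
          - w j * (if i = m then conformalTensor P w V m i k else 0)
          - (if i = j then w m * conformalTensor P w V m i k else 0) := by
      intro m
      rw [conformalTensor]
      split_ifs <;> ring
    simp_rw [this, Finset.sum_sub_distrib, ← Finset.mul_sum, sum_metric_mul_conformalTensor hV]
    congr 1
    · simp
    · split_ifs with hij
      · rw [sum_mul_conformalTensor, hij]
      · simp
  simp_rw [h1, Finset.sum_sub_distrib, ← Finset.mul_sum, sum_conformalTensor_trace hs hV]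
  have h2 : ∑ i, V i * (P i k * w j - w i * P j k - w k * P j i)
      = - (P j k * ∑ i, w i * V i) := by
    have : ∀ i, V i * (P i k * w j - w i * P j k - w k * P j i)
        = w j * (P k i * V i) - P j k * (w i * V i) - w k * (P j i * V i) := by
      intro i; rw [hs i k]; ring
    simp_rw [this, Finset.sum_sub_distrib, ← Finset.mul_sum, hV]
    ring
  rw [h2]
  simp
  ring

/-- The most singular part of the Ricci curvature of `r⁻² P`. -/
theorem conformal_leading_part (hs : ∀ i j, P i j = P j i) (hV : ∀ k, ∑ i, P k i * V i = w k)
    (j k : ι) :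
    (∑ i, (w j * conformalTensor P w V i i k - w i * conformalTensor P w V i j k))
      + ∑ i, ∑ m, (conformalTensor P w V i i m * conformalTensor P w V m j k
        - conformalTensor P w V i j m * conformalTensor P w V m i k)
      = - ((Fintype.card ι : ℝ) - 1) * (∑ i, w i * V i) * P j k := by
  simp only [Finset.sum_sub_distrib]
  rw [← Finset.mul_sum, sum_conformalTensor_trace hs hV, sum_mul_conformalTensor,
    sum_conformalTensor_mul hs hV, Finset.sum_comm]
  simp_rw [← Finset.sum_mul, sum_conformalTensor_trace hs hV, mul_assoc, ← Finset.mul_sum,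
    sum_mul_conformalTensor]
  ring

/-- The arrays dΓ and dT stand for the partial derivatives of Γ and of the conformal tensor, the
first index being the direction; the terms in r⁻² w come from differentiating r⁻¹. Sorting by powers
of r, the order r⁻² is `conformal_leading_part`. The inverse metric contributes r², so all the rest
keeps a factor r. -/
theorem contract_ricci_conformal {r : ℝ} (hr : r ≠ 0) (hdet : IsUnit P.det)
    (hs : ∀ i j, P i j = P j i) (hV : ∀ k, ∑ i, P k i * V i = w k) {R : Matrix ι ι ℝ}
    (Γ : ι → ι → ι → ℝ) (dΓ dT : ι → ι → ι → ι → ℝ)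
    (hR : ∀ j k, R j k = (∑ i, ((dΓ i i j k + r⁻¹ * dT i i j k
        - r⁻¹ ^ 2 * w i * conformalTensor P w V i j k)
      - (dΓ j i i k + r⁻¹ * dT j i i k - r⁻¹ ^ 2 * w j * conformalTensor P w V i i k)))
      + ∑ i, ∑ m, ((Γ i i m + r⁻¹ * conformalTensor P w V i i m)
          * (Γ m j k + r⁻¹ * conformalTensor P w V m j k)
        - (Γ i j m + r⁻¹ * conformalTensor P w V i j m)
          * (Γ m i k + r⁻¹ * conformalTensor P w V m i k))) :
    contract (r⁻¹ ^ 2 • P) R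
      = - ((Fintype.card ι : ℝ) * ((Fintype.card ι : ℝ) - 1)) * (∑ i, w i * V i)
        + r * contract P (Matrix.of fun j k => 
          ((∑ i, (dT i i j k - dT j i i k))
            + ∑ i, ∑ m, (Γ i i m * conformalTensor P w V m j k
              + conformalTensor P w V i i m * Γ m j k
              - Γ i j m * conformalTensor P w V m i k
              - conformalTensor P w V i j m * Γ m i k))
          + r * ((∑ i, (dΓ i i j k - dΓ j i i k))
            + ∑ i, ∑ m, (Γ i i m * Γ m j k - Γ i j m * Γ m i k))) := by
  have hinv : (r⁻¹ ^ 2 • P)⁻¹ = r ^ 2 • P⁻¹ := by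
    refine Matrix.inv_eq_left_inv ?_
    rw [Matrix.smul_mul, Matrix.mul_smul, smul_smul, Matrix.nonsing_inv_mul _ hdet]
    rw [← mul_pow, mul_inv_cancel₀ hr, one_pow, one_smul]
  set X : ι → ι → ℝ := fun j k => (∑ i, (dT i i j k - dT j i i k))
            + ∑ i, ∑ m, (Γ i i m * conformalTensor P w V m j k
              + conformalTensor P w V i i m * Γ m j k
              - Γ i j m * conformalTensor P w V m i k
              - conformalTensor P w V i j m * Γ m i k) with hX
  set Y : ι → ι → ℝ := fun j k => (∑ i, (dΓ i i j k - dΓ j i i k))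
            + ∑ i, ∑ m, (Γ i i m * Γ m j k - Γ i j m * Γ m i k) with hY
  set s := ∑ i, w i * V i with hsdef
  have hR' : ∀ j k, R j k = r⁻¹ ^ 2 * (- ((Fintype.card ι : ℝ) - 1) * s * P j k)
      + r⁻¹ * X j k + Y j k := by
    intro j k
    rw [hR, ← conformal_leading_part hs hV]
    simp only [hX, hY]
    have h1 : (∑ i, ((dΓ i i j k + r⁻¹ * dT i i j k
        - r⁻¹ ^ 2 * w i * conformalTensor P w V i j k)
        - (dΓ j i i k + r⁻¹ * dT j i i k - r⁻¹ ^ 2 * w j * conformalTensor P w V i i k)))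
        = r⁻¹ ^ 2 * (∑ i, (w j * conformalTensor P w V i i k - w i * conformalTensor P w V i j k))
          + r⁻¹ * (∑ i, (dT i i j k - dT j i i k)) + ∑ i, (dΓ i i j k - dΓ j i i k) := by
      rw [Finset.mul_sum, Finset.mul_sum, ← Finset.sum_add_distrib, ← Finset.sum_add_distrib]
      exact Finset.sum_congr rfl fun i _ => by ring
    have h2 : (∑ i, ∑ m, ((Γ i i m + r⁻¹ * conformalTensor P w V i i m)
          * (Γ m j k + r⁻¹ * conformalTensor P w V m j k)
        - (Γ i j m + r⁻¹ * conformalTensor P w V i j m)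
          * (Γ m i k + r⁻¹ * conformalTensor P w V m i k)))
        = r⁻¹ ^ 2 * (∑ i, ∑ m, (conformalTensor P w V i i m * conformalTensor P w V m j k
            - conformalTensor P w V i j m * conformalTensor P w V m i k))
          + r⁻¹ * (∑ i, ∑ m, (Γ i i m * conformalTensor P w V m j k
              + conformalTensor P w V i i m * Γ m j k
              - Γ i j m * conformalTensor P w V m i k
              - conformalTensor P w V i j m * Γ m i k))
          + ∑ i, ∑ m, (Γ i i m * Γ m j k - Γ i j m * Γ m i k) := by
      rw [Finset.mul_sum, Finset.mul_sum, ← Finset.sum_add_distrib, ← Finset.sum_add_distrib]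
      refine Finset.sum_congr rfl fun i _ => ?_
      rw [Finset.mul_sum, Finset.mul_sum, ← Finset.sum_add_distrib, ← Finset.sum_add_distrib]
      exact Finset.sum_congr rfl fun m _ => by ring
    rw [h1, h2]
    ring
  have htr : ∑ j, ∑ k, P⁻¹ j k * P j k = Fintype.card ι := by
    have : (P⁻¹ * P).trace = Fintype.card ι := by
      rw [Matrix.nonsing_inv_mul _ hdet, Matrix.trace_one]
    rw [← this]
    simp only [Matrix.trace, Matrix.diag, Matrix.mul_apply]
    exact Finset.sum_congr rfl fun j _ => Finset.sum_congr rfl fun k _ => by rw [hs j k]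
  simp only [contract, hinv, Matrix.smul_apply, smul_eq_mul, Matrix.of_apply, hR']
  have : ∀ j k, r ^ 2 * P⁻¹ j k * (r⁻¹ ^ 2 * (- ((Fintype.card ι : ℝ) - 1) * s * P j k)
      + r⁻¹ * X j k + Y j k)
      = (- ((Fintype.card ι : ℝ) - 1) * s) * (P⁻¹ j k * P j k)
        + r * (P⁻¹ j k * (X j k + r * Y j k)) := by
    intro j k
    field_simp
    ring
  simp_rw [this, Finset.sum_add_distrib, ← Finset.mul_sum, htr]
  ring

end Algebra

end AHYamabe
end

/-! ### The scalar curvature of a conformally compact metric, up to the boundary -/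

noncomputable section

namespace AHYamabe

open Filter Topology

variable {ι E : Type*} [Fintype ι] [DecidableEq ι] [NormedAddCommGroup E] [NormedSpace ℝ E]
  {b : Module.Basis ι ℝ E}

theorem contDiffOn_fderivWithin_apply {f : E → ℝ} {T : Set E} {k m : WithTop ℕ∞}
    (hT : UniqueDiffOn ℝ T) (hf : ContDiffOn ℝ k f T) (hmk : m + 1 ≤ k) (v : E) :
    ContDiffOn ℝ m (fun y => fderivWithin ℝ f T y v) T :=
  (hf.fderivWithin hT hmk).clm_apply contDiffOn_const

theorem ContDiffOn.hasFDerivAt_of_mem_interior {f : E → ℝ} {T : Set E} {k : WithTop ℕ∞}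
    (hf : ContDiffOn ℝ k f T) (hk : k ≠ 0) {y : E} (hy : y ∈ interior T) :
    HasFDerivAt f (fderivWithin ℝ f T y) y := by
  have hn : T ∈ 𝓝 y := mem_interior_iff_mem_nhds.1 hy
  rw [fderivWithin_of_mem_nhds hn]
  exact ((hf y (interior_subset hy)).contDiffAt hn).differentiableAt hk |>.hasFDerivAt

/-- The Christoffel symbols up to the boundary of `T`. -/
def chrWithin (b : Module.Basis ι ℝ E) (T : Set E) (P : E → Matrix ι ι ℝ) (k i j : ι) (y : E) : ℝ :=
  (1 / 2) * ∑ l, (P y)⁻¹ k l *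
    (fderivWithin ℝ (fun z => P z j l) T y (b i) + fderivWithin ℝ (fun z => P z i l) T y (b j)
      - fderivWithin ℝ (fun z => P z i j) T y (b l))

/-- The components of the differential of `r`, up to the boundary of `T`. -/
def diffWithin (b : Module.Basis ι ℝ E) (T : Set E) (r : E → ℝ) (y : E) (i : ι) : ℝ :=
  fderivWithin ℝ r T y (b i)

/-- The components of the gradient of `r` for the metric `P`, up to the boundary of `T`. -/
def gradWithin (b : Module.Basis ι ℝ E) (T : Set E) (P : E → Matrix ι ι ℝ) (r : E → ℝ) (y : E)
    (k : ι) : ℝ :=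
  ∑ l, (P y)⁻¹ k l * diffWithin b T r y l

/-- The squared norm of the differential of `r` for the metric `P`, up to the boundary of `T`. -/
def diffNormSq (b : Module.Basis ι ℝ E) (T : Set E) (P : E → Matrix ι ι ℝ) (r : E → ℝ)
    (y : E) : ℝ :=
  ∑ i, diffWithin b T r y i * gradWithin b T P r y i

section

variable {T : Set E} {P : E → Matrix ι ι ℝ} {r : E → ℝ}

theorem contDiffOn_inv (hP : ∀ i j, ContDiffOn ℝ 2 (fun y => P y i j) T)
    (hdet : ∀ y ∈ T, (P y).det ≠ 0) (i j : ι) : ContDiffOn ℝ 2 (fun y => (P y)⁻¹ i j) T :=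
  fun y hy => contDiffWithinAt_matrix_inv (fun i j => hP i j y hy) (hdet y hy) i j

theorem contDiffOn_chrWithin (hT : UniqueDiffOn ℝ T)
    (hP : ∀ i j, ContDiffOn ℝ 2 (fun y => P y i j) T) (hdet : ∀ y ∈ T, (P y).det ≠ 0)
    (k i j : ι) : ContDiffOn ℝ 1 (chrWithin b T P k i j) T := by
  have h1 : ∀ i j v, ContDiffOn ℝ 1 (fun y => fderivWithin ℝ (fun z => P z i j) T y v) T :=
    fun i j v => contDiffOn_fderivWithin_apply hT (hP i j) (by norm_num) v
  refine contDiffOn_const.mul (ContDiffOn.sum fun l _ => ContDiffOn.mul ?_ ?_)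
  · exact (contDiffOn_inv hP hdet k l).of_le (by norm_num)
  · exact ((h1 _ _ _).add (h1 _ _ _)).sub (h1 _ _ _)

theorem contDiffOn_diffWithin (hT : UniqueDiffOn ℝ T) (hr : ContDiffOn ℝ 2 r T) (i : ι) :
    ContDiffOn ℝ 1 (fun y => diffWithin b T r y i) T :=
  contDiffOn_fderivWithin_apply hT hr (by norm_num) _

theorem contDiffOn_gradWithin (hT : UniqueDiffOn ℝ T)
    (hP : ∀ i j, ContDiffOn ℝ 2 (fun y => P y i j) T) (hdet : ∀ y ∈ T, (P y).det ≠ 0)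
    (hr : ContDiffOn ℝ 2 r T) (k : ι) : ContDiffOn ℝ 1 (fun y => gradWithin b T P r y k) T :=
  ContDiffOn.sum fun l _ => ((contDiffOn_inv hP hdet k l).of_le (by norm_num)).mul
    (contDiffOn_diffWithin hT hr l)

theorem contDiffOn_diffNormSq (hT : UniqueDiffOn ℝ T)
    (hP : ∀ i j, ContDiffOn ℝ 2 (fun y => P y i j) T) (hdet : ∀ y ∈ T, (P y).det ≠ 0)
    (hr : ContDiffOn ℝ 2 r T) : ContDiffOn ℝ 1 (diffNormSq b T P r) T :=
  ContDiffOn.sum fun l _ => (contDiffOn_diffWithin hT hr l).mul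
    (contDiffOn_gradWithin hT hP hdet hr l)

theorem contDiffOn_conformalTensor (hT : UniqueDiffOn ℝ T)
    (hP : ∀ i j, ContDiffOn ℝ 2 (fun y => P y i j) T) (hdet : ∀ y ∈ T, (P y).det ≠ 0)
    (hr : ContDiffOn ℝ 2 r T) (k i j : ι) :
    ContDiffOn ℝ 1 (fun y => conformalTensor (P y) (diffWithin b T r y)
      (gradWithin b T P r y) k i j) T :=
  ((((hP i j).of_le (by norm_num)).mul (contDiffOn_gradWithin hT hP hdet hr k)).sub
    ((contDiffOn_diffWithin hT hr i).mul contDiffOn_const)).sub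
    ((contDiffOn_diffWithin hT hr j).mul contDiffOn_const)

theorem sum_mul_gradWithin {y : E} (hdet : (P y).det ≠ 0) (k : ι) :
    ∑ i, P y k i * gradWithin b T P r y i = diffWithin b T r y k := by
  have h2 : (P y).mulVec ((P y)⁻¹.mulVec (diffWithin b T r y)) k = diffWithin b T r y k := by
    rw [Matrix.mulVec_mulVec, Matrix.mul_nonsing_inv _ hdet.isUnit, Matrix.one_mulVec]
  simpa only [Matrix.mulVec, dotProduct, gradWithin] using h2

theorem hasFDerivAt_inv_of_mem_interior (hr : ContDiffOn ℝ 2 r T) {y : E} (hy : y ∈ interior T)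
    (hry : r y ≠ 0) :
    HasFDerivAt (fun z => (r z)⁻¹) (-((r y)⁻¹ ^ 2) • fderivWithin ℝ r T y) y := by
  have h1 := ContDiffOn.hasFDerivAt_of_mem_interior hr (by norm_num) hy
  have h2 := (hasDerivAt_inv hry).comp_hasFDerivAt y h1
  simpa [Function.comp_def, inv_pow] using h2

/-- Differentiating the factor r⁻² adds -2 r⁻³ dr ⊗ P to the derivatives of the metric. Raising an
index with r² P⁻¹ turns this into r⁻¹ times the conformal tensor. -/
theorem chr_conformal {G : E → Matrix ι ι ℝ}
    (hP : ∀ i j, ContDiffOn ℝ 2 (fun y => P y i j) T) (hdet : ∀ y ∈ T, (P y).det ≠ 0)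
    (hs : ∀ y ∈ T, ∀ i j, P y i j = P y j i) (hr : ContDiffOn ℝ 2 r T)
    (hr0 : ∀ y ∈ interior T, r y ≠ 0) (hG : ∀ y ∈ interior T, G y = (r y)⁻¹ ^ 2 • P y)
    {y : E} (hy : y ∈ interior T) (k i j : ι) :
    chr b G k i j y = chrWithin b T P k i j y + (r y)⁻¹ *
      conformalTensor (P y) (diffWithin b T r y) (gradWithin b T P r y) k i j := by
  have hyT := interior_subset hy
  have hry := hr0 y hy
  have hd : ∀ i j v, fderiv ℝ (fun z => G z i j) y v
      = (r y)⁻¹ ^ 2 * fderivWithin ℝ (fun z => P z i j) T y v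
        - 2 * (r y)⁻¹ ^ 3 * fderivWithin ℝ r T y v * P y i j := by
    intro i j v
    have h1 : (fun z => G z i j) =ᶠ[𝓝 y] fun z => ((r z)⁻¹ * (r z)⁻¹) * P z i j := by
      filter_upwards [isOpen_interior.mem_nhds hy] with z hz
      rw [hG z hz, Matrix.smul_apply, smul_eq_mul, sq]
    have hinv := hasFDerivAt_inv_of_mem_interior hr hy hry
    have hPd := ContDiffOn.hasFDerivAt_of_mem_interior (hP i j) (by norm_num) hy
    have hprod : HasFDerivAt (fun z => ((r z)⁻¹ * (r z)⁻¹) * P z i j) _ y :=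
      (hinv.mul hinv).mul hPd
    rw [h1.fderiv_eq, hprod.fderiv]
    simp
    ring
  have hGinv : (G y)⁻¹ = r y ^ 2 • (P y)⁻¹ := by
    rw [hG y hy]
    refine Matrix.inv_eq_left_inv ?_
    rw [Matrix.smul_mul, Matrix.mul_smul, smul_smul, Matrix.nonsing_inv_mul _ (hdet y hyT).isUnit,
      ← mul_pow, mul_inv_cancel₀ hry, one_pow, one_smul]
  have hone : ∀ j, ∑ l, (P y)⁻¹ k l * P y j l = if k = j then 1 else 0 := by
    intro j
    have h3 : ((P y)⁻¹ * P y) k j = (1 : Matrix ι ι ℝ) k j := by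
      rw [Matrix.nonsing_inv_mul _ (hdet y hyT).isUnit]
    rw [Matrix.mul_apply, Matrix.one_apply] at h3
    rw [← h3]
    exact Finset.sum_congr rfl fun l _ => by rw [hs y hyT j l]
  have hterm : ∀ l, (G y)⁻¹ k l *
      (fderiv ℝ (fun z => G z j l) y (b i) + fderiv ℝ (fun z => G z i l) y (b j)
        - fderiv ℝ (fun z => G z i j) y (b l))
      = (P y)⁻¹ k l * (fderivWithin ℝ (fun z => P z j l) T y (b i)
          + fderivWithin ℝ (fun z => P z i l) T y (b j)
          - fderivWithin ℝ (fun z => P z i j) T y (b l))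
        - 2 * (r y)⁻¹ * (diffWithin b T r y i * ((P y)⁻¹ k l * P y j l)
          + diffWithin b T r y j * ((P y)⁻¹ k l * P y i l)
          - P y i j * ((P y)⁻¹ k l * diffWithin b T r y l)) := by
    intro l
    rw [hGinv, hd, hd, hd, Matrix.smul_apply, smul_eq_mul]
    simp only [diffWithin]
    field_simp
    ring
  rw [chr, chrWithin, Finset.sum_congr rfl fun l _ => hterm l, Finset.sum_sub_distrib,
    ← Finset.mul_sum, Finset.sum_sub_distrib, Finset.sum_add_distrib, ← Finset.mul_sum,
    ← Finset.mul_sum, ← Finset.mul_sum, hone, hone]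
  simp only [conformalTensor, gradWithin]
  ring

/-- The scalar curvature of a conformally compact metric. -/
theorem exists_contract_ricciMatrix_conformal {G : E → Matrix ι ι ℝ} (hT : UniqueDiffOn ℝ T)
    (hP : ∀ i j, ContDiffOn ℝ 2 (fun y => P y i j) T) (hdet : ∀ y ∈ T, (P y).det ≠ 0)
    (hs : ∀ y ∈ T, ∀ i j, P y i j = P y j i) (hr : ContDiffOn ℝ 2 r T)
    (hr0 : ∀ y ∈ interior T, r y ≠ 0) (hG : ∀ y ∈ interior T, G y = (r y)⁻¹ ^ 2 • P y) :
    ∃ B : E → ℝ, ContinuousOn B T ∧ ∀ y ∈ interior T,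
      contract (G y) (ricciMatrix b G y)
        = - ((Fintype.card ι : ℝ) * ((Fintype.card ι : ℝ) - 1)) * diffNormSq b T P r y
          + r y * B y := by
  set Γ := chrWithin b T P with hΓ
  set S : ι → ι → ι → E → ℝ := fun k i j y =>
    conformalTensor (P y) (diffWithin b T r y) (gradWithin b T P r y) k i j with hS
  have cΓ : ∀ k i j, ContDiffOn ℝ 1 (Γ k i j) T := fun k i j => contDiffOn_chrWithin hT hP hdet k i j
  have cS : ∀ k i j, ContDiffOn ℝ 1 (S k i j) T := fun k i j =>
    contDiffOn_conformalTensor hT hP hdet hr k i j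
  -- The remainder of `contract_ricci_conformal`, with derivatives taken within T. Only first
  -- derivatives of the C¹ functions Γ and S occur, so it is continuous up to the boundary.
  refine ⟨fun y => contract (P y) (Matrix.of fun j k =>
          ((∑ i, (fderivWithin ℝ (S i j k) T y (b i) - fderivWithin ℝ (S i i k) T y (b j)))
            + ∑ i, ∑ m, (Γ i i m y * S m j k y + S i i m y * Γ m j k y
              - Γ i j m y * S m i k y - S i j m y * Γ m i k y))
          + r y * ((∑ i, (fderivWithin ℝ (Γ i j k) T y (b i) - fderivWithin ℝ (Γ i i k) T y (b j)))
            + ∑ i, ∑ m, (Γ i i m y * Γ m j k y - Γ i j m y * Γ m i k y))), ?_, fun y hy => ?_⟩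
  · have c0 : ∀ {f : E → ℝ}, ContDiffOn ℝ 1 f T → ∀ v,
        ContinuousOn (fun y => fderivWithin ℝ f T y v) T := fun hf v =>
      (contDiffOn_fderivWithin_apply (m := 0) hT hf (by norm_num) v).continuousOn
    have cΓ0 : ∀ k i j, ContinuousOn (Γ k i j) T := fun k i j => (cΓ k i j).continuousOn
    have cS0 : ∀ k i j, ContinuousOn (S k i j) T := fun k i j => (cS k i j).continuousOn
    simp only [contract, Matrix.of_apply]
    refine continuousOn_finsetSum _ fun j _ => continuousOn_finsetSum _ fun k _ => ContinuousOn.mul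
      (contDiffOn_inv hP hdet j k).continuousOn (ContinuousOn.add (ContinuousOn.add ?_ ?_)
        (hr.continuousOn.mul (ContinuousOn.add ?_ ?_)))
    · exact continuousOn_finsetSum _ fun i _ => (c0 (cS _ _ _) _).sub (c0 (cS _ _ _) _)
    · exact continuousOn_finsetSum _ fun i _ => continuousOn_finsetSum _ fun m _ =>
        ((((cΓ0 _ _ _).mul (cS0 _ _ _)).add ((cS0 _ _ _).mul (cΓ0 _ _ _))).sub
          ((cΓ0 _ _ _).mul (cS0 _ _ _))).sub ((cS0 _ _ _).mul (cΓ0 _ _ _))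
    · exact continuousOn_finsetSum _ fun i _ => (c0 (cΓ _ _ _) _).sub (c0 (cΓ _ _ _) _)
    · exact continuousOn_finsetSum _ fun i _ => continuousOn_finsetSum _ fun m _ =>
        ((cΓ0 _ _ _).mul (cΓ0 _ _ _)).sub ((cΓ0 _ _ _).mul (cΓ0 _ _ _))
  · have hyT := interior_subset hy
    have hry := hr0 y hy
    have hchr : ∀ k i j, chr b G k i j =ᶠ[𝓝 y] fun z => Γ k i j z + (r z)⁻¹ * S k i j z := by
      intro k i j
      filter_upwards [isOpen_interior.mem_nhds hy] with z hz
      exact chr_conformal hP hdet hs hr hr0 hG hz k i j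
    have hd : ∀ k i j m, fderiv ℝ (chr b G k i j) y (b m)
        = fderivWithin ℝ (Γ k i j) T y (b m) + (r y)⁻¹ * fderivWithin ℝ (S k i j) T y (b m)
          - (r y)⁻¹ ^ 2 * diffWithin b T r y m * S k i j y := by
      intro k i j m
      have d1 := ContDiffOn.hasFDerivAt_of_mem_interior (cΓ k i j) one_ne_zero hy
      have d2 := ContDiffOn.hasFDerivAt_of_mem_interior (cS k i j) one_ne_zero hy
      have d3 := hasFDerivAt_inv_of_mem_interior hr hy hry
      have d4 : HasFDerivAt (fun z => Γ k i j z + (r z)⁻¹ * S k i j z) _ y := d1.add (d3.mul d2)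
      rw [(hchr k i j).fderiv_eq, d4.fderiv]
      simp only [add_apply, smul_apply, smul_eq_mul, diffWithin]
      ring
    have hR := contract_ricci_conformal (P := P y) (w := diffWithin b T r y)
      (V := gradWithin b T P r y) (R := ricciMatrix b G y) hry (hdet y hyT).isUnit (hs y hyT)
      (sum_mul_gradWithin (hdet y hyT)) (fun k i j => Γ k i j y)
      (fun m k i j => fderivWithin ℝ (Γ k i j) T y (b m))
      (fun m k i j => fderivWithin ℝ (S k i j) T y (b m)) (fun j k => ?_)
    · rw [hG y hy, hR]
      rfl
    · rw [ricciMatrix, Matrix.of_apply]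
      simp only [hd, fun k i j => (hchr k i j).self_of_nhds]
      rfl

end

end AHYamabe
end

/-! ### Coordinate invariance of the scalar curvature -/

noncomputable section

namespace AHYamabe

open Filter Topology

section

variable {ι E : Type*} [Fintype ι] [DecidableEq ι] [NormedAddCommGroup E] [NormedSpace ℝ E]
  [FiniteDimensional ℝ E]

omit [FiniteDimensional ℝ E] in
theorem contDiffAt_sum_smul_const {κ F : Type*} [Fintype κ] [NormedAddCommGroup F]
    [NormedSpace ℝ F] {f : κ → E → ℝ} {y : E} {k : WithTop ℕ∞} (C : κ → F)
    (hf : ∀ q, ContDiffAt ℝ k (f q) y) : ContDiffAt ℝ k (fun z => ∑ q, f q z • C q) y :=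
  ContDiffAt.sum fun q _ => (hf q).smul contDiffAt_const

/-- The bilinear form with a given Gram matrix. -/
def bilinOfMatrix (b : Module.Basis ι ℝ E) (A : Matrix ι ι ℝ) : E →L[ℝ] E →L[ℝ] ℝ :=
  ∑ i, ∑ j, A i j • (LinearMap.toContinuousLinearMap (b.coord i)).smulRight
    (LinearMap.toContinuousLinearMap (b.coord j))

theorem bilinOfMatrix_apply (b : Module.Basis ι ℝ E) (A : Matrix ι ι ℝ) (v w : E) :
    bilinOfMatrix b A v w = ∑ i, ∑ j, b.repr v i * A i j * b.repr w j := by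
  simp only [bilinOfMatrix, sum_apply, smul_apply, ContinuousLinearMap.smulRight_apply]
  refine Finset.sum_congr rfl fun i _ => Finset.sum_congr rfl fun j _ => ?_
  simp
  ring

theorem bilinOfMatrix_basis (b : Module.Basis ι ℝ E) (A : Matrix ι ι ℝ) (i j : ι) :
    bilinOfMatrix b A (b i) (b j) = A i j := by
  rw [bilinOfMatrix_apply, Finset.sum_eq_single i, Finset.sum_eq_single j]
  · simp
  · intro c _ hc; simp [hc.symm]
  · simp
  · intro c _ hc; simp [hc.symm]
  · simp

theorem gram_bilinOfMatrix (b : Module.Basis ι ℝ E) (G : E → Matrix ι ι ℝ) :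
    gram b (fun y => bilinOfMatrix b (G y)) = G := by
  ext y i j
  exact bilinOfMatrix_basis b (G y) i j

theorem contDiffAt_bilinOfMatrix (b : Module.Basis ι ℝ E) {G : E → Matrix ι ι ℝ} {y : E}
    {k : WithTop ℕ∞} (hG : ∀ i j, ContDiffAt ℝ k (fun z => G z i j) y) :
    ContDiffAt ℝ k (fun z => bilinOfMatrix b (G z)) y := by
  have h := contDiffAt_sum_smul_const (f := fun (q : ι × ι) z => G z q.1 q.2) (y := y)
    (fun q => (LinearMap.toContinuousLinearMap (b.coord q.1)).smulRight
      (LinearMap.toContinuousLinearMap (b.coord q.2))) (fun q => hG q.1 q.2)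
  simpa only [bilinOfMatrix, Fintype.sum_prod_type] using h

/-- The scalar curvature does not depend on the coordinates. -/
theorem contract_ricciMatrix_comp (b : Module.Basis ι ℝ E) {U : Set E} {φ : E → E}
    {G H : E → Matrix ι ι ℝ} (hU : IsOpen U) (hφ : ∀ y ∈ U, ContDiffAt ℝ 3 φ y)
    (hφb : ∀ y ∈ U, Function.Bijective (fderiv ℝ φ y))
    (hG : ∀ y ∈ U, ∀ i j, ContDiffAt ℝ 2 (fun z => G z i j) y)
    (hH : ∀ y ∈ U, ∀ i j, ContDiffAt ℝ 2 (fun z => H z i j) (φ y))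
    (hp : ∀ y ∈ U, (H (φ y)).PosDef)
    (hGH : ∀ y ∈ U, G y = (LinearMap.toMatrix b b (fderiv ℝ φ y : E →ₗ[ℝ] E)).transpose
      * H (φ y) * LinearMap.toMatrix b b (fderiv ℝ φ y : E →ₗ[ℝ] E)) {y : E} (hy : y ∈ U) :
    contract (G y) (ricciMatrix b G y) = contract (H (φ y)) (ricciMatrix b H (φ y)) := by
  have h : IsPullbackMetric U φ (fun y => bilinOfMatrix b (G y))
      (fun y => bilinOfMatrix b (H y)) := by
    refine ⟨hU, hφ, hφb, fun y hy => contDiffAt_bilinOfMatrix b (hG y hy),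
      fun y hy => contDiffAt_bilinOfMatrix b (hH y hy), fun y hy v w => ?_, fun y hy v hv => ?_,
      fun y hy v w => ?_⟩
    · rw [bilinOfMatrix_apply, bilinOfMatrix_apply, Finset.sum_comm]
      refine Finset.sum_congr rfl fun i _ => Finset.sum_congr rfl fun j _ => ?_
      have := (hp y hy).1.apply i j
      rw [star_trivial] at this
      rw [this]; ring
    · have hv' : (fun i => b.repr v i) ≠ 0 := by
        intro h0
        exact hv (b.repr.map_eq_zero_iff.1 (Finsupp.ext fun i => congrFun h0 i))
      have := (hp y hy).dotProduct_mulVec_pos hv'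
      rw [bilinOfMatrix_apply]
      simpa [dotProduct, Matrix.mulVec, Finset.mul_sum, mul_assoc] using this
    · have key : ∀ v, (fun i => b.repr (fderiv ℝ φ y v) i)
          = (LinearMap.toMatrix b b (fderiv ℝ φ y : E →ₗ[ℝ] E)).mulVec (b.repr v) := by
        intro v
        rw [LinearMap.toMatrix_mulVec_repr]; rfl
      have h2 : ∀ (A : Matrix ι ι ℝ) v w, bilinOfMatrix b A v w
          = dotProduct (b.repr v) (A.mulVec (b.repr w)) := by
        intro A v w
        simp [bilinOfMatrix_apply, dotProduct, Matrix.mulVec, Finset.mul_sum, mul_assoc]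
      rw [h2, h2, hGH y hy]
      change _ = dotProduct (fun i => b.repr (fderiv ℝ φ y v) i)
        ((H (φ y)).mulVec (fun i => b.repr (fderiv ℝ φ y w) i))
      rw [key, key, ← Matrix.mulVec_mulVec, ← Matrix.mulVec_mulVec, Matrix.dotProduct_mulVec,
        Matrix.vecMul_transpose]
  have := h.contract_ricciMatrix_eq (b := b) hy
  rwa [gram_bilinOfMatrix, gram_bilinOfMatrix] at this

end

/-! ### Charts -/

variable {n : ℕ} [NeZero n] {M : Type*} [TopologicalSpace M]
  [ChartedSpace (EuclideanHalfSpace n) M]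

section

variable [IsManifold (𝓡∂ n) ∞ M]

theorem symm_mem_interior {c : M} {y : EuclideanSpace ℝ (Fin n)} (hy : y ∈ chartDomain (n := n) c) :
    (extChartAt (𝓡∂ n) c).symm y ∈ (𝓡∂ n).interior M := by
  have hyT : y ∈ (extChartAt (𝓡∂ n) c).target := interior_subset hy
  have hs : (extChartAt (𝓡∂ n) c).symm y ∈ (chartAt (EuclideanHalfSpace n) c).source := by
    rw [← extChartAt_source (𝓡∂ n)]; exact (extChartAt (𝓡∂ n) c).map_target hyT
  refine ((𝓡∂ n).isInteriorPoint_iff_of_mem_atlas (n := ∞) (by simp)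
    (chart_mem_atlas (EuclideanHalfSpace n) c) hs).2 ?_
  have h2 := (extChartAt (𝓡∂ n) c).right_inv hyT
  have h3 : extChartAt (𝓡∂ n) c ((extChartAt (𝓡∂ n) c).symm y)
    ∈ interior (extChartAt (𝓡∂ n) c).target := by rw [h2]; exact hy
  exact h3

theorem mem_chartDomain {c p : M} (hp : p ∈ (extChartAt (𝓡∂ n) c).source)
    (hpi : p ∈ (𝓡∂ n).interior M) : extChartAt (𝓡∂ n) c p ∈ chartDomain (n := n) c :=
  ((𝓡∂ n).isInteriorPoint_iff_of_mem_atlas (n := ∞) (by simp)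
    (chart_mem_atlas (EuclideanHalfSpace n) c) (by rwa [extChartAt_source] at hp)).1 hpi

/-- The standard basis of `ℝⁿ`. -/
abbrev stdBasis (n : ℕ) : Module.Basis (Fin n) ℝ (EuclideanSpace ℝ (Fin n)) :=
  (EuclideanSpace.basisFun (Fin n) ℝ).toBasis

omit [NeZero n] in
theorem stdBasis_apply (i : Fin n) : stdBasis n i = EuclideanSpace.single i 1 := by
  simp [stdBasis]

/-- The coordinate frame of the chart around `c`, at the point `p`. -/
def frameAt (c p : M) : EuclideanSpace ℝ (Fin n) →L[ℝ] TangentSpace (𝓡∂ n) p :=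
  tangentCoordChange (𝓡∂ n) c p p

theorem symmL_eq_frameAt {c p : M} (hp : p ∈ (extChartAt (𝓡∂ n) c).source) :
    (trivializationAt (EuclideanSpace ℝ (Fin n)) (TangentSpace (𝓡∂ n)) c).symmL ℝ p
      = frameAt c p :=
  TangentBundle.symmL_trivializationAt_eq_core (𝕜 := ℝ) (I := 𝓡∂ n)
    (by rwa [extChartAt_source] at hp)

/-- Expresses the coordinate vectors through the coordinate changes of the tangent bundle, for which
the cocycle identities are available. -/
theorem coordVec_eq {c : M} {y : EuclideanSpace ℝ (Fin n)}
    (hy : y ∈ (extChartAt (𝓡∂ n) c).target) (i : Fin n) :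
    coordVec c y i = frameAt c ((extChartAt (𝓡∂ n) c).symm y) (stdBasis n i) := by
  set p := (extChartAt (𝓡∂ n) c).symm y with hp
  have hps : p ∈ (chartAt (EuclideanHalfSpace n) c).source := by
    rw [← extChartAt_source (𝓡∂ n)]; exact (extChartAt (𝓡∂ n) c).map_target hy
  have h1 := TangentBundle.symmL_trivializationAt (𝕜 := ℝ) (I := 𝓡∂ n) hps
  have h2 := TangentBundle.symmL_trivializationAt_eq_core (𝕜 := ℝ) (I := 𝓡∂ n) hps
  -- The base point of the derivative appears as the image of (extChartAt c).symm y under the chart,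
  -- which equals y only propositionally. The tangent spaces are all viewed as ℝⁿ to transport the
  -- identity.
  have key : ∀ z, z = y → ∀ A : EuclideanSpace ℝ (Fin n) →L[ℝ] EuclideanSpace ℝ (Fin n),
      (mfderivWithin 𝓘(ℝ, EuclideanSpace ℝ (Fin n)) (𝓡∂ n) (extChartAt (𝓡∂ n) c).symm
        (range (𝓡∂ n)) z : EuclideanSpace ℝ (Fin n) →L[ℝ] EuclideanSpace ℝ (Fin n)) = A →
      (mfderivWithin 𝓘(ℝ, EuclideanSpace ℝ (Fin n)) (𝓡∂ n) (extChartAt (𝓡∂ n) c).symm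
        (range (𝓡∂ n)) y : EuclideanSpace ℝ (Fin n) →L[ℝ] EuclideanSpace ℝ (Fin n)) = A := by
    rintro _ rfl A h; exact h
  have h4 := key _ ((extChartAt (𝓡∂ n) c).right_inv hy) _ (h1.symm.trans h2)
  rw [stdBasis_apply]
  exact DFunLike.congr_fun h4 (EuclideanSpace.single i 1)

theorem frameAt_tangentCoordChange {c c' p : M} (hc : p ∈ (extChartAt (𝓡∂ n) c).source)
    (hc' : p ∈ (extChartAt (𝓡∂ n) c').source) (v : EuclideanSpace ℝ (Fin n)) :
    frameAt c' p (tangentCoordChange (𝓡∂ n) c c' p v) = frameAt c p v := by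
  have h := tangentCoordChange_comp (I := 𝓡∂ n) (v := v) ⟨⟨hc, hc'⟩, mem_extChartAt_source p⟩
  exact h

/-- The basis used in `covectorNormSq` is thus the coordinate frame of the chart centred at p, which
is the starting point for passing to another chart. -/
theorem frameAt_self (p : M) (i : Fin n) : frameAt p p (stdBasis n i) = stdVec p i := by
  rw [stdBasis_apply]
  have h := tangentCoordChange_self (I := 𝓡∂ n) (v := EuclideanSpace.single i 1)
    (mem_extChartAt_source p)
  exact h

theorem frameAt_injective {c p : M} (hc : p ∈ (extChartAt (𝓡∂ n) c).source) :
    Function.Injective (frameAt (n := n) c p) := by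
  intro v w h
  have h1 : ∀ v : EuclideanSpace ℝ (Fin n),
      tangentCoordChange (𝓡∂ n) p c p (tangentCoordChange (𝓡∂ n) c p p v) = v := by
    intro v
    rw [tangentCoordChange_comp ⟨⟨hc, mem_extChartAt_source p⟩, hc⟩, tangentCoordChange_self hc]
  rw [← h1 v, ← h1 w]
  exact congrArg (tangentCoordChange (𝓡∂ n) p c p) h

/-- The Jacobian matrix of a change of coordinates. -/
def jacMatrix (c c' p : M) : Matrix (Fin n) (Fin n) ℝ :=
  LinearMap.toMatrix (stdBasis n) (stdBasis n)
    (tangentCoordChange (𝓡∂ n) c c' p : EuclideanSpace ℝ (Fin n) →ₗ[ℝ] EuclideanSpace ℝ (Fin n))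

theorem frameAt_stdBasis {c c' p : M} (hc : p ∈ (extChartAt (𝓡∂ n) c).source)
    (hc' : p ∈ (extChartAt (𝓡∂ n) c').source) (i : Fin n) :
    frameAt c p (stdBasis n i) = ∑ a, jacMatrix (n := n) c c' p a i • frameAt c' p (stdBasis n a) := by
  rw [← frameAt_tangentCoordChange hc hc',
    ← (stdBasis n).sum_repr (tangentCoordChange (𝓡∂ n) c c' p (stdBasis n i)), map_sum]
  refine Finset.sum_congr rfl fun a _ => ?_
  rw [map_smul, jacMatrix, LinearMap.toMatrix_apply]
  rfl

theorem jacMatrix_mul_jacMatrix {c c' p : M} (hc : p ∈ (extChartAt (𝓡∂ n) c).source)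
    (hc' : p ∈ (extChartAt (𝓡∂ n) c').source) : jacMatrix (n := n) c' c p * jacMatrix (n := n) c c' p = 1 := by
  rw [jacMatrix, jacMatrix, ← LinearMap.toMatrix_comp, ← LinearMap.toMatrix_id (stdBasis n)]
  congr 1
  ext1 v
  exact (tangentCoordChange_comp ⟨⟨hc, hc'⟩, hc⟩).trans (tangentCoordChange_self hc)

theorem isUnit_det_jacMatrix {c c' p : M} (hc : p ∈ (extChartAt (𝓡∂ n) c).source)
    (hc' : p ∈ (extChartAt (𝓡∂ n) c').source) : IsUnit (jacMatrix (n := n) c c' p).det := by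
  have := congrArg Matrix.det (jacMatrix_mul_jacMatrix hc hc')
  rw [Matrix.det_mul, Matrix.det_one] at this
  exact IsUnit.of_mul_eq_one _ (by rw [mul_comm]; exact this)

/-- The Gram matrix of a bilinear form on a tangent space in the frame of the chart around `c`. -/
def frameGram (c p : M) (β : TangentSpace (𝓡∂ n) p →L[ℝ] TangentSpace (𝓡∂ n) p →L[ℝ] ℝ) :
    Matrix (Fin n) (Fin n) ℝ :=
  Matrix.of fun i j => β (frameAt c p (stdBasis n i)) (frameAt c p (stdBasis n j))

theorem metricMatrix_eq (g : BilinField n M) {c : M} {y : EuclideanSpace ℝ (Fin n)}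
    (hy : y ∈ (extChartAt (𝓡∂ n) c).target) :
    metricMatrix g c y = frameGram c ((extChartAt (𝓡∂ n) c).symm y)
      (g ((extChartAt (𝓡∂ n) c).symm y)) := by
  ext i j
  simp only [metricMatrix, frameGram, Matrix.of_apply, coordVec_eq hy]

theorem frameGram_eq {c c' p : M} (hc : p ∈ (extChartAt (𝓡∂ n) c).source)
    (hc' : p ∈ (extChartAt (𝓡∂ n) c').source)
    (β : TangentSpace (𝓡∂ n) p →L[ℝ] TangentSpace (𝓡∂ n) p →L[ℝ] ℝ) :
    frameGram c p β = (jacMatrix (n := n) c c' p).transpose * frameGram c' p β * jacMatrix (n := n) c c' p := by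
  ext i j
  simp only [frameGram, Matrix.of_apply, Matrix.mul_apply, Matrix.transpose_apply,
    frameAt_stdBasis hc hc', map_sum, map_smul, sum_apply, smul_apply, smul_eq_mul]
  refine Finset.sum_congr rfl fun a _ => ?_
  rw [mul_comm]

/-- The squared norm of a covector can be computed in any chart. -/
theorem covectorNormSq_eq {c p : M} (hc : p ∈ (extChartAt (𝓡∂ n) c).source)
    (β : TangentSpace (𝓡∂ n) p →L[ℝ] TangentSpace (𝓡∂ n) p →L[ℝ] ℝ)
    (α : TangentSpace (𝓡∂ n) p →L[ℝ] ℝ) :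
    covectorNormSq p β α = contract (frameGram c p β)
      (Matrix.of fun i j => α (frameAt c p (stdBasis n i)) * α (frameAt c p (stdBasis n j))) := by
  have h1 : covectorNormSq p β α = contract (frameGram p p β)
      (Matrix.of fun i j => α (frameAt p p (stdBasis n i)) * α (frameAt p p (stdBasis n j))) := by
    simp only [covectorNormSq, contract, frameGram, Matrix.of_apply, frameAt_self, mul_assoc]
  have hp := mem_extChartAt_source (I := 𝓡∂ n) p
  have h2 : (Matrix.of fun i j => α (frameAt p p (stdBasis n i)) * α (frameAt p p (stdBasis n j)))
      = (jacMatrix (n := n) p c p).transpose * (Matrix.of fun i j => α (frameAt c p (stdBasis n i))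
        * α (frameAt c p (stdBasis n j))) * jacMatrix (n := n) p c p := by
    ext i j
    simp only [Matrix.of_apply, Matrix.mul_apply, Matrix.transpose_apply,
      frameAt_stdBasis hp hc, map_sum, map_smul, smul_eq_mul, Finset.sum_mul, Finset.mul_sum]
    refine Finset.sum_congr rfl fun a _ => Finset.sum_congr rfl fun d _ => ?_
    ring
  rw [h1, h2, frameGram_eq hp hc, contract_congr _ _ _ (isUnit_det_jacMatrix hp hc)]

end

end AHYamabe
end

/-! ### The compactified metric, the differential of ρ and the scalar curvature in charts -/

noncomputable section

namespace AHYamabe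

open Filter Topology

variable {n : ℕ} [NeZero n] {M : Type*} [TopologicalSpace M]
  [ChartedSpace (EuclideanHalfSpace n) M] [IsManifold (𝓡∂ n) ∞ M]

/-- The `C²` metrics up to the boundary. -/
abbrev C2Metric (n : ℕ) [NeZero n] (M : Type*) [TopologicalSpace M]
    [ChartedSpace (EuclideanHalfSpace n) M] [IsManifold (𝓡∂ n) ∞ M] :=
  Bundle.ContMDiffRiemannianMetric (𝓡∂ n) 2 (EuclideanSpace ℝ (Fin n))
    (fun p : M => TangentSpace (𝓡∂ n) p)

/-- `ρ² g` extends to `gbar`, with `|dρ|² = 1` along the boundary. -/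
structure IsCompactification (ρ : M → ℝ) (gbar : C2Metric n M) (g : BilinField n M) : Prop where
  defining : IsDefiningFunction (n := n) ρ
  conformal : ∀ p ∈ (𝓡∂ n).interior M, gbar.inner p = ρ p ^ 2 • g p
  normalized : ∀ p ∈ (𝓡∂ n).boundary M,
    covectorNormSq p (gbar.inner p) (mfderiv (𝓡∂ n) 𝓘(ℝ, ℝ) ρ p) = 1

/-- The coordinate frame is the local frame of the trivialization of the tangent bundle, hence
smooth; a C² metric evaluated on smooth sections is C². -/
theorem contMDiffOn_frameGram (gbar : C2Metric n M) (c : M) (i j : Fin n) :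
    ContMDiffOn (𝓡∂ n) 𝓘(ℝ, ℝ) 2 (fun p => frameGram c p (gbar.inner p) i j)
      (extChartAt (𝓡∂ n) c).source := by
  set e := trivializationAt (EuclideanSpace ℝ (Fin n)) (TangentSpace (𝓡∂ n) (M := M)) c with he
  have hb : e.baseSet = (extChartAt (𝓡∂ n) c).source := by
    rw [extChartAt_source]; rfl
  have hf : ∀ i, ContMDiffOn (𝓡∂ n) ((𝓡∂ n).prod 𝓘(ℝ, EuclideanSpace ℝ (Fin n))) 2
      (fun x => (⟨x, frameAt c x (stdBasis n i)⟩ : Bundle.TotalSpace (EuclideanSpace ℝ (Fin n))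
        (TangentSpace (𝓡∂ n) (M := M)))) (extChartAt (𝓡∂ n) c).source := by
    intro i
    have h := Bundle.Trivialization.contMDiffOn_localFrame_baseSet (I := 𝓡∂ n) 2 e (stdBasis n) i
    rw [hb] at h
    refine h.congr fun p hp => ?_
    have hp' : p ∈ e.baseSet := by rw [hb]; exact hp
    rw [e.localFrame_apply_of_mem_baseSet (stdBasis n) hp']
    have h2 := symmL_eq_frameAt hp
    congr 1
    rw [← h2]
    simp only [Bundle.Trivialization.basisAt, he, Module.Basis.map_apply]
    exact Bundle.Trivialization.symmL_apply _ hp' _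
  have h := ContMDiffOn.clm_bundle_apply₂ (E₃ := fun _ : M => ℝ) (F₃ := ℝ)
    gbar.contMDiff.contMDiffOn (hf i) (hf j)
  intro p hp
  have h1 := h p hp
  rw [Bundle.contMDiffWithinAt_totalSpace] at h1
  exact h1.2

theorem contDiffOn_metricMatrix (gbar : C2Metric n M) (c : M) (i j : Fin n) :
    ContDiffOn ℝ 2 (fun y => metricMatrix gbar.inner c y i j) (extChartAt (𝓡∂ n) c).target := by
  rw [← contMDiffOn_iff_contDiffOn]
  refine ((contMDiffOn_frameGram gbar c i j).comp (contMDiffOn_extChartAt_symm c)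
    (fun y hy => (extChartAt (𝓡∂ n) c).map_target hy)).congr fun y hy => ?_
  rw [metricMatrix_eq _ hy]
  rfl

theorem posDef_metricMatrix (gbar : C2Metric n M) {c : M} {y : EuclideanSpace ℝ (Fin n)}
    (hy : y ∈ (extChartAt (𝓡∂ n) c).target) : (metricMatrix gbar.inner c y).PosDef := by
  rw [metricMatrix_eq _ hy]
  set p := (extChartAt (𝓡∂ n) c).symm y
  refine posDef_of_bilin (stdBasis n)
    (B := fun v w => gbar.inner p (frameAt c p v) (frameAt c p w)) (fun w => ⟨?_, ?_⟩) ?_ ?_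
  · intro v v'; simp
  · intro a v; simp
  · intro v w; exact gbar.symm _ _ _
  · intro v hv
    refine gbar.pos _ _ fun h0 => hv ?_
    exact frameAt_injective ((extChartAt (𝓡∂ n) c).map_target hy) (by rw [h0, map_zero])

/-- The differential of a function on `M`, as a field of covectors. -/
def differential (ρ : M → ℝ) (p : M) : TangentSpace (𝓡∂ n) p →L[ℝ] ℝ :=
  mfderiv (𝓡∂ n) 𝓘(ℝ, ℝ) ρ p

/-- The chain rule up to the boundary. It turns the normalization of |dρ|, stated with the manifold
derivative, into one on the derivative within the chart target. -/
theorem differential_frameAt {ρ : M → ℝ} (hρ : ContMDiff (𝓡∂ n) 𝓘(ℝ, ℝ) ∞ ρ) {c p : M}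
    (hp : p ∈ (extChartAt (𝓡∂ n) c).source) (v : EuclideanSpace ℝ (Fin n)) :
    differential ρ p (frameAt c p v)
      = fderivWithin ℝ (fun y => ρ ((extChartAt (𝓡∂ n) c).symm y)) (extChartAt (𝓡∂ n) c).target
        (extChartAt (𝓡∂ n) c p) v := by
  set y := extChartAt (𝓡∂ n) c p with hy
  have hyT : y ∈ (extChartAt (𝓡∂ n) c).target := (extChartAt (𝓡∂ n) c).map_source hp
  have hpc : p ∈ (chartAt (EuclideanHalfSpace n) c).source := by rwa [extChartAt_source] at hp
  have hsy : (extChartAt (𝓡∂ n) c).symm y = p := (extChartAt (𝓡∂ n) c).left_inv hp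
  have hyr : y ∈ range (𝓡∂ n) := extChartAt_target_subset_range c hyT
  have h1 : frameAt c p = mfderivWithin 𝓘(ℝ, EuclideanSpace ℝ (Fin n)) (𝓡∂ n)
      (extChartAt (𝓡∂ n) c).symm (range (𝓡∂ n)) y :=
    (symmL_eq_frameAt hp).symm.trans
      (TangentBundle.symmL_trivializationAt (𝕜 := ℝ) (I := 𝓡∂ n) hpc)
  have hd : MDifferentiableAt (𝓡∂ n) 𝓘(ℝ, ℝ) ρ ((extChartAt (𝓡∂ n) c).symm y) :=
    (hρ _).mdifferentiableAt (by simp)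
  have h2 := mfderiv_comp_mfderivWithin (I := 𝓘(ℝ, EuclideanSpace ℝ (Fin n))) (I' := 𝓡∂ n)
    (I'' := 𝓘(ℝ, ℝ)) y hd (mdifferentiableWithinAt_extChartAt_symm hyT)
    ((𝓡∂ n).uniqueDiffOn.uniqueMDiffOn y hyr)
  have h3 : fderivWithin ℝ (fun y => ρ ((extChartAt (𝓡∂ n) c).symm y))
      (extChartAt (𝓡∂ n) c).target y
      = fderivWithin ℝ (ρ ∘ (extChartAt (𝓡∂ n) c).symm) (range (𝓡∂ n)) y :=
    fderivWithin_congr_set (extChartAt_target_eventuallyEq_of_mem hyT)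
  have key : ∀ q, q = p → ∀ w : EuclideanSpace ℝ (Fin n),
      (mfderiv (𝓡∂ n) 𝓘(ℝ, ℝ) ρ p : EuclideanSpace ℝ (Fin n) →L[ℝ] ℝ) w
        = (mfderiv (𝓡∂ n) 𝓘(ℝ, ℝ) ρ q : EuclideanSpace ℝ (Fin n) →L[ℝ] ℝ) w := by
    rintro _ rfl w; rfl
  rw [h3, ← mfderivWithin_eq_fderivWithin, h2, h1, differential]
  exact key _ hsy _

theorem contDiffOn_comp_symm {ρ : M → ℝ} (hρ : ContMDiff (𝓡∂ n) 𝓘(ℝ, ℝ) ∞ ρ) (c : M) :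
    ContDiffOn ℝ ∞ (fun y => ρ ((extChartAt (𝓡∂ n) c).symm y)) (extChartAt (𝓡∂ n) c).target := by
  rw [← contMDiffOn_iff_contDiffOn]
  exact hρ.comp_contMDiffOn (contMDiffOn_extChartAt_symm c)

theorem scal_eq_contract (g : BilinField n M) (p : M) :
    scal g p = contract (metricMatrix g p (extChartAt (𝓡∂ n) p p))
      (ricciMatrix (stdBasis n) (metricMatrix g p) (extChartAt (𝓡∂ n) p p)) := by
  have h1 : ∀ k i j, christoffel g p k i j = chr (stdBasis n) (metricMatrix g p) k i j := by
    intro k i j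
    ext y
    simp only [christoffel, chr, partialD, stdBasis_apply]
  simp only [scal, contract, ricci, ricciMatrix, Matrix.of_apply, h1, partialD, stdBasis_apply]

theorem fderiv_coordChange {c c' : M} {y : EuclideanSpace ℝ (Fin n)}
    (hy : y ∈ chartDomain (n := n) c)
    (hy' : (extChartAt (𝓡∂ n) c).symm y ∈ (extChartAt (𝓡∂ n) c').source) :
    HasFDerivAt (extChartAt (𝓡∂ n) c' ∘ (extChartAt (𝓡∂ n) c).symm)
      (tangentCoordChange (𝓡∂ n) c c' ((extChartAt (𝓡∂ n) c).symm y)) y := by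
  have hyT := interior_subset hy
  have h := hasFDerivWithinAt_tangentCoordChange (I := 𝓡∂ n)
    ⟨(extChartAt (𝓡∂ n) c).map_target hyT, hy'⟩
  rw [(extChartAt (𝓡∂ n) c).right_inv hyT] at h
  exact h.hasFDerivAt (mem_of_superset (mem_interior_iff_mem_nhds.1 hy)
    (extChartAt_target_subset_range c))

theorem contDiffAt_coordChange {c c' : M} {y : EuclideanSpace ℝ (Fin n)}
    (hy : y ∈ chartDomain (n := n) c)
    (hy' : (extChartAt (𝓡∂ n) c).symm y ∈ (extChartAt (𝓡∂ n) c').source) :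
    ContDiffAt ℝ 3 (extChartAt (𝓡∂ n) c' ∘ (extChartAt (𝓡∂ n) c).symm) y := by
  have hyT := interior_subset hy
  have h1 : ContMDiffAt (𝓡∂ n) 𝓘(ℝ, EuclideanSpace ℝ (Fin n)) 3 (extChartAt (𝓡∂ n) c')
      ((extChartAt (𝓡∂ n) c).symm y) :=
    (contMDiffOn_extChartAt (I := 𝓡∂ n) (n := 3) (x := c')).contMDiffAt
      ((chartAt (EuclideanHalfSpace n) c').open_source.mem_nhds (by rwa [extChartAt_source] at hy'))
  have h2 : ContMDiffAt 𝓘(ℝ, EuclideanSpace ℝ (Fin n)) (𝓡∂ n) 3 (extChartAt (𝓡∂ n) c).symm y :=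
    (contMDiffOn_extChartAt_symm (I := 𝓡∂ n) (n := 3) c).contMDiffAt
      (mem_interior_iff_mem_nhds.1 hy)
  exact contMDiffAt_iff_contDiffAt.1 (h1.comp y h2)

theorem isOpen_chartDomain_inter (c : M) {s : Set M} (hs : IsOpen s) :
    IsOpen (chartDomain (n := n) c ∩ (extChartAt (𝓡∂ n) c).symm ⁻¹' s) :=
  ((continuousOn_extChartAt_symm c).mono interior_subset).isOpen_inter_preimage isOpen_interior hs

namespace IsCompactification

variable {ρ : M → ℝ} {gbar : C2Metric n M} {g : BilinField n M}

theorem pos (h : IsCompactification ρ gbar g) {p : M} (hp : p ∈ (𝓡∂ n).interior M) : 0 < ρ p := by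
  refine lt_of_le_of_ne (h.defining.nonneg p) fun h0 => ?_
  have := (h.defining.eq_zero_iff p).1 h0.symm
  exact Set.disjoint_left.1 ((𝓡∂ n).disjoint_interior_boundary) hp this

theorem mem_interior (h : IsCompactification ρ gbar g) {p : M} (hp : 0 < ρ p) :
    p ∈ (𝓡∂ n).interior M := by
  rcases (𝓡∂ n).isInteriorPoint_or_isBoundaryPoint p with h1 | h1
  · exact h1
  · exact absurd ((h.defining.eq_zero_iff p).2 h1) hp.ne'

theorem continuous (h : IsCompactification ρ gbar g) : Continuous ρ := h.defining.smooth.continuous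

theorem metricMatrix_eq (h : IsCompactification ρ gbar g) {c : M} {y : EuclideanSpace ℝ (Fin n)}
    (hy : y ∈ chartDomain (n := n) c) :
    metricMatrix g c y
      = (ρ ((extChartAt (𝓡∂ n) c).symm y))⁻¹ ^ 2 • metricMatrix gbar.inner c y := by
  have hpi := symm_mem_interior hy
  have hne := (h.pos hpi).ne'
  ext i j
  simp only [metricMatrix, Matrix.of_apply, Matrix.smul_apply, smul_eq_mul]
  rw [h.conformal _ hpi, smul_apply, smul_apply, smul_eq_mul, ← mul_assoc, ← mul_pow,
    inv_mul_cancel₀ hne, one_pow, one_mul]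

theorem posDef (h : IsCompactification ρ gbar g) {c : M} {y : EuclideanSpace ℝ (Fin n)}
    (hy : y ∈ chartDomain (n := n) c) : (metricMatrix g c y).PosDef := by
  rw [h.metricMatrix_eq hy]
  have := inv_pos.2 (h.pos (symm_mem_interior hy))
  exact (posDef_metricMatrix gbar (interior_subset hy)).smul (by positivity)

theorem contDiffAt_metricMatrix (h : IsCompactification ρ gbar g) {c : M}
    {y : EuclideanSpace ℝ (Fin n)} (hy : y ∈ chartDomain (n := n) c) (i j : Fin n) :
    ContDiffAt ℝ 2 (fun z => metricMatrix g c z i j) y := by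
  have hn := mem_interior_iff_mem_nhds.1 hy
  have h1 := (contDiffOn_metricMatrix gbar c i j).contDiffAt hn
  have h2 : ContDiffAt ℝ 2 (fun y => ρ ((extChartAt (𝓡∂ n) c).symm y)) y :=
    ((contDiffOn_comp_symm h.defining.smooth c).contDiffAt hn).of_le ENat.LEInfty.out
  refine ContDiffAt.congr_of_eventuallyEq
    (((h2.inv (h.pos (symm_mem_interior hy)).ne').pow 2).mul h1) ?_
  filter_upwards [isOpen_interior.mem_nhds hy] with z hz
  rw [h.metricMatrix_eq hz, Matrix.smul_apply, smul_eq_mul]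
  rfl

/-- The scalar curvature can be computed in any chart. -/
theorem scal_eq (h : IsCompactification ρ gbar g) {c p : M}
    (hc : p ∈ (extChartAt (𝓡∂ n) c).source) (hp : p ∈ (𝓡∂ n).interior M) :
    scal g p = contract (metricMatrix g c (extChartAt (𝓡∂ n) c p))
      (ricciMatrix (stdBasis n) (metricMatrix g c) (extChartAt (𝓡∂ n) c p)) := by
  have hpp := mem_extChartAt_source (I := 𝓡∂ n) p
  have hsy : (extChartAt (𝓡∂ n) p).symm (extChartAt (𝓡∂ n) p p) = p :=
    (extChartAt (𝓡∂ n) p).left_inv hpp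
  -- The coordinate change φ from the chart at p to the chart at c is a local diffeomorphism on U.
  -- Only interior points are involved, so ordinary derivatives are available.
  set U := chartDomain (n := n) p ∩ (extChartAt (𝓡∂ n) p).symm ⁻¹' (extChartAt (𝓡∂ n) c).source
    with hU
  set φ := extChartAt (𝓡∂ n) c ∘ (extChartAt (𝓡∂ n) p).symm with hφ
  have hmem : ∀ y ∈ U, φ y ∈ chartDomain (n := n) c := fun y hy =>
    mem_chartDomain hy.2 (symm_mem_interior hy.1)
  have hsφ : ∀ y ∈ U, (extChartAt (𝓡∂ n) c).symm (φ y) = (extChartAt (𝓡∂ n) p).symm y :=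
    fun y hy => (extChartAt (𝓡∂ n) c).left_inv hy.2
  have hyU : extChartAt (𝓡∂ n) p p ∈ U :=
    ⟨mem_chartDomain hpp hp, by rw [mem_preimage, hsy]; exact hc⟩
  have hφp : φ (extChartAt (𝓡∂ n) p p) = extChartAt (𝓡∂ n) c p := by
    rw [hφ, Function.comp_apply, hsy]
  rw [scal_eq_contract, ← hφp]
  refine contract_ricciMatrix_comp (stdBasis n) (U := U) (φ := φ)
    (isOpen_chartDomain_inter p (isOpen_extChartAt_source c))
    (fun y hy => contDiffAt_coordChange hy.1 hy.2) (fun y hy => ?_)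
    (fun y hy i j => h.contDiffAt_metricMatrix hy.1 i j)
    (fun y hy i j => h.contDiffAt_metricMatrix (hmem y hy) i j)
    (fun y hy => h.posDef (hmem y hy)) (fun y hy => ?_) hyU
  · have hq := (extChartAt (𝓡∂ n) p).map_target (interior_subset hy.1)
    rw [(fderiv_coordChange hy.1 hy.2).fderiv]
    have inv1 : ∀ {c c' q : M} (_ : q ∈ (extChartAt (𝓡∂ n) c).source)
        (_ : q ∈ (extChartAt (𝓡∂ n) c').source) (v : EuclideanSpace ℝ (Fin n)),
        tangentCoordChange (𝓡∂ n) c' c q (tangentCoordChange (𝓡∂ n) c c' q v) = v := by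
      intro c c' q h1 h2 v
      rw [tangentCoordChange_comp ⟨⟨h1, h2⟩, h1⟩, tangentCoordChange_self h1]
    exact Function.bijective_iff_has_inverse.2 ⟨_, inv1 hq hy.2, inv1 hy.2 hq⟩
  · have hq := (extChartAt (𝓡∂ n) p).map_target (interior_subset hy.1)
    have e1 := AHYamabe.metricMatrix_eq g (interior_subset hy.1)
    have e2 := AHYamabe.metricMatrix_eq g (interior_subset (hmem y hy))
    rw [hsφ y hy] at e2
    rw [(fderiv_coordChange hy.1 hy.2).fderiv, e1, e2, frameGram_eq hq hy.2]
    rfl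

/-- `|dρ|²` for the metric `ρ² g`, up to the boundary. -/
def normSq (ρ : M → ℝ) (gbar : C2Metric n M) (p : M) : ℝ :=
  covectorNormSq p (gbar.inner p) (differential ρ p)

theorem normSq_eq (h : IsCompactification ρ gbar g) {c p : M}
    (hc : p ∈ (extChartAt (𝓡∂ n) c).source) :
    normSq ρ gbar p = diffNormSq (stdBasis n) (extChartAt (𝓡∂ n) c).target
      (metricMatrix gbar.inner c) (fun y => ρ ((extChartAt (𝓡∂ n) c).symm y))
      (extChartAt (𝓡∂ n) c p) := by
  have e1 := AHYamabe.metricMatrix_eq gbar.inner ((extChartAt (𝓡∂ n) c).map_source hc)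
  rw [(extChartAt (𝓡∂ n) c).left_inv hc] at e1
  have e2 := covectorNormSq_eq hc (gbar.inner p) (differential ρ p)
  rw [← e1] at e2
  refine e2.trans ?_
  simp only [contract, Matrix.of_apply, differential_frameAt h.defining.smooth hc, diffNormSq,
    gradWithin, diffWithin, Finset.mul_sum]
  refine Finset.sum_congr rfl fun i _ => Finset.sum_congr rfl fun j _ => ?_
  ring

theorem contDiffOn_rho (h : IsCompactification ρ gbar g) (c : M) :
    ContDiffOn ℝ 2 (fun y => ρ ((extChartAt (𝓡∂ n) c).symm y)) (extChartAt (𝓡∂ n) c).target :=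
  (contDiffOn_comp_symm h.defining.smooth c).of_le ENat.LEInfty.out

theorem _root_.AHYamabe.det_metricMatrix_ne_zero (gbar : C2Metric n M) (c : M) :
    ∀ y ∈ (extChartAt (𝓡∂ n) c).target, (metricMatrix gbar.inner c y).det ≠ 0 :=
  fun _ hy => (posDef_metricMatrix gbar hy).det_pos.ne'

theorem _root_.AHYamabe.metricMatrix_symm (gbar : C2Metric n M) (c : M) :
    ∀ y ∈ (extChartAt (𝓡∂ n) c).target, ∀ i j,
      metricMatrix gbar.inner c y i j = metricMatrix gbar.inner c y j i :=
  fun _ _ _ _ => gbar.symm _ _ _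

theorem continuous_normSq (h : IsCompactification ρ gbar g) : Continuous (normSq ρ gbar) := by
  rw [continuous_iff_continuousAt]
  intro c
  have h1 := (contDiffOn_diffNormSq (b := stdBasis n) (uniqueDiffOn_extChartAt_target c)
    (contDiffOn_metricMatrix gbar c) (det_metricMatrix_ne_zero gbar c)
    (h.contDiffOn_rho c)).continuousOn
  have h2 := h1.comp (continuousOn_extChartAt (I := 𝓡∂ n) c)
    (fun p hp => (extChartAt (𝓡∂ n) c).map_source hp)
  have h3 : ContinuousOn (normSq ρ gbar) (extChartAt (𝓡∂ n) c).source :=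
    h2.congr fun p hp => h.normSq_eq hp
  exact h3.continuousAt (extChartAt_source_mem_nhds c)

/-- The conformal formula in the fixed chart around c. `scal_eq` is what permits the use of this
single chart for all nearby points. -/
theorem exists_scal_eq (h : IsCompactification ρ gbar g) (c : M) :
    ∃ B : M → ℝ, ContinuousOn B (extChartAt (𝓡∂ n) c).source ∧
      ∀ p ∈ (extChartAt (𝓡∂ n) c).source, p ∈ (𝓡∂ n).interior M →
        scal g p = - ((n : ℝ) * ((n : ℝ) - 1)) * normSq ρ gbar p + ρ p * B p := by
  obtain ⟨B, hB, hB'⟩ := exists_contract_ricciMatrix_conformal (b := stdBasis n)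
    (G := metricMatrix g c) (uniqueDiffOn_extChartAt_target c)
    (contDiffOn_metricMatrix gbar c) (det_metricMatrix_ne_zero gbar c)
    (metricMatrix_symm gbar c) (h.contDiffOn_rho c)
    (fun y hy => (h.pos (symm_mem_interior hy)).ne') (fun y hy => h.metricMatrix_eq hy)
  refine ⟨fun p => B (extChartAt (𝓡∂ n) c p), hB.comp (continuousOn_extChartAt (I := 𝓡∂ n) c)
    (fun p hp => (extChartAt (𝓡∂ n) c).map_source hp), fun p hp hpi => ?_⟩
  rw [h.scal_eq hp hpi, hB' _ (mem_chartDomain hp hpi), ← h.normSq_eq hp,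
    (extChartAt (𝓡∂ n) c).left_inv hp, Fintype.card_fin]

/-- Serves for the measurability of Scal. -/
theorem continuousOn_scal (h : IsCompactification ρ gbar g) :
    ContinuousOn (scal g) ((𝓡∂ n).interior M) := by
  intro c hc
  obtain ⟨B, hB, hB'⟩ := h.exists_scal_eq c
  have h1 : ContinuousOn (fun p => - ((n : ℝ) * ((n : ℝ) - 1)) * normSq ρ gbar p + ρ p * B p)
      (extChartAt (𝓡∂ n) c).source :=
    (continuousOn_const.mul h.continuous_normSq.continuousOn).add (h.continuous.continuousOn.mul hB)
  have h2 := (h1.continuousAt (extChartAt_source_mem_nhds c)).continuousWithinAt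
    (s := (𝓡∂ n).interior M)
  refine h2.congr_of_eventuallyEq ?_ (hB' c (mem_extChartAt_source c) hc)
  filter_upwards [self_mem_nhdsWithin, mem_nhdsWithin_of_mem_nhds (extChartAt_source_mem_nhds (I := 𝓡∂ n) c)]
    with p hp hp' using hB' p hp' hp

/-- The local remainders of `exists_scal_eq` are continuous up to the boundary, hence locally
bounded, and finitely many charts suffice. -/
theorem exists_scal_bound [CompactSpace M] (h : IsCompactification ρ gbar g) :
    ∃ C : ℝ, 0 ≤ C ∧ ∀ p ∈ (𝓡∂ n).interior M,
      |scal g p + (n : ℝ) * ((n : ℝ) - 1) * normSq ρ gbar p| ≤ C * ρ p := by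
  have key : ∃ C : ℝ, 0 ≤ C ∧ ∀ p ∈ (univ : Set M), p ∈ (𝓡∂ n).interior M →
      |scal g p + (n : ℝ) * ((n : ℝ) - 1) * normSq ρ gbar p| ≤ C * ρ p := by
    refine isCompact_univ.induction_on (p := fun s : Set M => ∃ C : ℝ, 0 ≤ C ∧ ∀ p ∈ s,
      p ∈ (𝓡∂ n).interior M →
      |scal g p + (n : ℝ) * ((n : ℝ) - 1) * normSq ρ gbar p| ≤ C * ρ p) ⟨0, le_rfl, by simp⟩
      ?_ ?_ ?_
    · rintro s t hst ⟨C, h0, hC⟩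
      exact ⟨C, h0, fun p hp => hC p (hst hp)⟩
    · rintro s t ⟨C, h0, hC⟩ ⟨C', h0', hC'⟩
      refine ⟨C + C', by positivity, fun p hp hpi => ?_⟩
      have hρ := h.defining.nonneg p
      rcases hp with hp | hp
      · refine (hC p hp hpi).trans ?_
        nlinarith
      · refine (hC' p hp hpi).trans ?_
        nlinarith
    · intro c _
      obtain ⟨B, hB, hB'⟩ := h.exists_scal_eq c
      have hcont : ContinuousAt B c := hB.continuousAt (extChartAt_source_mem_nhds c)
      have hev : ∀ᶠ p in 𝓝 c, |B p| < |B c| + 1 :=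
        hcont.abs.eventually (gt_mem_nhds (lt_add_one _))
      refine ⟨_, mem_nhdsWithin_of_mem_nhds
        (inter_mem hev (extChartAt_source_mem_nhds (I := 𝓡∂ n) c)), |B c| + 1, by positivity,
        fun p hp hpi => ?_⟩
      rw [hB' p hp.2 hpi]
      have hρ := h.defining.nonneg p
      have : |B p| ≤ |B c| + 1 := le_of_lt hp.1
      rw [show - ((n : ℝ) * ((n : ℝ) - 1)) * normSq ρ gbar p + ρ p * B p
        + (n : ℝ) * ((n : ℝ) - 1) * normSq ρ gbar p = ρ p * B p by ring, abs_mul,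
        abs_of_nonneg hρ, mul_comm]
      gcongr
  obtain ⟨C, h0, hC⟩ := key
  exact ⟨C, h0, fun p hp => hC p (mem_univ p) hp⟩

theorem normSq_eq_one (h : IsCompactification ρ gbar g) {p : M} (hp : p ∈ (𝓡∂ n).boundary M) :
    normSq ρ gbar p = 1 := h.normalized p hp

end IsCompactification

end AHYamabe
end

noncomputable section

namespace AHYamabe

open Filter Topology

/-! ### The volume measure -/

variable {n : ℕ} [NeZero n] {M : Type*} [TopologicalSpace M]
  [ChartedSpace (EuclideanHalfSpace n) M] [IsManifold (𝓡∂ n) ∞ M]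
  [MeasurableSpace M] [BorelSpace M]

theorem measurableSet_chartDomain (c : M) : MeasurableSet (chartDomain (n := n) c) :=
  isOpen_interior.measurableSet

theorem measurableSet_source (c : M) : MeasurableSet (extChartAt (𝓡∂ n) c).source :=
  (isOpen_extChartAt_source c).measurableSet

theorem continuousOn_symm_chartDomain (c : M) :
    ContinuousOn (extChartAt (𝓡∂ n) c).symm (chartDomain (n := n) c) :=
  (continuousOn_extChartAt_symm c).mono interior_subset

theorem aemeasurable_symm (c : M) {f : EuclideanSpace ℝ (Fin n) → ℝ≥0∞} :
    AEMeasurable (extChartAt (𝓡∂ n) c).symm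
      ((volume.restrict (chartDomain (n := n) c)).withDensity f) :=
  ((continuousOn_symm_chartDomain c).aemeasurable (measurableSet_chartDomain c)).mono_ac
    (withDensity_absolutelyContinuous _ _)

theorem measurableSet_chartDomain_inter (c : M) {s : Set M} (hs : MeasurableSet s) :
    MeasurableSet (chartDomain (n := n) c ∩ (extChartAt (𝓡∂ n) c).symm ⁻¹' s) := by
  have h1 : Measurable ((chartDomain (n := n) c).domRestrict (extChartAt (𝓡∂ n) c).symm) :=
    (continuousOn_iff_continuous_domRestrict.1 (continuousOn_symm_chartDomain c)).measurable
  have h2 := (MeasurableEmbedding.subtype_coe (measurableSet_chartDomain c)).measurableSet_image.2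
    (h1 hs)
  convert h2 using 1
  ext y
  simp [Set.domRestrict, and_comm]

theorem chartVolume_apply (g : BilinField n M) (c : M) {s : Set M} (hs : MeasurableSet s) :
    chartVolume g c s = ∫⁻ y in chartDomain (n := n) c ∩ (extChartAt (𝓡∂ n) c).symm ⁻¹' s,
      ENNReal.ofReal (Real.sqrt (metricMatrix g c y).det) := by
  have hm := measurableSet_chartDomain_inter (n := n) c hs
  rw [chartVolume, Measure.map_apply_of_aemeasurable (aemeasurable_symm c) hs]
  have h1 : ((volume.restrict (chartDomain (n := n) c)).withDensity fun y =>
      ENNReal.ofReal (Real.sqrt (metricMatrix g c y).det)) (chartDomain (n := n) c)ᶜ = 0 :=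
    withDensity_absolutelyContinuous _ _
      (by rw [Measure.restrict_apply (measurableSet_chartDomain c).compl]; simp)
  rw [← measure_inter_conull h1, inter_comm, withDensity_apply _ hm, Measure.restrict_restrict hm,
    inter_assoc, inter_comm _ (chartDomain c), ← inter_assoc, inter_self]

theorem chartVolume_compl_eq_zero (g : BilinField n M) (c : M) :
    chartVolume g c ((extChartAt (𝓡∂ n) c).source ∩ (𝓡∂ n).interior M)ᶜ = 0 := by
  have hm : MeasurableSet ((extChartAt (𝓡∂ n) c).source ∩ (𝓡∂ n).interior M) :=
    (measurableSet_source c).inter ((𝓡∂ n).isOpen_interior (n := ∞) (by simp)).measurableSet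
  rw [chartVolume_apply g c hm.compl]
  have : chartDomain (n := n) c ∩ (extChartAt (𝓡∂ n) c).symm ⁻¹'
      ((extChartAt (𝓡∂ n) c).source ∩ (𝓡∂ n).interior M)ᶜ = ∅ := by
    ext y
    simp only [mem_inter_iff, mem_preimage, mem_compl_iff, mem_empty_iff_false, iff_false]
    rintro ⟨h1, h2⟩
    exact h2 ⟨(extChartAt (𝓡∂ n) c).map_target (interior_subset h1), symm_mem_interior h1⟩
  rw [this]; simp

/-- The Gram matrix transforms by Jᵀ · J, so the square root of its determinant acquires |det J|,
exactly the factor in the change of variables formula. -/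
theorem sqrt_det_metricMatrix (g : BilinField n M) {c c' : M} {y : EuclideanSpace ℝ (Fin n)}
    (hy : y ∈ chartDomain (n := n) c)
    (hy' : (extChartAt (𝓡∂ n) c).symm y ∈ (extChartAt (𝓡∂ n) c').source) :
    Real.sqrt (metricMatrix g c y).det
      = |(tangentCoordChange (𝓡∂ n) c c' ((extChartAt (𝓡∂ n) c).symm y)).det|
        * Real.sqrt (metricMatrix g c'
          (extChartAt (𝓡∂ n) c' ((extChartAt (𝓡∂ n) c).symm y))).det := by
  have hyT := interior_subset hy
  set p := (extChartAt (𝓡∂ n) c).symm y with hp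
  have hps : p ∈ (extChartAt (𝓡∂ n) c).source := (extChartAt (𝓡∂ n) c).map_target hyT
  have e1 := metricMatrix_eq g hyT
  have e2 := metricMatrix_eq g ((extChartAt (𝓡∂ n) c').map_source hy')
  rw [(extChartAt (𝓡∂ n) c').left_inv hy'] at e2
  have e3 : (jacMatrix (n := n) c c' p).det = (tangentCoordChange (𝓡∂ n) c c' p).det :=
    LinearMap.det_toMatrix _ _
  rw [e1, e2, frameGram_eq hps hy', Matrix.det_mul, Matrix.det_mul, Matrix.det_transpose, e3,
    mul_comm, ← mul_assoc, Real.sqrt_mul (mul_self_nonneg _), Real.sqrt_mul_self_eq_abs]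

/-- The measures of two charts agree on the intersection of their domains. -/
theorem chartVolume_eq (g : BilinField n M) {c c' : M} {s : Set M} (hs : MeasurableSet s)
    (hsc : s ⊆ (extChartAt (𝓡∂ n) c).source) (hsc' : s ⊆ (extChartAt (𝓡∂ n) c').source) :
    chartVolume g c s = chartVolume g c' s := by
  rw [chartVolume_apply g c hs, chartVolume_apply g c' hs]
  set U := chartDomain (n := n) c ∩ (extChartAt (𝓡∂ n) c).symm ⁻¹' s with hU
  set φ := extChartAt (𝓡∂ n) c' ∘ (extChartAt (𝓡∂ n) c).symm with hφ
  have himg : φ '' U = chartDomain (n := n) c' ∩ (extChartAt (𝓡∂ n) c').symm ⁻¹' s := by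
    ext z
    constructor
    · rintro ⟨y, ⟨hy, hys⟩, rfl⟩
      refine ⟨mem_chartDomain (hsc' hys) (symm_mem_interior hy), ?_⟩
      rw [mem_preimage, hφ, Function.comp_apply, (extChartAt (𝓡∂ n) c').left_inv (hsc' hys)]
      exact hys
    · rintro ⟨hz, hzs⟩
      refine ⟨extChartAt (𝓡∂ n) c ((extChartAt (𝓡∂ n) c').symm z),
        ⟨mem_chartDomain (hsc hzs) (symm_mem_interior hz), ?_⟩, ?_⟩
      · rw [mem_preimage, (extChartAt (𝓡∂ n) c).left_inv (hsc hzs)]; exact hzs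
      · rw [hφ, Function.comp_apply, (extChartAt (𝓡∂ n) c).left_inv (hsc hzs),
          (extChartAt (𝓡∂ n) c').right_inv (interior_subset hz)]
  have hinj : InjOn φ U := by
    intro y hy z hz hyz
    have h1 := (extChartAt (𝓡∂ n) c').injOn (hsc' hy.2) (hsc' hz.2) hyz
    exact (extChartAt (𝓡∂ n) c).symm.injOn (interior_subset hy.1) (interior_subset hz.1) h1
  rw [← himg, lintegral_image_eq_lintegral_abs_det_fderiv_mul volume
    (measurableSet_chartDomain_inter c hs)
    (fun y hy => (fderiv_coordChange hy.1 (hsc' hy.2)).hasFDerivWithinAt) hinj]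
  refine setLIntegral_congr_fun (measurableSet_chartDomain_inter c hs) fun y hy => ?_
  rw [sqrt_det_metricMatrix g hy.1 (hsc' hy.2), ENNReal.ofReal_mul (abs_nonneg _)]
  rfl

/-- A supremum of measures is not computed set by set, so upper bounds for `riemVolume` require a
measure dominating all chart measures. It is glued one chart at a time: the chart measure on the new
source, the previous measure off it. -/
theorem exists_measure_eq_chartVolume (g : BilinField n M) (t : Finset M) :
    ∃ ν : Measure M, ∀ c : M, ∀ s : Set M, MeasurableSet s → s ⊆ (extChartAt (𝓡∂ n) c).source →
      s ⊆ ⋃ a ∈ t, (extChartAt (𝓡∂ n) a).source → ν s = chartVolume g c s := by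
  classical
  induction t using Finset.induction_on with
  | empty =>
    refine ⟨0, fun c s _ _ hs => ?_⟩
    have : s = ∅ := by simpa using hs
    simp [this]
  | insert a t _ ih =>
    obtain ⟨ν, hν⟩ := ih
    have hma := measurableSet_source (n := n) a
    refine ⟨(chartVolume g a).restrict (extChartAt (𝓡∂ n) a).source
      + ν.restrict (extChartAt (𝓡∂ n) a).sourceᶜ, fun c s hs hsc hst => ?_⟩
    rw [Measure.add_apply, Measure.restrict_apply hs, Measure.restrict_apply hs,
      chartVolume_eq g (hs.inter hma) inter_subset_right (inter_subset_left.trans hsc),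
      hν c _ (hs.inter hma.compl) (inter_subset_left.trans hsc), ← sdiff_eq,
      measure_inter_add_sdiff _ hma]
    rintro p ⟨hp, hpa⟩
    have := hst hp
    simp only [Finset.mem_insert, iUnion_iUnion_eq_or_left, mem_union] at this
    exact this.resolve_left hpa

theorem exists_finset_source_cover [CompactSpace M] :
    ∃ t : Finset M, (univ : Set M) ⊆ ⋃ a ∈ t, (extChartAt (𝓡∂ n) a).source :=
  (isCompact_univ.elim_nhds_subcover (fun a => (extChartAt (𝓡∂ n) a).source)
    (fun a _ => extChartAt_source_mem_nhds a)).imp fun _ h => h.2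

variable [CompactSpace M]

theorem riemVolume_apply (g : BilinField n M) (c : M) {s : Set M} (hs : MeasurableSet s)
    (hsc : s ⊆ (extChartAt (𝓡∂ n) c).source) : riemVolume g s = chartVolume g c s := by
  obtain ⟨t, ht⟩ := exists_finset_source_cover (n := n) (M := M)
  obtain ⟨ν, hν⟩ := exists_measure_eq_chartVolume g t
  refine le_antisymm ?_ (Measure.le_iff.1 (le_iSup (fun c => chartVolume g c) c) s hs)
  rw [← hν c s hs hsc ((subset_univ _).trans ht)]
  -- The glued measure ν dominates every chart measure, hence their supremum; on s it equals the
  -- measure of the chart around c.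
  refine Measure.le_iff.1 (iSup_le fun a => Measure.le_iff.2 fun B hB => ?_) s hs
  have h0 : chartVolume g a (extChartAt (𝓡∂ n) a).sourceᶜ = 0 :=
    measure_mono_null (compl_subset_compl.2 inter_subset_left) (chartVolume_compl_eq_zero g a)
  rw [← measure_inter_conull h0, ← hν a _ (hB.inter (measurableSet_source a)) inter_subset_right
    ((subset_univ _).trans ht)]
  exact measure_mono inter_subset_left

/-- The volume measure in a chart. -/
theorem riemVolume_restrict (g : BilinField n M) (c : M) :
    (riemVolume g).restrict (extChartAt (𝓡∂ n) c).source = chartVolume g c := by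
  ext s hs
  have h0 : chartVolume g c (extChartAt (𝓡∂ n) c).sourceᶜ = 0 :=
    measure_mono_null (compl_subset_compl.2 inter_subset_left) (chartVolume_compl_eq_zero g c)
  rw [Measure.restrict_apply hs,
    riemVolume_apply g c (hs.inter (measurableSet_source c)) inter_subset_right,
    measure_inter_conull h0]

theorem riemVolume_compl_interior (g : BilinField n M) :
    riemVolume g ((𝓡∂ n).interior M)ᶜ = 0 := by
  obtain ⟨t, ht⟩ := exists_finset_source_cover (n := n) (M := M)
  have hm : MeasurableSet ((𝓡∂ n).interior M)ᶜ :=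
    ((𝓡∂ n).isOpen_interior (n := ∞) (by simp)).measurableSet.compl
  have h1 : ((𝓡∂ n).interior M)ᶜ
      ⊆ ⋃ a ∈ t, ((𝓡∂ n).interior M)ᶜ ∩ (extChartAt (𝓡∂ n) a).source := by
    intro p hp
    obtain ⟨a, ha, hpa⟩ := mem_iUnion₂.1 (ht (mem_univ p))
    exact mem_iUnion₂.2 ⟨a, ha, hp, hpa⟩
  refine measure_mono_null h1 ((measure_biUnion_null_iff t.countable_toSet).2 fun a _ => ?_)
  rw [riemVolume_apply g a (hm.inter (measurableSet_source a)) inter_subset_right]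
  refine measure_mono_null ?_ (chartVolume_compl_eq_zero g a)
  rintro p ⟨hp, -⟩ ⟨-, h2⟩
  exact hp h2

theorem ae_mem_interior (g : BilinField n M) :
    ∀ᵐ p ∂(riemVolume g), p ∈ (𝓡∂ n).interior M :=
  riemVolume_compl_interior g

namespace IsCompactification

variable {ρ : M → ℝ} {gbar : C2Metric n M} {g : BilinField n M}

omit [MeasurableSpace M] [BorelSpace M] [CompactSpace M] in
theorem continuousOn_sqrt_det (h : IsCompactification ρ gbar g) (c : M) :
    ContinuousOn (fun y => Real.sqrt (metricMatrix g c y).det) (chartDomain (n := n) c) := by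
  refine Real.continuous_sqrt.comp_continuousOn fun y hy => ?_
  have h1 := contDiffWithinAt_det (s := univ) (A := metricMatrix g c) (y := y)
    fun i j => (h.contDiffAt_metricMatrix hy i j).contDiffWithinAt
  exact (contDiffWithinAt_univ.1 h1).continuousAt.continuousWithinAt

omit [MeasurableSpace M] [BorelSpace M] [CompactSpace M] in
theorem aemeasurable_density (h : IsCompactification ρ gbar g) (c : M) :
    AEMeasurable (fun y => ENNReal.ofReal (Real.sqrt (metricMatrix g c y).det))
      (volume.restrict (chartDomain (n := n) c)) :=
  ((h.continuousOn_sqrt_det c).aemeasurable (isOpen_interior.measurableSet)).ennreal_ofReal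

theorem setIntegral_source (h : IsCompactification ρ gbar g) (c : M) {F : M → ℝ}
    (hF : AEStronglyMeasurable F (riemVolume g)) :
    ∫ p in (extChartAt (𝓡∂ n) c).source, F p ∂(riemVolume g)
      = ∫ y in chartDomain (n := n) c, Real.sqrt (metricMatrix g c y).det
        * F ((extChartAt (𝓡∂ n) c).symm y) := by
  have hF' : AEStronglyMeasurable F (chartVolume g c) := by
    rw [← riemVolume_restrict]; exact hF.restrict
  rw [riemVolume_restrict, chartVolume, integral_map (aemeasurable_symm c) hF',
    integral_withDensity_eq_integral_toReal_smul₀ (h.aemeasurable_density c) (by simp)]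
  simp [ENNReal.toReal_ofReal]

theorem integrableOn_source (h : IsCompactification ρ gbar g) (c : M) {F : M → ℝ}
    (hF : Integrable F (riemVolume g)) :
    IntegrableOn (fun y => Real.sqrt (metricMatrix g c y).det
        * F ((extChartAt (𝓡∂ n) c).symm y)) (chartDomain (n := n) c) := by
  have hF' : Integrable F (chartVolume g c) := by
    rw [← riemVolume_restrict]; exact hF.restrict
  rw [chartVolume, integrable_map_measure hF'.1 (aemeasurable_symm c),
    integrable_withDensity_iff_integrable_smul₀' (h.aemeasurable_density c) (by simp)] at hF'
  refine Integrable.congr hF' (ae_of_all _ fun y => ?_)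
  simp [ENNReal.toReal_ofReal]

/-- The set is compact and consists of interior points, near which the volume density is continuous.
-/
theorem measure_ge_lt_top (h : IsCompactification ρ gbar g) {δ : ℝ} (hδ : 0 < δ) :
    riemVolume g {p | δ ≤ ρ p} < ⊤ := by
  have hK : IsCompact {p | δ ≤ ρ p} :=
    (isClosed_le continuous_const h.continuous).isCompact
  refine hK.measure_lt_top_of_nhdsWithin fun p hp => ?_
  have hpi := h.mem_interior (hδ.trans_le hp)
  have hpp := mem_extChartAt_source (I := 𝓡∂ n) p
  have hy := mem_chartDomain hpp hpi
  obtain ⟨ε, hε, hball⟩ := Metric.nhds_basis_closedBall.mem_iff.1 (isOpen_interior.mem_nhds hy)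
  have hnhds : (extChartAt (𝓡∂ n) p).source ∩ extChartAt (𝓡∂ n) p ⁻¹' Metric.ball
      (extChartAt (𝓡∂ n) p p) ε ∈ 𝓝 p :=
    inter_mem (extChartAt_source_mem_nhds p)
      ((continuousAt_extChartAt p).preimage_mem_nhds (Metric.ball_mem_nhds _ hε))
  refine ⟨_, mem_nhdsWithin_of_mem_nhds hnhds, ?_⟩
  have hm : MeasurableSet ((extChartAt (𝓡∂ n) p).source ∩ extChartAt (𝓡∂ n) p ⁻¹' Metric.ball
      (extChartAt (𝓡∂ n) p p) ε) :=
    ((continuousOn_extChartAt p).isOpen_inter_preimage (isOpen_extChartAt_source p)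
      Metric.isOpen_ball).measurableSet
  rw [riemVolume_apply g p hm inter_subset_left, chartVolume_apply g p hm]
  have hsub : chartDomain (n := n) p ∩ (extChartAt (𝓡∂ n) p).symm ⁻¹'
      ((extChartAt (𝓡∂ n) p).source ∩ extChartAt (𝓡∂ n) p ⁻¹' Metric.ball
      (extChartAt (𝓡∂ n) p p) ε) ⊆ Metric.closedBall (extChartAt (𝓡∂ n) p p) ε := by
    rintro y ⟨hyD, -, h2⟩
    rw [mem_preimage, (extChartAt (𝓡∂ n) p).right_inv (interior_subset hyD)] at h2
    exact Metric.ball_subset_closedBall h2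
  refine (lintegral_mono_set hsub).trans_lt ?_
  have hint : IntegrableOn (fun y => Real.sqrt (metricMatrix g p y).det)
      (Metric.closedBall (extChartAt (𝓡∂ n) p p) ε) :=
    ((h.continuousOn_sqrt_det p).mono hball).integrableOn_compact (isCompact_closedBall _ _)
  exact hint.lintegral_lt_top

end IsCompactification

end AHYamabe
end

noncomputable section

namespace AHYamabe

open Filter Topology

/-! ### Cutting off near the boundary -/

/-- A smooth step, equal to `0` on `(-∞, 1]` and to `1` on `[2, ∞)`. -/
def step (x : ℝ) : ℝ := Real.smoothTransition (x - 1)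

theorem contDiff_step : ContDiff ℝ ∞ step :=
  Real.smoothTransition.contDiff.comp (contDiff_id.sub contDiff_const)

theorem step_nonneg (x : ℝ) : 0 ≤ step x := Real.smoothTransition.nonneg _

theorem step_le_one (x : ℝ) : step x ≤ 1 := Real.smoothTransition.le_one _

theorem step_eq_zero {x : ℝ} (hx : x ≤ 1) : step x = 0 :=
  Real.smoothTransition.zero_of_nonpos (by linarith)

theorem step_eq_one {x : ℝ} (hx : 2 ≤ x) : step x = 1 :=
  Real.smoothTransition.one_of_one_le (by linarith)

theorem deriv_step_eq_zero_of_lt {x : ℝ} (hx : x < 1) : deriv step x = 0 := by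
  have : step =ᶠ[𝓝 x] fun _ => 0 := by
    filter_upwards [gt_mem_nhds hx] with z hz using step_eq_zero hz.le
  rw [this.deriv_eq]; simp

theorem deriv_step_eq_zero_of_gt {x : ℝ} (hx : 2 < x) : deriv step x = 0 := by
  have : step =ᶠ[𝓝 x] fun _ => 1 := by
    filter_upwards [lt_mem_nhds hx] with z hz using step_eq_one hz.le
  rw [this.deriv_eq]; simp

/-- Scale invariance: the derivative of step (k r) is O(1/r) uniformly in k, that is, bounded in
terms of the hyperbolic metric. -/
theorem exists_mul_deriv_step_bound : ∃ C : ℝ, 0 ≤ C ∧ ∀ x, |x * deriv step x| ≤ C := by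
  have hc : Continuous fun x => x * deriv step x :=
    continuous_id.mul (contDiff_step.continuous_deriv (by simp))
  obtain ⟨C, hC⟩ := (isCompact_Icc (a := (1 : ℝ)) (b := 2)).exists_bound_of_continuousOn
    hc.continuousOn
  refine ⟨max C 0, le_max_right _ _, fun x => ?_⟩
  by_cases h1 : x < 1
  · simp [deriv_step_eq_zero_of_lt h1]
  by_cases h2 : 2 < x
  · simp [deriv_step_eq_zero_of_gt h2]
  exact (hC x ⟨not_lt.1 h1, not_lt.1 h2⟩).trans (le_max_left _ _)

theorem contDiff_indicator_of_eq_zero {E : Type*} [NormedAddCommGroup E] [NormedSpace ℝ E]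
    {D K : Set E} {f : E → ℝ} (hD : IsOpen D) (hK : IsCompact K) (hKD : K ⊆ D)
    (hf : ContDiffOn ℝ 1 f D) (h0 : ∀ y ∈ D, y ∉ K → f y = 0) :
    ContDiff ℝ 1 (D.indicator f) ∧ tsupport (D.indicator f) ⊆ K := by
  have hs : ∀ y ∉ K, D.indicator f y = 0 := by
    intro y hy
    by_cases hyD : y ∈ D
    · rw [indicator_of_mem hyD, h0 y hyD hy]
    · rw [indicator_of_notMem hyD]
  refine ⟨contDiff_iff_contDiffAt.2 fun y => ?_, ?_⟩
  · by_cases hyD : y ∈ D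
    · refine (hf.contDiffAt (hD.mem_nhds hyD)).congr_of_eventuallyEq ?_
      filter_upwards [hD.mem_nhds hyD] with z hz using indicator_of_mem hz f
    · have hyK : y ∉ K := fun h => hyD (hKD h)
      refine (contDiffAt_const (c := (0 : ℝ))).congr_of_eventuallyEq ?_
      filter_upwards [hK.isClosed.isOpen_compl.mem_nhds hyK] with z hz using hs z hz
  · refine closure_minimal (fun y hy => ?_) hK.isClosed
    by_contra hyK
    exact hy (hs y hyK)

variable {n : ℕ}

/-- A chart of a conformally compact metric: `T` is the image of the chart, `r` the defining
function, `P` the compactified metric and `K` a compact part of the chart. -/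
structure IsChartModel (T K : Set (EuclideanSpace ℝ (Fin n))) (r : EuclideanSpace ℝ (Fin n) → ℝ)
    (P : EuclideanSpace ℝ (Fin n) → Matrix (Fin n) (Fin n) ℝ) : Prop where
  uniqueDiffOn : UniqueDiffOn ℝ T
  isCompact : IsCompact K
  subset : K ⊆ T
  mem_interior : ∀ y ∈ K, 0 < r y → y ∈ interior T
  contDiffOn : ContDiffOn ℝ 2 r T
  pos : ∀ y ∈ interior T, 0 < r y
  contDiffOn_metric : ∀ i j, ContDiffOn ℝ 2 (fun y => P y i j) T
  posDef : ∀ y ∈ T, (P y).PosDef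

variable {T K : Set (EuclideanSpace ℝ (Fin n))} {r b f : EuclideanSpace ℝ (Fin n) → ℝ}
  {P : EuclideanSpace ℝ (Fin n) → Matrix (Fin n) (Fin n) ℝ}
  {a : Fin n → EuclideanSpace ℝ (Fin n) → ℝ}

theorem IsWeakGradient.aestronglyMeasurable {D : Set (EuclideanSpace ℝ (Fin n))} (hD : IsOpen D)
    (hf : ∀ K ⊆ D, IsCompact K → MemLp f 2 (volume.restrict K)) :
    AEStronglyMeasurable f (volume.restrict D) := by
  refine LocallyIntegrableOn.aestronglyMeasurable
    ((locallyIntegrableOn_iff hD.isLocallyClosed).2 fun L hL hLc => ?_)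
  have : IsFiniteMeasure (volume.restrict L) := ⟨by simpa using hLc.measure_lt_top⟩
  exact (hf L hL hLc).integrable (by norm_num)

/-- The function `r ^ β b`, cut off near the boundary. -/
def cutoffTest (T : Set (EuclideanSpace ℝ (Fin n))) (r b : EuclideanSpace ℝ (Fin n) → ℝ) (β : ℝ)
    (k : ℕ) : EuclideanSpace ℝ (Fin n) → ℝ :=
  (interior T).indicator fun y => step (k * r y) * r y ^ β * b y

/-- The density of the volume measure of `r⁻² P`. -/
def dens (r : EuclideanSpace ℝ (Fin n) → ℝ)
    (P : EuclideanSpace ℝ (Fin n) → Matrix (Fin n) (Fin n) ℝ) (y : EuclideanSpace ℝ (Fin n)) : ℝ :=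
  r y ^ (-(n : ℝ)) * Real.sqrt (P y).det

/-- The squared norm of the covector `v` for the metric `A`. -/
def coNormSq (A : Matrix (Fin n) (Fin n) ℝ) (v : Fin n → ℝ) : ℝ :=
  contract A (Matrix.of fun i j => v i * v j)

namespace IsChartModel

/-- As step (k r) vanishes for r ≤ 1/k, the support lies in K ∩ {r ≥ 1/k}, a compact subset of the
interior. -/
theorem contDiff_cutoffTest (h : IsChartModel T K r P) (hb : ContDiffOn ℝ 1 b T)
    (hb0 : ∀ y ∈ T, y ∉ K → b y = 0) (β : ℝ) {k : ℕ} (hk : 0 < k) :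
    ContDiff ℝ 1 (cutoffTest T r b β k) ∧ HasCompactSupport (cutoffTest T r b β k) ∧
      tsupport (cutoffTest T r b β k) ⊆ interior T := by
  have hk' : (0 : ℝ) < k := by exact_mod_cast hk
  set L := K ∩ r ⁻¹' Ici ((k : ℝ)⁻¹) with hL
  have hLc : IsCompact L := by
    refine h.isCompact.of_isClosed_subset ?_ inter_subset_left
    exact (h.contDiffOn.continuousOn.mono h.subset).preimage_isClosed_of_isClosed
      h.isCompact.isClosed isClosed_Ici
  have hLD : L ⊆ interior T := fun y hy =>
    h.mem_interior y hy.1 ((inv_pos.2 hk').trans_le hy.2)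
  have hr1 : ContDiffOn ℝ 1 r (interior T) :=
    (h.contDiffOn.mono interior_subset).of_le (by norm_num)
  have hcd : ContDiffOn ℝ 1 (fun y => step (k * r y) * r y ^ β * b y) (interior T) := by
    refine ContDiffOn.mul (ContDiffOn.mul ?_ ?_) (hb.mono interior_subset)
    · exact (contDiff_step.of_le (by simp)).comp_contDiffOn (contDiffOn_const.mul hr1)
    · exact hr1.rpow_const_of_ne fun y hy => (h.pos y hy).ne'
  have h0 : ∀ y ∈ interior T, y ∉ L → step (k * r y) * r y ^ β * b y = 0 := by
    intro y hy hyL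
    by_cases hyK : y ∈ K
    · have : r y < (k : ℝ)⁻¹ := not_le.1 fun hle => hyL ⟨hyK, hle⟩
      have h2 : k * r y ≤ 1 := by
        have := mul_le_mul_of_nonneg_left this.le hk'.le
        rwa [mul_inv_cancel₀ hk'.ne'] at this
      rw [step_eq_zero h2]; simp
    · rw [hb0 y (interior_subset hy) hyK, mul_zero]
  obtain ⟨h1, h2⟩ := contDiff_indicator_of_eq_zero isOpen_interior hLc hLD hcd h0
  exact ⟨h1, hLc.of_isClosed_subset (isClosed_tsupport _) h2, h2.trans hLD⟩

theorem partialD_cutoffTest (h : IsChartModel T K r P) (hb : ContDiffOn ℝ 1 b T) (β : ℝ) (k : ℕ)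
    {y : EuclideanSpace ℝ (Fin n)} (hy : y ∈ interior T) (i : Fin n) :
    partialD i (cutoffTest T r b β k) y
      = step (k * r y) * (r y ^ β * diffWithin (stdBasis n) T b y i
          + β * r y ^ (β - 1) * diffWithin (stdBasis n) T r y i * b y)
        + k * deriv step (k * r y) * diffWithin (stdBasis n) T r y i * r y ^ β * b y := by
  have hry := h.pos y hy
  have d1 := ContDiffOn.hasFDerivAt_of_mem_interior h.contDiffOn (by norm_num) hy
  have d2 := ContDiffOn.hasFDerivAt_of_mem_interior hb one_ne_zero hy
  have d0 : HasDerivAt step (deriv step (k * r y)) (k * r y) :=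
    ((contDiff_step.differentiable (by simp)) (k * r y)).hasDerivAt
  have d3 := d0.comp_hasFDerivAt y (d1.const_mul (k : ℝ))
  have d4 := d1.rpow_const (p := β) (Or.inl hry.ne')
  have d5 : HasFDerivAt (fun y => step (k * r y) * r y ^ β * b y) _ y := (d3.mul d4).mul d2
  have hev : cutoffTest T r b β k =ᶠ[𝓝 y] fun y => step (k * r y) * r y ^ β * b y := by
    filter_upwards [isOpen_interior.mem_nhds hy] with z hz using indicator_of_mem hz _
  rw [partialD, hev.fderiv_eq, d5.fderiv]
  simp only [diffWithin, stdBasis_apply, add_apply, smul_apply, smul_eq_mul, Pi.mul_apply,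
    Function.comp_apply]
  ring

theorem diffWithin_eq_zero (h : IsChartModel T K r P) (hb0 : ∀ y ∈ T, y ∉ K → b y = 0)
    {y : EuclideanSpace ℝ (Fin n)} (hy : y ∈ interior T) (hyK : y ∉ K) (i : Fin n) :
    diffWithin (stdBasis n) T b y i = 0 := by
  have hev : b =ᶠ[𝓝 y] fun _ => 0 := by
    filter_upwards [isOpen_interior.mem_nhds hy, h.isCompact.isClosed.isOpen_compl.mem_nhds hyK]
      with z hz hzK using hb0 z (interior_subset hz) hzK
  rw [diffWithin, fderivWithin_of_mem_nhds (mem_interior_iff_mem_nhds.1 hy), hev.fderiv_eq]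
  simp

/-- At a fixed interior point the cutoff is inactive for large k; this gives the pointwise limits
below. -/
theorem tendsto_step {x : ℝ} (hx : 0 < x) :
    ∀ᶠ k : ℕ in atTop, step (k * x) = 1 ∧ deriv step (k * x) = 0 := by
  obtain ⟨N, hN⟩ := exists_nat_gt (2 / x)
  filter_upwards [eventually_ge_atTop N] with k hk
  have h1 : 2 / x < k := hN.trans_le (by exact_mod_cast hk)
  have h2 : 2 < k * x := by rwa [div_lt_iff₀ hx] at h1
  exact ⟨step_eq_one h2.le, deriv_step_eq_zero_of_gt h2⟩

end IsChartModel

end AHYamabe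
end

noncomputable section

namespace AHYamabe

open Filter Topology

variable {n : ℕ}

/-! ### Norms of covectors -/

section

variable {A : Matrix (Fin n) (Fin n) ℝ}

theorem coNormSq_eq (A : Matrix (Fin n) (Fin n) ℝ) (v : Fin n → ℝ) :
    coNormSq A v = dotProduct v (A⁻¹.mulVec v) := by
  simp only [coNormSq, contract, Matrix.of_apply, dotProduct, Matrix.mulVec, Finset.mul_sum]
  refine Finset.sum_congr rfl fun i _ => Finset.sum_congr rfl fun j _ => ?_
  ring

theorem coNormSq_nonneg (hA : A.PosDef) (v : Fin n → ℝ) : 0 ≤ coNormSq A v := by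
  rw [coNormSq_eq]
  simpa using hA.inv.posSemidef.dotProduct_mulVec_nonneg v

theorem sq_dotProduct_inv_mulVec_le (hA : A.PosDef) (v w : Fin n → ℝ) :
    (dotProduct v (A⁻¹.mulVec w)) ^ 2 ≤ coNormSq A v * coNormSq A w := by
  have hsymm : dotProduct w (A⁻¹.mulVec v) = dotProduct v (A⁻¹.mulVec w) := by
    have hT : A⁻¹.transpose = A⁻¹ := by
      have := hA.inv.isHermitian.eq
      rwa [Matrix.conjTranspose_eq_transpose_of_trivial] at this
    rw [Matrix.dotProduct_mulVec, ← Matrix.mulVec_transpose, hT, dotProduct_comm]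
  have h : ∀ x : ℝ, 0 ≤ coNormSq A w * (x * x) + 2 * dotProduct v (A⁻¹.mulVec w) * x
      + coNormSq A v := by
    intro x
    have h1 := coNormSq_nonneg hA (v + x • w)
    rw [coNormSq_eq, Matrix.mulVec_add, Matrix.mulVec_smul, add_dotProduct, dotProduct_add,
      dotProduct_add, smul_dotProduct, smul_dotProduct, dotProduct_smul, dotProduct_smul, hsymm,
      ← coNormSq_eq, ← coNormSq_eq] at h1
    simp only [smul_eq_mul] at h1
    linarith
  have h2 := discrim_le_zero h
  rw [discrim] at h2
  nlinarith

/-- Cauchy–Schwarz against e = A eᵢ: the pairing of v with e is vᵢ, and the squared norm of e is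
Aᵢᵢ. -/
theorem sq_le_mul_coNormSq (hA : A.PosDef) (v : Fin n → ℝ) (i : Fin n) :
    v i ^ 2 ≤ A i i * coNormSq A v := by
  have hu : IsUnit A.det := hA.det_pos.ne'.isUnit
  set e : Fin n → ℝ := A.mulVec (Pi.single i 1) with he
  have h1 := sq_dotProduct_inv_mulVec_le hA v e
  have h2 : A⁻¹.mulVec e = Pi.single i 1 := by
    rw [he, Matrix.mulVec_mulVec, Matrix.nonsing_inv_mul _ hu, Matrix.one_mulVec]
  have h3 : coNormSq A e = A i i := by
    rw [coNormSq_eq, h2]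
    simp [he]
  rw [h2, h3] at h1
  simp at h1
  linarith

end

variable {T K : Set (EuclideanSpace ℝ (Fin n))} {r b f : EuclideanSpace ℝ (Fin n) → ℝ}
  {P : EuclideanSpace ℝ (Fin n) → Matrix (Fin n) (Fin n) ℝ}
  {a : Fin n → EuclideanSpace ℝ (Fin n) → ℝ}

namespace IsChartModel

theorem exists_bound (h : IsChartModel T K r P) {F : EuclideanSpace ℝ (Fin n) → ℝ}
    (hF : ContinuousOn F T) : ∃ C : ℝ, 0 ≤ C ∧ ∀ y ∈ K, |F y| ≤ C := by
  obtain ⟨C, hC⟩ := h.isCompact.exists_bound_of_continuousOn (hF.mono h.subset)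
  exact ⟨max C 0, le_max_right _ _, fun y hy => (hC y hy).trans (le_max_left _ _)⟩

theorem continuousOn_sqrt_det (h : IsChartModel T K r P) :
    ContinuousOn (fun y => Real.sqrt (P y).det) T :=
  Real.continuous_sqrt.comp_continuousOn fun y hy =>
    (contDiffWithinAt_det fun i j => h.contDiffOn_metric i j y hy).continuousWithinAt

theorem sqrt_det_pos (h : IsChartModel T K r P) {y : EuclideanSpace ℝ (Fin n)} (hy : y ∈ T) :
    0 < Real.sqrt (P y).det := Real.sqrt_pos.2 (h.posDef y hy).det_pos

theorem contDiffOn_sqrt_det (h : IsChartModel T K r P) :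
    ContDiffOn ℝ 2 (fun y => Real.sqrt (P y).det) T := fun y hy =>
  (contDiffWithinAt_det fun i j => h.contDiffOn_metric i j y hy).sqrt (h.posDef y hy).det_pos.ne'

theorem dens_pos (h : IsChartModel T K r P) {y : EuclideanSpace ℝ (Fin n)}
    (hy : y ∈ interior T) : 0 < dens r P y :=
  mul_pos (Real.rpow_pos_of_pos (h.pos y hy) _) (h.sqrt_det_pos (interior_subset hy))

theorem continuousOn_dens (h : IsChartModel T K r P) : ContinuousOn (dens r P) (interior T) :=
  ((h.contDiffOn.continuousOn.mono interior_subset).rpow_const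
    fun y hy => Or.inl (h.pos y hy).ne').mul (h.continuousOn_sqrt_det.mono interior_subset)

/-- On `K` the density is comparable with `r ^ (-n)`. -/
theorem exists_rpow_le_dens (h : IsChartModel T K r P) : ∃ C : ℝ, 0 < C ∧
    ∀ y ∈ K, y ∈ interior T → r y ^ (-(n : ℝ)) ≤ C * dens r P y := by
  obtain ⟨C, hC0, hC⟩ := h.exists_bound (F := fun y => (Real.sqrt (P y).det)⁻¹)
    (h.continuousOn_sqrt_det.inv₀ fun y hy => (h.sqrt_det_pos hy).ne')
  refine ⟨C + 1, by positivity, fun y hyK hy => ?_⟩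
  have hw := h.sqrt_det_pos (h.subset hyK)
  have h1 : 1 ≤ (C + 1) * Real.sqrt (P y).det := by
    have := hC y hyK
    rw [abs_of_pos (inv_pos.2 hw), inv_le_iff_one_le_mul₀ hw] at this
    nlinarith
  have h2 := Real.rpow_pos_of_pos (h.pos y hy) (-(n : ℝ))
  rw [dens]
  nlinarith

theorem exists_sq_le_coNormSq (h : IsChartModel T K r P) : ∃ C : ℝ, 0 < C ∧
    ∀ y ∈ K, ∀ (v : Fin n → ℝ) i, v i ^ 2 ≤ C * coNormSq (P y) v := by
  choose C hC0 hC using fun i => h.exists_bound (h.contDiffOn_metric i i).continuousOn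
  refine ⟨∑ i, C i + 1, by have := Finset.sum_nonneg fun i (_ : i ∈ Finset.univ) => hC0 i; linarith,
    fun y hy v i => ?_⟩
  refine (sq_le_mul_coNormSq (h.posDef y (h.subset hy)) v i).trans ?_
  refine mul_le_mul_of_nonneg_right ?_ (coNormSq_nonneg (h.posDef y (h.subset hy)) v)
  have h1 := (le_abs_self _).trans (hC i y hy)
  have h2 := Finset.single_le_sum (fun i (_ : i ∈ Finset.univ) => hC0 i) (Finset.mem_univ i)
  linarith

/-- A derivative costs one power of r, whether it falls on b, on r^β or on the cutoff. The constant
is independent of k, as dominated convergence requires. -/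
theorem cutoffTest_bound (h : IsChartModel T K r P) (hb : ContDiffOn ℝ 1 b T)
    (hb0 : ∀ y ∈ T, y ∉ K → b y = 0) (β : ℝ) : ∃ C : ℝ, 0 ≤ C ∧
      ∀ (k : ℕ), ∀ y ∈ interior T, (y ∉ K → cutoffTest T r b β k y = 0 ∧
        ∀ i, partialD i (cutoffTest T r b β k) y = 0) ∧
        (y ∈ K → |cutoffTest T r b β k y| ≤ C * r y ^ β ∧
        ∀ i, |partialD i (cutoffTest T r b β k) y| ≤ C * r y ^ (β - 1)) := by
  obtain ⟨Cθ, hCθ0, hCθ⟩ := exists_mul_deriv_step_bound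
  obtain ⟨Cb, hCb0, hCb⟩ := h.exists_bound hb.continuousOn
  obtain ⟨Cr, hCr0, hCr⟩ := h.exists_bound h.contDiffOn.continuousOn
  choose Db hDb0 hDb using fun i => h.exists_bound
    (contDiffOn_fderivWithin_apply (m := 0) h.uniqueDiffOn hb (by norm_num)
      (stdBasis n i)).continuousOn
  choose Dr hDr0 hDr using fun i => h.exists_bound
    (contDiffOn_fderivWithin_apply (m := 0) h.uniqueDiffOn h.contDiffOn (by norm_num)
      (stdBasis n i)).continuousOn
  have hnn : ∀ i, 0 ≤ Cr * Db i + |β| * Dr i * Cb + Cθ * Dr i * Cb := fun i => by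
    have := hDb0 i; have := hDr0 i; positivity
  refine ⟨Cb + ∑ i, (Cr * Db i + |β| * Dr i * Cb + Cθ * Dr i * Cb),
    add_nonneg hCb0 (Finset.sum_nonneg fun i _ => hnn i), fun k y hy => ⟨fun hyK => ⟨?_, fun i => ?_⟩,
    fun hyK => ⟨?_, fun i => ?_⟩⟩⟩
  · rw [cutoffTest, indicator_of_mem hy, hb0 y (interior_subset hy) hyK, mul_zero]
  · rw [h.partialD_cutoffTest hb β k hy, hb0 y (interior_subset hy) hyK,
      h.diffWithin_eq_zero hb0 hy hyK]
    simp
  · rw [cutoffTest, indicator_of_mem hy, abs_mul, abs_mul, abs_of_nonneg (step_nonneg _)]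
    have h1 := Real.rpow_pos_of_pos (h.pos y hy) β
    rw [abs_of_pos h1]
    calc step (k * r y) * r y ^ β * |b y| ≤ 1 * r y ^ β * Cb := by
          gcongr
          · exact step_le_one _
          · exact hCb y hyK
      _ ≤ _ := by
          have := Finset.sum_nonneg fun i (_ : i ∈ Finset.univ) => hnn i
          nlinarith
  · have hr := h.pos y hy
    have e1 : r y ^ β = r y * r y ^ (β - 1) := by
      have := Real.rpow_add hr 1 (β - 1)
      rwa [Real.rpow_one, add_sub_cancel] at this
    have h1 := Real.rpow_pos_of_pos hr (β - 1)
    rw [h.partialD_cutoffTest hb β k hy]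
    have e2 : step (k * r y) * (r y ^ β * diffWithin (stdBasis n) T b y i
          + β * r y ^ (β - 1) * diffWithin (stdBasis n) T r y i * b y)
        + k * deriv step (k * r y) * diffWithin (stdBasis n) T r y i * r y ^ β * b y
        = (step (k * r y) * (r y * diffWithin (stdBasis n) T b y i
          + β * diffWithin (stdBasis n) T r y i * b y)
        + (k * r y * deriv step (k * r y)) * diffWithin (stdBasis n) T r y i * b y)
          * r y ^ (β - 1) := by
      rw [e1]; ring
    rw [e2, abs_mul, abs_of_pos h1]
    refine mul_le_mul_of_nonneg_right ?_ h1.le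
    have b1 : |diffWithin (stdBasis n) T b y i| ≤ Db i := hDb i y hyK
    have b2 : |diffWithin (stdBasis n) T r y i| ≤ Dr i := hDr i y hyK
    have b3 := hCb y hyK
    have b4 := hCr y hyK
    have b5 := hCθ (k * r y)
    have hDr0' := hDr0 i
    have hDb0' := hDb0 i
    have h4 := Finset.single_le_sum (fun i (_ : i ∈ Finset.univ) => hnn i) (Finset.mem_univ i)
    refine le_trans ?_ (h4.trans (le_add_of_nonneg_left hCb0))
    refine (abs_add_le _ _).trans (add_le_add ?_ ?_)
    · rw [abs_mul, abs_of_nonneg (step_nonneg _)]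
      refine (mul_le_of_le_one_left (abs_nonneg _) (step_le_one _)).trans ?_
      refine (abs_add_le _ _).trans (add_le_add ?_ ?_)
      · rw [abs_mul]; gcongr
      · rw [abs_mul, abs_mul]; gcongr
    · rw [abs_mul, abs_mul]; gcongr

end IsChartModel

end AHYamabe
end

/-! ### Integration by parts up to the boundary and the Hardy inequality in a chart -/

noncomputable section

namespace AHYamabe

open Filter Topology

variable {n : ℕ} {T K : Set (EuclideanSpace ℝ (Fin n))} {r b f X : EuclideanSpace ℝ (Fin n) → ℝ}
  {P : EuclideanSpace ℝ (Fin n) → Matrix (Fin n) (Fin n) ℝ}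
  {a : Fin n → EuclideanSpace ℝ (Fin n) → ℝ}

/-- The density `|du|² dμ` in a chart. -/
def gradDens (r : EuclideanSpace ℝ (Fin n) → ℝ)
    (P : EuclideanSpace ℝ (Fin n) → Matrix (Fin n) (Fin n) ℝ)
    (a : Fin n → EuclideanSpace ℝ (Fin n) → ℝ) (y : EuclideanSpace ℝ (Fin n)) : ℝ :=
  dens r P y * (r y ^ 2 * coNormSq (P y) fun i => a i y)

/-- `f` is a `W^{1,2}` function with weak gradient `a`, in a chart. -/
structure IsSobolevModel (T : Set (EuclideanSpace ℝ (Fin n))) (r : EuclideanSpace ℝ (Fin n) → ℝ)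
    (P : EuclideanSpace ℝ (Fin n) → Matrix (Fin n) (Fin n) ℝ) (f : EuclideanSpace ℝ (Fin n) → ℝ)
    (a : Fin n → EuclideanSpace ℝ (Fin n) → ℝ) : Prop where
  isWeakGradient : IsWeakGradient (interior T) f a
  integrableOn : IntegrableOn (fun y => dens r P y * f y ^ 2) (interior T)
  integrableOn_grad : IntegrableOn (gradDens r P a) (interior T)

namespace IsChartModel

theorem partialD_cutoffTest_eq_zero (h : IsChartModel T K r P) (hb : ContDiffOn ℝ 1 b T)
    (hb0 : ∀ y ∈ T, y ∉ K → b y = 0) (β : ℝ) {k : ℕ} (hk : 0 < k)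
    {y : EuclideanSpace ℝ (Fin n)} (hy : y ∉ interior T) (i : Fin n) :
    partialD i (cutoffTest T r b β k) y = 0 :=
  image_eq_zero_of_notMem_tsupport fun h1 =>
    hy ((h.contDiff_cutoffTest hb hb0 β hk).2.2 (tsupport_partialD_subset _ i h1))

theorem gradDens_nonneg (h : IsChartModel T K r P) {y : EuclideanSpace ℝ (Fin n)}
    (hy : y ∈ interior T) : 0 ≤ gradDens r P a y :=
  mul_nonneg (h.dens_pos hy).le (mul_nonneg (sq_nonneg _)
    (coNormSq_nonneg (h.posDef y (interior_subset hy)) _))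

/-- Integration by parts up to the boundary. -/
theorem integral_by_parts (h : IsChartModel T K r P) (hu : IsSobolevModel T r P f a)
    (hb : ContDiffOn ℝ 1 b T) (hb0 : ∀ y ∈ T, y ∉ K → b y = 0) (i : Fin n) :
    IntegrableOn (fun y => f y ^ 2 * (r y ^ (1 - (n : ℝ)) * diffWithin (stdBasis n) T b y i
        + (1 - (n : ℝ)) * r y ^ (-(n : ℝ)) * diffWithin (stdBasis n) T r y i * b y)) (interior T) ∧
    IntegrableOn (fun y => f y * a i y * (r y ^ (1 - (n : ℝ)) * b y)) (interior T) ∧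
    ∫ y in interior T, f y ^ 2 * (r y ^ (1 - (n : ℝ)) * diffWithin (stdBasis n) T b y i
        + (1 - (n : ℝ)) * r y ^ (-(n : ℝ)) * diffWithin (stdBasis n) T r y i * b y)
      = - 2 * ∫ y in interior T, f y * a i y * (r y ^ (1 - (n : ℝ)) * b y) := by
  set D := interior T with hD
  -- With this exponent a differentiated test function is O(r^(-n)), comparable with the volume
  -- density. An undifferentiated one has an extra factor r, which pairs with the gradient of f to
  -- form |du|.
  set β : ℝ := 1 - (n : ℝ) with hβ
  have hβ1 : β - 1 = -(n : ℝ) := by rw [hβ]; ring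
  obtain ⟨C, hC0, hC⟩ := h.cutoffTest_bound hb hb0 β
  obtain ⟨Cd, hCd0, hCd⟩ := h.exists_rpow_le_dens
  obtain ⟨Ca, hCa0, hCa⟩ := h.exists_sq_le_coNormSq
  have hfm := IsWeakGradient.aestronglyMeasurable isOpen_interior hu.isWeakGradient.memLp
  have ham : ∀ i, AEStronglyMeasurable (a i) (volume.restrict D) := fun i =>
    IsWeakGradient.aestronglyMeasurable isOpen_interior
      fun K hK hKc => hu.isWeakGradient.memLp_grad K hK hKc i
  -- An integrable majorant for both integrands and all k, by the W^{1,2} assumption. So the cutoff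
  -- may be removed without a boundary contribution.
  set Φ : EuclideanSpace ℝ (Fin n) → ℝ := fun y =>
    C * Cd * (1 + Ca) * (dens r P y * f y ^ 2 + gradDens r P a y) with hΦ
  have hΦi : IntegrableOn Φ D := (hu.integrableOn.add hu.integrableOn_grad).const_mul _
  have hΦ0 : ∀ y ∈ D, 0 ≤ Φ y := fun y hy => by
    have h1 := (h.dens_pos hy).le
    have h2 := h.gradDens_nonneg (a := a) hy
    positivity
  -- The shift to k + 1 keeps the cutoff parameter positive.
  set Z : ℕ → EuclideanSpace ℝ (Fin n) → ℝ := fun k => cutoffTest T r b β (k + 1) with hZ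
  have hZp : ∀ k, _ := fun k => h.contDiff_cutoffTest hb hb0 β (Nat.succ_pos k)
  have bound1 : ∀ k, ∀ y ∈ D, ‖f y ^ 2 * partialD i (Z k) y‖ ≤ Φ y := by
    intro k y hy
    obtain ⟨c1, c2⟩ := hC (k + 1) y hy
    by_cases hyK : y ∈ K
    · have c3 := (c2 hyK).2 i
      rw [hβ1] at c3
      have c4 := hCd y hyK hy
      have h1 := (h.dens_pos hy).le
      have h2 := h.gradDens_nonneg (a := a) hy
      rw [norm_mul, Real.norm_eq_abs, Real.norm_eq_abs, abs_of_nonneg (sq_nonneg _)]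
      calc f y ^ 2 * |partialD i (Z k) y| ≤ f y ^ 2 * (C * (Cd * dens r P y)) := by
            gcongr
            exact c3.trans (by gcongr)
        _ = C * Cd * (dens r P y * f y ^ 2) := by ring
        _ ≤ C * Cd * (1 + Ca) * (dens r P y * f y ^ 2 + gradDens r P a y) := by
            have h3 : 0 ≤ dens r P y * f y ^ 2 := by positivity
            have h4 : 0 ≤ C * Cd := by positivity
            rw [mul_assoc (C * Cd)]
            refine mul_le_mul_of_nonneg_left ?_ h4
            nlinarith
    · rw [(c1 hyK).2 i]
      simpa using hΦ0 y hy
  have bound2 : ∀ k, ∀ y ∈ D, ‖f y * a i y * Z k y‖ ≤ Φ y := by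
    intro k y hy
    obtain ⟨c1, c2⟩ := hC (k + 1) y hy
    by_cases hyK : y ∈ K
    · have c3 := (c2 hyK).1
      have hr := h.pos y hy
      have e1 : r y ^ β = r y * r y ^ (-(n : ℝ)) := by
        have := Real.rpow_add hr 1 (-(n : ℝ))
        rwa [Real.rpow_one, ← sub_eq_add_neg] at this
      have c4 := hCd y hyK hy
      have c5 := hCa y hyK (fun i => a i y) i
      have h1 := (h.dens_pos hy).le
      have h2 := h.gradDens_nonneg (a := a) hy
      have h6 := coNormSq_nonneg (h.posDef y (interior_subset hy)) (fun i => a i y)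
      rw [norm_mul, Real.norm_eq_abs, Real.norm_eq_abs]
      have e2 : |f y * a i y| * r y ≤ f y ^ 2 + r y ^ 2 * a i y ^ 2 := by
        rw [abs_mul, mul_assoc]
        have := two_mul_le_add_sq |f y| (|a i y| * r y)
        rw [mul_pow, sq_abs, sq_abs] at this
        have h7 : 0 ≤ |f y| * (|a i y| * r y) := by positivity
        nlinarith
      calc |f y * a i y| * |Z k y| ≤ |f y * a i y| * (C * r y ^ β) := by gcongr
        _ = C * r y ^ (-(n : ℝ)) * (|f y * a i y| * r y) := by rw [e1]; ring
        _ ≤ C * (Cd * dens r P y) * (f y ^ 2 + r y ^ 2 * (Ca * coNormSq (P y) fun i => a i y)) := by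
            gcongr
            exact e2.trans (by gcongr)
        _ = C * Cd * (dens r P y * f y ^ 2 + Ca * gradDens r P a y) := by
            rw [gradDens]; ring
        _ ≤ C * Cd * ((1 + Ca) * (dens r P y * f y ^ 2 + gradDens r P a y)) := by
            have h3 : 0 ≤ dens r P y * f y ^ 2 := by positivity
            refine mul_le_mul_of_nonneg_left ?_ (by positivity)
            nlinarith
        _ = _ := by rw [hΦ]; ring
    · have hz : Z k y = 0 := (c1 hyK).1
      rw [hz]
      simpa using hΦ0 y hy
  have lim1 : ∀ y ∈ D, Tendsto (fun k => f y ^ 2 * partialD i (Z k) y) atTop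
      (𝓝 (f y ^ 2 * (r y ^ β * diffWithin (stdBasis n) T b y i
        + β * r y ^ (-(n : ℝ)) * diffWithin (stdBasis n) T r y i * b y))) := by
    intro y hy
    refine tendsto_const_nhds.congr' ?_
    filter_upwards [(tendsto_add_atTop_nat 1).eventually (tendsto_step (h.pos y hy))] with k hk
    rw [hZ]
    simp only []
    rw [h.partialD_cutoffTest hb β (k + 1) hy, hk.1, hk.2, hβ1]
    ring
  have lim2 : ∀ y ∈ D, Tendsto (fun k => f y * a i y * Z k y) atTop
      (𝓝 (f y * a i y * (r y ^ β * b y))) := by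
    intro y hy
    refine tendsto_const_nhds.congr' ?_
    filter_upwards [(tendsto_add_atTop_nat 1).eventually (tendsto_step (h.pos y hy))] with k hk
    rw [hZ]
    simp only []
    rw [cutoffTest, indicator_of_mem hy, hk.1]
    ring
  have hDm : MeasurableSet D := isOpen_interior.measurableSet
  have meas1 : ∀ k, AEStronglyMeasurable (fun y => f y ^ 2 * partialD i (Z k) y)
      (volume.restrict D) := fun k =>
    (hfm.pow 2).mul (continuous_partialD (hZp k).1 i).aestronglyMeasurable
  have meas2 : ∀ k, AEStronglyMeasurable (fun y => f y * a i y * Z k y)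
      (volume.restrict D) := fun k =>
    (hfm.mul (ham i)).mul (hZp k).1.continuous.aestronglyMeasurable
  have ae : ∀ {p : EuclideanSpace ℝ (Fin n) → Prop}, (∀ y ∈ D, p y) →
      ∀ᵐ y ∂(volume.restrict D), p y := fun hp => by
    filter_upwards [ae_restrict_mem hDm] with y hy using hp y hy
  have int1 := tendsto_integral_of_dominated_convergence Φ meas1 hΦi (fun k => ae (bound1 k))
    (ae lim1)
  have int2 := tendsto_integral_of_dominated_convergence Φ meas2 hΦi (fun k => ae (bound2 k))
    (ae lim2)
  refine ⟨?_, ?_, ?_⟩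
  · refine hΦi.mono' (aestronglyMeasurable_of_tendsto_ae atTop meas1 (ae lim1))
      (ae fun y hy => ?_)
    exact le_of_tendsto (lim1 y hy).norm (Eventually.of_forall fun k => bound1 k y hy)
  · refine hΦi.mono' (aestronglyMeasurable_of_tendsto_ae atTop meas2 (ae lim2))
      (ae fun y hy => ?_)
    exact le_of_tendsto (lim2 y hy).norm (Eventually.of_forall fun k => bound2 k y hy)
  · refine tendsto_nhds_unique int1 ((int2.const_mul (-2)).congr fun k => ?_)
    have e1 : ∫ y in D, f y ^ 2 * partialD i (Z k) y = ∫ y, f y ^ 2 * partialD i (Z k) y :=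
      setIntegral_eq_of_tsupport fun y hy => by
        have hz : partialD i (Z k) y = 0 :=
          h.partialD_cutoffTest_eq_zero hb hb0 β (Nat.succ_pos k) hy i
        rw [hz, mul_zero]
    have e2 : ∫ y in D, f y * a i y * Z k y = ∫ y, f y * a i y * Z k y :=
      setIntegral_eq_of_tsupport fun y hy => by
        have hz : Z k y = 0 := indicator_of_notMem hy _
        rw [hz, mul_zero]
    rw [e1, e2]
    exact (hu.isWeakGradient.integral_sq_mul_partialD isOpen_interior (hZp k).1 (hZp k).2.1
      (hZp k).2.2 i).symm

theorem contDiffOn_sqrt_det_mul_grad (h : IsChartModel T K r P) (i : Fin n) :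
    ContDiffOn ℝ 1 (fun y => Real.sqrt (P y).det * gradWithin (stdBasis n) T P r y i) T :=
  (h.contDiffOn_sqrt_det.of_le (by norm_num)).mul (contDiffOn_gradWithin h.uniqueDiffOn
    h.contDiffOn_metric (fun y hy => (h.posDef y hy).det_pos.ne') h.contDiffOn i)

theorem continuousOn_diffNormSq (h : IsChartModel T K r P) :
    ContinuousOn (diffNormSq (stdBasis n) T P r) T :=
  (contDiffOn_diffNormSq h.uniqueDiffOn h.contDiffOn_metric
    (fun y hy => (h.posDef y hy).det_pos.ne') h.contDiffOn).continuousOn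

theorem diffNormSq_eq_coNormSq (y : EuclideanSpace ℝ (Fin n)) :
    diffNormSq (stdBasis n) T P r y = coNormSq (P y) (diffWithin (stdBasis n) T r y) := by
  rw [coNormSq_eq]
  rfl

/-- A function which is bounded on `K` and vanishes outside `K` is a multiplier. -/
theorem integrableOn_mul (h : IsChartModel T K r P) {F q : EuclideanSpace ℝ (Fin n) → ℝ}
    (hF : ContinuousOn F T) (hF0 : ∀ y ∈ T, y ∉ K → F y = 0) (hq : IntegrableOn q (interior T)) :
    IntegrableOn (fun y => F y * q y) (interior T) := by
  obtain ⟨C, hC0, hC⟩ := h.exists_bound hF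
  refine Integrable.bdd_mul (c := C) hq ((hF.mono interior_subset).aestronglyMeasurable
    isOpen_interior.measurableSet) ?_
  filter_upwards [ae_restrict_mem isOpen_interior.measurableSet] with y hy
  by_cases hyK : y ∈ K
  · exact hC y hyK
  · rw [hF0 y (interior_subset hy) hyK]; simpa using hC0

/-- The Hardy inequality in a chart. -/
theorem exists_hardy (h : IsChartModel T K r P) (hX : ContDiffOn ℝ 1 X T)
    (hX0 : ∀ y ∈ T, y ∉ K → X y = 0) (hXn : ∀ y ∈ T, 0 ≤ X y) : ∃ C : ℝ, 0 ≤ C ∧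
      ∀ f a, IsSobolevModel T r P f a →
        IntegrableOn (fun y => dens r P y * (r y * f y ^ 2)) (interior T) → ∀ t : ℝ, 0 < t →
        ((n : ℝ) - 1) * ∫ y in interior T,
            dens r P y * (X y * (diffNormSq (stdBasis n) T P r y * f y ^ 2))
          ≤ t * (∫ y in interior T,
              dens r P y * (X y * (diffNormSq (stdBasis n) T P r y * f y ^ 2)))
            + t⁻¹ * (∫ y in interior T,
              dens r P y * (X y * (r y ^ 2 * coNormSq (P y) fun i => a i y)))
            + C * ∫ y in interior T, dens r P y * (r y * f y ^ 2) := by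
  -- The vector field X √det P ∇r, to be tested with the weight r^(1-n). Differentiating the weight
  -- gives the main term (1-n) r^(-n) X √det P |dr|²; the divergence of b is bounded and yields only
  -- the error C ∫ r f².
  set b : Fin n → EuclideanSpace ℝ (Fin n) → ℝ := fun i y =>
    X y * (Real.sqrt (P y).det * gradWithin (stdBasis n) T P r y i) with hbdef
  have hb : ∀ i, ContDiffOn ℝ 1 (b i) T := fun i => hX.mul (h.contDiffOn_sqrt_det_mul_grad i)
  have hb0 : ∀ i, ∀ y ∈ T, y ∉ K → b i y = 0 := fun i y hy hyK => by
    rw [hbdef]; simp only [hX0 y hy hyK, zero_mul]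
  choose Cb hCb0 hCb using fun i => h.exists_bound (contDiffOn_fderivWithin_apply (m := 0)
    h.uniqueDiffOn (hb i) (by norm_num) (stdBasis n i)).continuousOn
  obtain ⟨Cd, hCd0, hCd⟩ := h.exists_rpow_le_dens
  have hCs : 0 ≤ ∑ i, Cb i := Finset.sum_nonneg fun i _ => hCb0 i
  refine ⟨(∑ i, Cb i) * Cd, by positivity, fun f a hu hint t ht => ?_⟩
  set D := interior T with hD
  have hDm : MeasurableSet D := isOpen_interior.measurableSet
  set s := diffNormSq (stdBasis n) T P r with hs
  set F : Fin n → EuclideanSpace ℝ (Fin n) → ℝ := fun i y =>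
    f y ^ 2 * (r y ^ (1 - (n : ℝ)) * diffWithin (stdBasis n) T (b i) y i
        + (1 - (n : ℝ)) * r y ^ (-(n : ℝ)) * diffWithin (stdBasis n) T r y i * b i y) with hF
  set G : Fin n → EuclideanSpace ℝ (Fin n) → ℝ := fun i y =>
    f y * a i y * (r y ^ (1 - (n : ℝ)) * b i y) with hG
  have hparts : ∀ i, _ := fun i => h.integral_by_parts hu (hb i) (hb0 i) i
  have hFi : ∀ i, IntegrableOn (F i) D := fun i => (hparts i).1
  have hGi : ∀ i, IntegrableOn (G i) D := fun i => (hparts i).2.1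
  -- The integrand is the divergence of f² r^(1-n) b.
  have hFG : ∫ y in D, ∑ i, (F i y + 2 * G i y) = 0 := by
    have hi : ∀ i ∈ Finset.univ, Integrable (fun y => F i y + 2 * G i y) (volume.restrict D) :=
      fun i _ => (hFi i).add ((hGi i).const_mul 2)
    rw [integral_finsetSum _ hi]
    refine Finset.sum_eq_zero fun i _ => ?_
    rw [integral_add (hFi i) ((hGi i).const_mul 2), integral_const_mul]
    have := (hparts i).2.2
    linarith
  have hFGi : IntegrableOn (fun y => ∑ i, (F i y + 2 * G i y)) D :=
    integrable_finsetSum _ fun i _ => (hFi i).add ((hGi i).const_mul 2)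
  have i1 : IntegrableOn (fun y => dens r P y * (X y * (s y * f y ^ 2))) D := by
    have := h.integrableOn_mul (F := fun y => X y * s y)
      (hX.continuousOn.mul h.continuousOn_diffNormSq)
      (fun y hy hyK => by rw [hX0 y hy hyK, zero_mul]) hu.integrableOn
    exact this.congr (ae_of_all _ fun y => by ring)
  have i2 : IntegrableOn (fun y => dens r P y * (X y * (r y ^ 2 * coNormSq (P y) fun i => a i y)))
      D := by
    have := h.integrableOn_mul hX.continuousOn hX0 hu.integrableOn_grad
    exact this.congr (ae_of_all _ fun y => by simp only [gradDens]; ring)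
  have hpt : ∀ y ∈ D, ((n : ℝ) - 1) * (dens r P y * (X y * (s y * f y ^ 2)))
        + ∑ i, (F i y + 2 * G i y)
      ≤ t * (dens r P y * (X y * (s y * f y ^ 2)))
        + t⁻¹ * (dens r P y * (X y * (r y ^ 2 * coNormSq (P y) fun i => a i y)))
        + (∑ i, Cb i) * Cd * (dens r P y * (r y * f y ^ 2)) := by
    intro y hy
    have hyT := interior_subset hy
    have hr := h.pos y hy
    have e1 : r y ^ (1 - (n : ℝ)) = r y * r y ^ (-(n : ℝ)) := by
      have := Real.rpow_add hr 1 (-(n : ℝ))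
      rwa [Real.rpow_one, ← sub_eq_add_neg] at this
    set Bd := ∑ i, diffWithin (stdBasis n) T (b i) y i with hBd
    set q := ∑ i, a i y * gradWithin (stdBasis n) T P r y i with hq
    -- The divergence expanded: the term with the derivatives of b, the Hardy term, and the cross
    -- term with the gradient of f.
    have hsum : ∑ i, (F i y + 2 * G i y) = f y ^ 2 * r y * r y ^ (-(n : ℝ)) * Bd
        - ((n : ℝ) - 1) * (dens r P y * (X y * (s y * f y ^ 2)))
        + 2 * (dens r P y * X y * (f y * r y * q)) := by
      rw [hBd, hq, hs, diffNormSq, dens]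
      simp only [Finset.mul_sum, Finset.sum_mul]
      rw [← Finset.sum_sub_distrib, ← Finset.sum_add_distrib]
      refine Finset.sum_congr rfl fun i _ => ?_
      simp only [hF, hG, hbdef, e1]
      ring
    have hBdb : f y ^ 2 * r y * r y ^ (-(n : ℝ)) * Bd
        ≤ (∑ i, Cb i) * Cd * (dens r P y * (r y * f y ^ 2)) := by
      have hrp := (Real.rpow_pos_of_pos hr (-(n : ℝ))).le
      have hd := (h.dens_pos hy).le
      by_cases hyK : y ∈ K
      · have h1 : Bd ≤ ∑ i, Cb i := Finset.sum_le_sum fun i _ =>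
          (le_abs_self _).trans (hCb i y hyK)
        have h2 := hCd y hyK hy
        calc f y ^ 2 * r y * r y ^ (-(n : ℝ)) * Bd
            ≤ f y ^ 2 * r y * r y ^ (-(n : ℝ)) * ∑ i, Cb i := by gcongr
          _ ≤ f y ^ 2 * r y * (Cd * dens r P y) * ∑ i, Cb i := by gcongr
          _ = _ := by ring
      · have h1 : Bd = 0 := Finset.sum_eq_zero fun i _ =>
          h.diffWithin_eq_zero (hb0 i) hy hyK i
        rw [h1, mul_zero]
        positivity
    have hcs : q ^ 2 ≤ (coNormSq (P y) fun i => a i y) * s y := by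
      have := sq_dotProduct_inv_mulVec_le (h.posDef y hyT) (fun i => a i y)
        (diffWithin (stdBasis n) T r y)
      rw [hs, diffNormSq_eq_coNormSq]
      exact this
    have hs0 : 0 ≤ s y := by
      rw [hs, diffNormSq_eq_coNormSq]; exact coNormSq_nonneg (h.posDef y hyT) _
    have ha0 := coNormSq_nonneg (h.posDef y hyT) (fun i => a i y)
    -- Cauchy–Schwarz for the metric P, followed by 2xy ≤ t x² + t⁻¹ y².
    have hamgm : 2 * (f y * r y * q) ≤ t * (s y * f y ^ 2)
        + t⁻¹ * (r y ^ 2 * coNormSq (P y) fun i => a i y) := by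
      set A := coNormSq (P y) fun i => a i y with hA
      have h1 : 2 * (f y * r y * q) ≤ 2 * (|f y| * r y * (Real.sqrt A * Real.sqrt (s y))) := by
        have h2 : |q| ≤ Real.sqrt A * Real.sqrt (s y) := by
          rw [← Real.sqrt_mul ha0]; exact Real.abs_le_sqrt hcs
        have h3 : f y * r y * q ≤ |f y| * r y * |q| := by
          have := le_abs_self (f y * r y * q)
          rwa [abs_mul, abs_mul, abs_of_pos hr] at this
        have h4 : |f y| * r y * |q| ≤ |f y| * r y * (Real.sqrt A * Real.sqrt (s y)) := by gcongr
        linarith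
      refine h1.trans ?_
      have h5 := sq_nonneg (t * (Real.sqrt (s y) * |f y|) - r y * Real.sqrt A)
      have h6 : Real.sqrt (s y) ^ 2 = s y := Real.sq_sqrt hs0
      have h7 : Real.sqrt A ^ 2 = A := Real.sq_sqrt ha0
      have h8 : |f y| ^ 2 = f y ^ 2 := sq_abs _
      have h9 : t * (2 * (|f y| * r y * (Real.sqrt A * Real.sqrt (s y))))
          ≤ t * (t * (s y * f y ^ 2) + t⁻¹ * (r y ^ 2 * A)) := by
        rw [mul_add, mul_inv_cancel_left₀ ht.ne']
        have h10 : (t * (Real.sqrt (s y) * |f y|) - r y * Real.sqrt A) ^ 2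
          = t * (t * (s y * f y ^ 2)) + r y ^ 2 * A
            - t * (2 * (|f y| * r y * (Real.sqrt A * Real.sqrt (s y)))) := by
          rw [← h6, ← h8, ← h7, Real.sqrt_sq (Real.sqrt_nonneg _), Real.sqrt_sq (Real.sqrt_nonneg _)]
          ring
        linarith
      exact le_of_mul_le_mul_left h9 ht
    rw [hsum]
    have hw : 0 ≤ dens r P y * X y := mul_nonneg (h.dens_pos hy).le (hXn y hyT)
    have := mul_le_mul_of_nonneg_left hamgm hw
    linarith
  have hmono := setIntegral_mono_on ((i1.const_mul ((n : ℝ) - 1)).add hFGi)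
    (((i1.const_mul t).add (i2.const_mul t⁻¹)).add (hint.const_mul ((∑ i, Cb i) * Cd))) hDm hpt
  have L := integral_add (i1.const_mul ((n : ℝ) - 1)) hFGi
  have R1 := integral_add ((i1.const_mul t).add (i2.const_mul t⁻¹))
    (hint.const_mul ((∑ i, Cb i) * Cd))
  have R2 := integral_add (i1.const_mul t) (i2.const_mul t⁻¹)
  simp only [integral_const_mul, hFG] at L R1 R2
  simp only [Pi.add_apply] at hmono L R1 R2
  linarith

end IsChartModel

end AHYamabe
end

/-! ### The Sobolev inequality in a chart -/

noncomputable section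

namespace AHYamabe

open Filter Topology

variable {n : ℕ} {T K : Set (EuclideanSpace ℝ (Fin n))} {r b f X : EuclideanSpace ℝ (Fin n) → ℝ}
  {P : EuclideanSpace ℝ (Fin n) → Matrix (Fin n) (Fin n) ℝ}
  {a : Fin n → EuclideanSpace ℝ (Fin n) → ℝ}

theorem critExp_pos (hn : 3 ≤ n) : 0 < 2 * (n : ℝ) / ((n : ℝ) - 2) := by
  have : (3 : ℝ) ≤ n := by exact_mod_cast hn
  exact div_pos (by linarith) (by linarith)

theorem critExp_toReal (hn : 3 ≤ n) : (critExp n).toReal = 2 * (n : ℝ) / ((n : ℝ) - 2) :=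
  ENNReal.toReal_ofReal (critExp_pos hn).le

theorem critExp_ne_zero (hn : 3 ≤ n) : critExp n ≠ 0 := by
  simpa [critExp] using critExp_pos hn

theorem critExp_ne_top : critExp n ≠ ⊤ := ENNReal.ofReal_ne_top

namespace IsChartModel

/-- The exponent β = -(n-2)/2 satisfies βN = -n, which matches the volume density in the L^N norm.
Moreover 2(β-1) = -n and 2β = 2-n, so both terms of the gradient of r^β X f have squares bounded by
the W^{1,2} density. -/
theorem exists_eLpNorm_cutoffTest_le (h : IsChartModel T K r P) (hn : 3 ≤ n)
    (hX : ContDiffOn ℝ 1 X T) (hX0 : ∀ y ∈ T, y ∉ K → X y = 0) : ∃ C : ℝ, 0 ≤ C ∧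
      ∀ f a, IsSobolevModel T r P f a → ∀ k : ℕ, 0 < k →
        eLpNorm (fun y => cutoffTest T r X (-((n : ℝ) - 2) / 2) k y * f y) (critExp n) volume
          ≤ ENNReal.ofReal (C * Real.sqrt
            (∫ y in interior T, (dens r P y * f y ^ 2 + gradDens r P a y))) := by
  set β : ℝ := -((n : ℝ) - 2) / 2 with hβ
  set D := interior T with hD
  obtain ⟨S, hS⟩ := exists_sobolev_const hn
  obtain ⟨C, hC0, hC⟩ := h.cutoffTest_bound hX hX0 β
  obtain ⟨Cd, hCd0, hCd⟩ := h.exists_rpow_le_dens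
  obtain ⟨Ca, hCa0, hCa⟩ := h.exists_sq_le_coNormSq
  set A := 2 * C ^ 2 * Cd * (1 + Ca) with hA
  have hA0 : 0 ≤ A := by positivity
  refine ⟨S * (n * Real.sqrt A), by positivity, fun f a hu k hk => ?_⟩
  obtain ⟨p1, p2, p3⟩ := h.contDiff_cutoffTest hX hX0 β hk
  refine (hS D f a isOpen_interior hu.isWeakGradient _ p1 p2 p3).trans ?_
  set ζ := cutoffTest T r X β k with hζ
  set Ψ : EuclideanSpace ℝ (Fin n) → ℝ := fun y => dens r P y * f y ^ 2 + gradDens r P a y with hΨ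
  have hΨi : IntegrableOn Ψ D := hu.integrableOn.add hu.integrableOn_grad
  have hΨ0 : ∀ y ∈ D, 0 ≤ Ψ y := fun y hy =>
    add_nonneg (mul_nonneg (h.dens_pos hy).le (sq_nonneg _)) (h.gradDens_nonneg hy)
  have hI0 : 0 ≤ ∫ y in D, Ψ y := setIntegral_nonneg isOpen_interior.measurableSet hΨ0
  have key : ∀ i, eLpNorm (fun y => ζ y * a i y + f y * partialD i ζ y) 2 volume
      ≤ ENNReal.ofReal (Real.sqrt A * Real.sqrt (∫ y in D, Ψ y)) := by
    intro i
    have hpt : ∀ y ∈ D, (ζ y * a i y + f y * partialD i ζ y) ^ 2 ≤ A * Ψ y := by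
      intro y hy
      obtain ⟨c1, c2⟩ := hC k y hy
      by_cases hyK : y ∈ K
      · obtain ⟨c3, c4⟩ := c2 hyK
        replace c4 := c4 i
        have hr := h.pos y hy
        have hrn := Real.rpow_pos_of_pos hr (-(n : ℝ))
        have e1 : (r y ^ β) ^ 2 = r y ^ 2 * r y ^ (-(n : ℝ)) := by
          rw [← Real.rpow_natCast, ← Real.rpow_mul hr.le, ← Real.rpow_natCast (r y) 2,
            ← Real.rpow_add hr]
          congr 1
          rw [hβ]; push_cast; ring
        have e2 : (r y ^ (β - 1)) ^ 2 = r y ^ (-(n : ℝ)) := by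
          rw [← Real.rpow_natCast, ← Real.rpow_mul hr.le]
          congr 1
          rw [hβ]; push_cast; ring
        have c5 : ζ y ^ 2 ≤ C ^ 2 * (r y ^ 2 * r y ^ (-(n : ℝ))) := by
          rw [← e1, ← mul_pow, ← sq_abs (ζ y)]
          gcongr
        have c6 : partialD i ζ y ^ 2 ≤ C ^ 2 * r y ^ (-(n : ℝ)) := by
          rw [← e2, ← mul_pow, ← sq_abs (partialD i ζ y)]
          gcongr
        have c7 := hCd y hyK hy
        have c8 := hCa y hyK (fun i => a i y) i
        have h1 := (h.dens_pos hy).le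
        have h6 := coNormSq_nonneg (h.posDef y (interior_subset hy)) (fun i => a i y)
        calc (ζ y * a i y + f y * partialD i ζ y) ^ 2
            ≤ 2 * (ζ y ^ 2 * a i y ^ 2 + f y ^ 2 * partialD i ζ y ^ 2) := by
              nlinarith [sq_nonneg (ζ y * a i y - f y * partialD i ζ y)]
          _ ≤ 2 * (C ^ 2 * (r y ^ 2 * r y ^ (-(n : ℝ))) * a i y ^ 2
              + f y ^ 2 * (C ^ 2 * r y ^ (-(n : ℝ)))) := by gcongr
          _ = 2 * C ^ 2 * r y ^ (-(n : ℝ)) * (r y ^ 2 * a i y ^ 2 + f y ^ 2) := by ring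
          _ ≤ 2 * C ^ 2 * (Cd * dens r P y)
              * (r y ^ 2 * (Ca * coNormSq (P y) fun i => a i y) + f y ^ 2) := by gcongr
          _ = 2 * C ^ 2 * Cd * (dens r P y * f y ^ 2 + Ca * gradDens r P a y) := by
              rw [gradDens]; ring
          _ ≤ 2 * C ^ 2 * Cd * ((1 + Ca) * Ψ y) := by
              have h3 : 0 ≤ dens r P y * f y ^ 2 := by positivity
              have h2 := h.gradDens_nonneg (a := a) hy
              refine mul_le_mul_of_nonneg_left ?_ (by positivity)
              simp only [hΨ]
              nlinarith
          _ = A * Ψ y := by rw [hA]; ring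
      · have h1 : ζ y = 0 := (c1 hyK).1
        have h2 : partialD i ζ y = 0 := (c1 hyK).2 i
        rw [h1, h2]
        have := hΨ0 y hy
        simpa using mul_nonneg hA0 this
    have hsq : eLpNorm (fun y => ζ y * a i y + f y * partialD i ζ y) 2 volume ^ 2
        ≤ ENNReal.ofReal (Real.sqrt A * Real.sqrt (∫ y in D, Ψ y)) ^ 2 := by
      rw [sq_eLpNorm_two, ← ENNReal.ofReal_pow (by positivity), mul_pow, Real.sq_sqrt hA0,
        Real.sq_sqrt hI0, ← integral_const_mul, ofReal_integral_eq_lintegral_ofReal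
          (hΨi.const_mul A)
          (by filter_upwards [ae_restrict_mem isOpen_interior.measurableSet] with y hy
              using mul_nonneg hA0 (hΨ0 y hy)), ← lintegral_indicator isOpen_interior.measurableSet]
      refine lintegral_mono fun y => ?_
      by_cases hy : y ∈ D
      · rw [indicator_of_mem hy]
        rw [← ofReal_norm, ← ENNReal.ofReal_pow (norm_nonneg _), Real.norm_eq_abs, sq_abs]
        exact ENNReal.ofReal_le_ofReal (hpt y hy)
      · have h1 : ζ y = 0 := indicator_of_notMem hy _
        have h2 : partialD i ζ y = 0 := h.partialD_cutoffTest_eq_zero hX hX0 β hk hy i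
        simp [h1, h2]
    exact (ENNReal.pow_le_pow_left_iff two_ne_zero).1 hsq
  calc (S : ℝ≥0∞) * ∑ i, eLpNorm (fun y => ζ y * a i y + f y * partialD i ζ y) 2 volume
      ≤ S * ∑ _i : Fin n, ENNReal.ofReal (Real.sqrt A * Real.sqrt (∫ y in D, Ψ y)) := by
        gcongr with i _
        exact key i
    _ = _ := by
        rw [Finset.sum_const, Finset.card_univ, Fintype.card_fin, nsmul_eq_mul,
          ← ENNReal.ofReal_coe_nnreal, ← ENNReal.ofReal_natCast n,
          ← ENNReal.ofReal_mul (by positivity), ← ENNReal.ofReal_mul (by positivity)]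
        congr 1
        ring

/-- The Sobolev inequality in a chart. -/
theorem exists_sobolev (h : IsChartModel T K r P) (hn : 3 ≤ n)
    (hX : ContDiffOn ℝ 1 X T) (hX0 : ∀ y ∈ T, y ∉ K → X y = 0) : ∃ C : ℝ, 0 ≤ C ∧
      ∀ f a, IsSobolevModel T r P f a →
        eLpNorm (fun y => X y * f y) (critExp n)
            ((volume.restrict (interior T)).withDensity fun y => ENNReal.ofReal (dens r P y))
          ≤ ENNReal.ofReal (C * Real.sqrt
            (∫ y in interior T, (dens r P y * f y ^ 2 + gradDens r P a y))) := by
  set β : ℝ := -((n : ℝ) - 2) / 2 with hβ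
  set D := interior T with hD
  have hDm : MeasurableSet D := isOpen_interior.measurableSet
  have hn' : (3 : ℝ) ≤ n := by exact_mod_cast hn
  obtain ⟨C, hC0, hC⟩ := h.exists_eLpNorm_cutoffTest_le hn hX hX0
  obtain ⟨W, hW0, hW⟩ := h.exists_bound h.continuousOn_sqrt_det
  set q := (critExp n).toReal with hq
  have hqe : q = 2 * (n : ℝ) / ((n : ℝ) - 2) := critExp_toReal hn
  have hq0 : 0 < q := by rw [hqe]; exact critExp_pos hn
  -- W bounds √det P on K, the only part of the density not absorbed by r^(βN) = r^(-n).
  refine ⟨W ^ (1 / q) * C, by positivity, fun f a hu => ?_⟩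
  set I := C * Real.sqrt (∫ y in D, (dens r P y * f y ^ 2 + gradDens r P a y)) with hI
  have hfm := IsWeakGradient.aestronglyMeasurable isOpen_interior hu.isWeakGradient.memLp
  have hXm : AEStronglyMeasurable X (volume.restrict D) :=
    (hX.continuousOn.mono interior_subset).aestronglyMeasurable hDm
  have h1 : eLpNorm (fun y => r y ^ β * X y * f y) (critExp n) (volume.restrict D)
      ≤ ENNReal.ofReal I := by
    -- The cutoff is removed by Fatou's lemma, the bound being uniform in k.
    refine (Lp.eLpNorm_lim_le_liminf_eLpNorm
      (f := fun (k : ℕ) y => cutoffTest T r X β (k + 1) y * f y) (fun k => ?_) _ ?_).trans ?_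
    · exact (h.contDiff_cutoffTest hX hX0 β (Nat.succ_pos k)).1.continuous.aestronglyMeasurable.mul
        hfm
    · filter_upwards [ae_restrict_mem hDm] with y hy
      refine tendsto_const_nhds.congr' ?_
      filter_upwards [(tendsto_add_atTop_nat 1).eventually (tendsto_step (h.pos y hy))] with k hk
      rw [cutoffTest, indicator_of_mem hy, hk.1, one_mul]
    · refine (liminf_le_liminf (Eventually.of_forall fun k => (eLpNorm_mono_measure _
        Measure.restrict_le_self).trans (hC f a hu (k + 1) (Nat.succ_pos k)))).trans ?_
      simp
      rfl
  refine le_trans ?_ ((mul_le_mul_right h1 (ENNReal.ofReal (W ^ (1 / q)))).trans ?_)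
  swap
  · rw [← ENNReal.ofReal_mul (by positivity), hI, mul_assoc]
  rw [eLpNorm_eq_lintegral_rpow_enorm_toReal (critExp_ne_zero hn) critExp_ne_top,
    eLpNorm_eq_lintegral_rpow_enorm_toReal (critExp_ne_zero hn) critExp_ne_top,
    ← ENNReal.ofReal_rpow_of_nonneg hW0 (by positivity), ← ENNReal.mul_rpow_of_nonneg _ _
      (by positivity)]
  refine ENNReal.rpow_le_rpow ?_ (by positivity)
  have hgm : AEMeasurable (fun y => ‖X y * f y‖ₑ ^ q) (volume.restrict D) :=
    (hXm.mul hfm).enorm.pow_const _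
  rw [lintegral_withDensity_eq_lintegral_mul₀
    ((h.continuousOn_dens.aemeasurable hDm).ennreal_ofReal)
    hgm, ← lintegral_const_mul' _ _ ENNReal.ofReal_ne_top]
  refine setLIntegral_mono' hDm fun y hy => ?_
  rw [Pi.mul_apply]
  by_cases hyK : y ∈ K
  · have hr := h.pos y hy
    have hrn := Real.rpow_pos_of_pos hr (-(n : ℝ))
    have e1 : ‖r y ^ β * X y * f y‖ₑ ^ q
        = ENNReal.ofReal (r y ^ (-(n : ℝ))) * ‖X y * f y‖ₑ ^ q := by
      rw [mul_assoc, enorm_mul, ENNReal.mul_rpow_of_nonneg _ _ hq0.le]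
      congr 1
      rw [Real.enorm_of_nonneg (Real.rpow_nonneg hr.le _),
        ENNReal.ofReal_rpow_of_nonneg (Real.rpow_nonneg hr.le _) hq0.le, ← Real.rpow_mul hr.le]
      congr 2
      rw [hβ, hqe]
      have : (n : ℝ) - 2 ≠ 0 := by linarith
      field_simp
    rw [e1, ← mul_assoc, ← ENNReal.ofReal_mul hW0]
    gcongr
    rw [dens, mul_comm]
    gcongr
    exact (le_abs_self _).trans (hW y hyK)
  · rw [hX0 y (interior_subset hy) hyK]
    simp [hq0]

end IsChartModel

end AHYamabe
end

/-! ### Transfer of the chart inequalities to the manifold -/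

noncomputable section

namespace AHYamabe

open Filter Topology

variable {n : ℕ} [NeZero n] {M : Type*} [TopologicalSpace M]
  [ChartedSpace (EuclideanHalfSpace n) M] [IsManifold (𝓡∂ n) ∞ M]

theorem hasWeakDifferential_weakDifferential {u : M → ℝ}
    (h : ∃ α : CovectorField n M, HasWeakDifferential u α) :
    HasWeakDifferential u (weakDifferential (n := n) u) := by
  rw [weakDifferential, dif_pos h]
  exact h.choose_spec

theorem HasWeakDifferential.isWeakGradient {u : M → ℝ} {α : CovectorField n M}
    (h : HasWeakDifferential u α) (c : M) :
    IsWeakGradient (chartDomain (n := n) c) (fun y => u ((extChartAt (𝓡∂ n) c).symm y))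
      (fun i y => α ((extChartAt (𝓡∂ n) c).symm y) (coordVec c y i)) :=
  ⟨fun K hK hKc => ((h c).1 K hK hKc).1, fun K hK hKc => ((h c).1 K hK hKc).2, (h c).2⟩

theorem contract_smul {A R : Matrix (Fin n) (Fin n) ℝ} (hA : IsUnit A.det) {x : ℝ} (hx : x ≠ 0) :
    contract (x • A) R = x⁻¹ * contract A R := by
  have h1 : (x • A)⁻¹ = x⁻¹ • A⁻¹ := by
    refine Matrix.inv_eq_left_inv ?_
    rw [Matrix.smul_mul, Matrix.mul_smul, smul_smul, inv_mul_cancel₀ hx, one_smul,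
      Matrix.nonsing_inv_mul _ hA]
  simp only [contract, h1, Matrix.smul_apply, smul_eq_mul, Finset.mul_sum]
  refine Finset.sum_congr rfl fun i _ => Finset.sum_congr rfl fun j _ => ?_
  ring

namespace IsCompactification

variable {ρ : M → ℝ} {gbar : C2Metric n M} {g : BilinField n M}

theorem isChartModel [CompactSpace M] [T2Space M] (h : IsCompactification ρ gbar g) (c : M)
    {L : Set M} (hL : IsClosed L) (hLc : L ⊆ (extChartAt (𝓡∂ n) c).source) :
    IsChartModel (extChartAt (𝓡∂ n) c).target (extChartAt (𝓡∂ n) c '' L)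
      (fun y => ρ ((extChartAt (𝓡∂ n) c).symm y)) (metricMatrix gbar.inner c) where
  uniqueDiffOn := uniqueDiffOn_extChartAt_target c
  isCompact := hL.isCompact.image_of_continuousOn ((continuousOn_extChartAt c).mono hLc)
  subset := by
    rintro _ ⟨p, hp, rfl⟩
    exact (extChartAt (𝓡∂ n) c).map_source (hLc hp)
  mem_interior := by
    rintro _ ⟨p, hp, rfl⟩ h0
    rw [(extChartAt (𝓡∂ n) c).left_inv (hLc hp)] at h0
    exact mem_chartDomain (hLc hp) (h.mem_interior h0)
  contDiffOn := h.contDiffOn_rho c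
  pos := fun y hy => h.pos (symm_mem_interior hy)
  contDiffOn_metric := contDiffOn_metricMatrix gbar c
  posDef := fun y hy => posDef_metricMatrix gbar hy

theorem dens_eq (h : IsCompactification ρ gbar g) {c : M} {y : EuclideanSpace ℝ (Fin n)}
    (hy : y ∈ chartDomain (n := n) c) :
    Real.sqrt (metricMatrix g c y).det
      = dens (fun y => ρ ((extChartAt (𝓡∂ n) c).symm y)) (metricMatrix gbar.inner c) y := by
  have hp := h.pos (symm_mem_interior hy)
  rw [h.metricMatrix_eq hy, Matrix.det_smul, Fintype.card_fin, dens, ← pow_mul, mul_comm 2 n,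
    pow_mul, Real.sqrt_mul (by positivity), Real.sqrt_sq (by positivity),
    Real.rpow_neg hp.le, Real.rpow_natCast, inv_pow]

theorem gradNormSq_eq (h : IsCompactification ρ gbar g) {c : M} {y : EuclideanSpace ℝ (Fin n)}
    (hy : y ∈ chartDomain (n := n) c) (u : M → ℝ) :
    gradNormSq g u ((extChartAt (𝓡∂ n) c).symm y)
      = ρ ((extChartAt (𝓡∂ n) c).symm y) ^ 2 * coNormSq (metricMatrix gbar.inner c y)
        (fun i => weakDifferential u ((extChartAt (𝓡∂ n) c).symm y) (coordVec c y i)) := by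
  have hyT := interior_subset hy
  have hp := h.pos (symm_mem_interior hy)
  have hinv : ((ρ ((extChartAt (𝓡∂ n) c).symm y))⁻¹ ^ 2)⁻¹
      = ρ ((extChartAt (𝓡∂ n) c).symm y) ^ 2 := by rw [inv_pow, inv_inv]
  rw [gradNormSq, covectorNormSq_eq ((extChartAt (𝓡∂ n) c).map_target hyT),
    ← AHYamabe.metricMatrix_eq g hyT, h.metricMatrix_eq hy,
    contract_smul (posDef_metricMatrix gbar hyT).det_pos.ne'.isUnit (by positivity), hinv, coNormSq]
  simp only [coordVec_eq hyT]

section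

variable [MeasurableSpace M] [BorelSpace M] [CompactSpace M]

theorem isSobolevModel (h : IsCompactification ρ gbar g) {u : M → ℝ} (hu : MemW12 g u) (c : M) :
    IsSobolevModel (extChartAt (𝓡∂ n) c).target (fun y => ρ ((extChartAt (𝓡∂ n) c).symm y))
      (metricMatrix gbar.inner c) (fun y => u ((extChartAt (𝓡∂ n) c).symm y))
      (fun i y => weakDifferential u ((extChartAt (𝓡∂ n) c).symm y) (coordVec c y i)) where
  isWeakGradient := (hasWeakDifferential_weakDifferential hu.1).isWeakGradient c
  integrableOn := by
    refine (h.integrableOn_source c hu.2.1.integrable_sq).congr_fun (fun y hy => ?_)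
      (measurableSet_chartDomain c)
    simp only [h.dens_eq hy]
  integrableOn_grad := by
    refine (h.integrableOn_source c hu.2.2).congr_fun (fun y hy => ?_)
      (measurableSet_chartDomain c)
    simp only [gradDens, h.dens_eq hy, h.gradNormSq_eq hy]

theorem setIntegral_source_eq (h : IsCompactification ρ gbar g) (c : M) {F : M → ℝ}
    (hF : AEStronglyMeasurable F (riemVolume g)) {G : EuclideanSpace ℝ (Fin n) → ℝ}
    (hG : ∀ y ∈ chartDomain (n := n) c, F ((extChartAt (𝓡∂ n) c).symm y) = G y) :
    ∫ p in (extChartAt (𝓡∂ n) c).source, F p ∂(riemVolume g)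
      = ∫ y in interior (extChartAt (𝓡∂ n) c).target,
        dens (fun y => ρ ((extChartAt (𝓡∂ n) c).symm y)) (metricMatrix gbar.inner c) y * G y := by
  rw [h.setIntegral_source c hF]
  exact setIntegral_congr_fun (measurableSet_chartDomain c)
    fun y hy => by simp only [h.dens_eq hy, hG y hy]

theorem gradNormSq_nonneg (h : IsCompactification ρ gbar g) (u : M → ℝ) {p : M}
    (hp : p ∈ (𝓡∂ n).interior M) : 0 ≤ gradNormSq g u p := by
  have hy := mem_chartDomain (mem_extChartAt_source (I := 𝓡∂ n) p) hp
  have e := h.gradNormSq_eq hy u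
  rw [(extChartAt (𝓡∂ n) p).left_inv (mem_extChartAt_source (I := 𝓡∂ n) p)] at e
  rw [e]
  exact mul_nonneg (sq_nonneg _) (coNormSq_nonneg (posDef_metricMatrix gbar (interior_subset hy)) _)

theorem normSq_nonneg (h : IsCompactification ρ gbar g) (p : M) : 0 ≤ normSq ρ gbar p := by
  have hp := mem_extChartAt_source (I := 𝓡∂ n) p
  rw [h.normSq_eq hp, IsChartModel.diffNormSq_eq_coNormSq]
  exact coNormSq_nonneg (posDef_metricMatrix gbar ((extChartAt (𝓡∂ n) p).map_source hp)) _

theorem exists_abs_le {F : M → ℝ} (hF : Continuous F) : ∃ C, 0 ≤ C ∧ ∀ p, |F p| ≤ C := by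
  obtain ⟨C, hC⟩ := isCompact_univ.exists_bound_of_continuousOn hF.continuousOn
  exact ⟨max C 0, le_max_right _ _, fun p => (hC p (mem_univ p)).trans (le_max_left _ _)⟩

theorem integrable_mul {F q : M → ℝ} {μ : Measure M} (hF : Continuous F) (hq : Integrable q μ) :
    Integrable (fun p => F p * q p) μ := by
  obtain ⟨C, -, hC⟩ := exists_abs_le hF
  exact hq.bdd_mul (c := C) hF.aestronglyMeasurable (ae_of_all _ hC)

variable [T2Space M]

/-- The weight χ enters linearly and never multiplies u before differentiation. Its derivative falls
on the vector field and is absorbed in C, so these inequalities can be summed over a partition of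
unity with the sharp constant intact. -/
theorem exists_hardy_of_tsupport (h : IsCompactification ρ gbar g) (c : M) {χ : M → ℝ}
    (hχ : ContMDiff (𝓡∂ n) 𝓘(ℝ, ℝ) ∞ χ) (hχ0 : ∀ p, 0 ≤ χ p)
    (hχc : tsupport χ ⊆ (extChartAt (𝓡∂ n) c).source) : ∃ C : ℝ, 0 ≤ C ∧
      ∀ u, MemW12 g u → ∀ t : ℝ, 0 < t →
        ((n : ℝ) - 1) * ∫ p, χ p * (normSq ρ gbar p * u p ^ 2) ∂(riemVolume g)
          ≤ t * (∫ p, χ p * (normSq ρ gbar p * u p ^ 2) ∂(riemVolume g))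
            + t⁻¹ * (∫ p, χ p * gradNormSq g u p ∂(riemVolume g))
            + C * ∫ p, ρ p * u p ^ 2 ∂(riemVolume g) := by
  have hm := h.isChartModel c (isClosed_tsupport χ) hχc
  have hX : ContDiffOn ℝ 1 (fun y => χ ((extChartAt (𝓡∂ n) c).symm y))
      (extChartAt (𝓡∂ n) c).target := (contDiffOn_comp_symm hχ c).of_le (by simp)
  have hX0 : ∀ y ∈ (extChartAt (𝓡∂ n) c).target, y ∉ extChartAt (𝓡∂ n) c '' tsupport χ →
      χ ((extChartAt (𝓡∂ n) c).symm y) = 0 := by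
    intro y hy hyK
    by_contra hne
    exact hyK ⟨_, subset_tsupport χ hne, (extChartAt (𝓡∂ n) c).right_inv hy⟩
  obtain ⟨C, hC0, hC⟩ := hm.exists_hardy hX hX0 fun y _ => hχ0 _
  refine ⟨C, hC0, fun u hu t ht => ?_⟩
  have hu2 := hu.2.1.integrable_sq
  have i1 := integrable_mul h.continuous hu2
  have i2 := integrable_mul hχ.continuous (integrable_mul h.continuous_normSq hu2)
  have i3 := integrable_mul hχ.continuous hu.2.2
  have hres : ∀ F : M → ℝ, ∫ p, χ p * F p ∂(riemVolume g)
      = ∫ p in (extChartAt (𝓡∂ n) c).source, χ p * F p ∂(riemVolume g) := by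
    intro F
    refine (setIntegral_eq_integral_of_forall_compl_eq_zero fun p hp => ?_).symm
    rw [image_eq_zero_of_notMem_tsupport fun h1 => hp (hχc h1), zero_mul]
  have hρ : ∫ p in (extChartAt (𝓡∂ n) c).source, ρ p * u p ^ 2 ∂(riemVolume g)
      ≤ ∫ p, ρ p * u p ^ 2 ∂(riemVolume g) :=
    setIntegral_le_integral i1 (ae_of_all _ fun p =>
      mul_nonneg (h.defining.nonneg p) (sq_nonneg _))
  have hint : IntegrableOn (fun y => dens (fun y => ρ ((extChartAt (𝓡∂ n) c).symm y))
      (metricMatrix gbar.inner c) y * (ρ ((extChartAt (𝓡∂ n) c).symm y)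
        * u ((extChartAt (𝓡∂ n) c).symm y) ^ 2)) (interior (extChartAt (𝓡∂ n) c).target) := by
    refine (h.integrableOn_source c i1).congr_fun (fun y hy => ?_) (measurableSet_chartDomain c)
    simp only [h.dens_eq hy]
  have key := hC _ _ (h.isSobolevModel hu c) hint t ht
  rw [hres, hres, h.setIntegral_source_eq c i2.1 (G := fun y =>
      χ ((extChartAt (𝓡∂ n) c).symm y) * (diffNormSq (stdBasis n) (extChartAt (𝓡∂ n) c).target
      (metricMatrix gbar.inner c) (fun y => ρ ((extChartAt (𝓡∂ n) c).symm y)) y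
      * u ((extChartAt (𝓡∂ n) c).symm y) ^ 2)) fun y hy => ?_,
    h.setIntegral_source_eq c i3.1 (G := fun y => χ ((extChartAt (𝓡∂ n) c).symm y)
      * (ρ ((extChartAt (𝓡∂ n) c).symm y) ^ 2 * coNormSq (metricMatrix gbar.inner c y)
        (fun i => weakDifferential u ((extChartAt (𝓡∂ n) c).symm y) (coordVec c y i))))
      fun y hy => by rw [h.gradNormSq_eq hy]]
  · rw [h.setIntegral_source_eq c i1.1 (fun y _ => rfl)] at hρ
    have := mul_le_mul_of_nonneg_left hρ hC0
    linarith
  · rw [h.normSq_eq ((extChartAt (𝓡∂ n) c).map_target (interior_subset hy)),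
      (extChartAt (𝓡∂ n) c).right_inv (interior_subset hy)]

theorem exists_sobolev_of_tsupport (h : IsCompactification ρ gbar g) (hn : 3 ≤ n) (c : M)
    {χ : M → ℝ} (hχ : ContMDiff (𝓡∂ n) 𝓘(ℝ, ℝ) ∞ χ)
    (hχc : tsupport χ ⊆ (extChartAt (𝓡∂ n) c).source) : ∃ C : ℝ, 0 ≤ C ∧
      ∀ u, MemW12 g u → eLpNorm (fun p => χ p * u p) (critExp n) (riemVolume g)
        ≤ ENNReal.ofReal (C * Real.sqrt (∫ p, (u p ^ 2 + gradNormSq g u p) ∂(riemVolume g))) := by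
  have hm := h.isChartModel c (isClosed_tsupport χ) hχc
  have hX : ContDiffOn ℝ 1 (fun y => χ ((extChartAt (𝓡∂ n) c).symm y))
      (extChartAt (𝓡∂ n) c).target := (contDiffOn_comp_symm hχ c).of_le (by simp)
  have hX0 : ∀ y ∈ (extChartAt (𝓡∂ n) c).target, y ∉ extChartAt (𝓡∂ n) c '' tsupport χ →
      χ ((extChartAt (𝓡∂ n) c).symm y) = 0 := by
    intro y hy hyK
    by_contra hne
    exact hyK ⟨_, subset_tsupport χ hne, (extChartAt (𝓡∂ n) c).right_inv hy⟩
  obtain ⟨C, hC0, hC⟩ := hm.exists_sobolev hn hX hX0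
  refine ⟨C, hC0, fun u hu => ?_⟩
  have hi : Integrable (fun p => u p ^ 2 + gradNormSq g u p) (riemVolume g) :=
    hu.2.1.integrable_sq.add hu.2.2
  have e1 : eLpNorm (fun p => χ p * u p) (critExp n) (riemVolume g)
      = eLpNorm (fun p => χ p * u p) (critExp n) (chartVolume g c) := by
    rw [← riemVolume_restrict, ← eLpNorm_indicator_eq_eLpNorm_restrict (measurableSet_source c)]
    congr 1
    funext p
    by_cases hp : p ∈ (extChartAt (𝓡∂ n) c).source
    · rw [indicator_of_mem hp]
    · rw [indicator_of_notMem hp, image_eq_zero_of_notMem_tsupport fun h1 => hp (hχc h1), zero_mul]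
  have hmeas : AEStronglyMeasurable (fun p => χ p * u p) (chartVolume g c) := by
    rw [← riemVolume_restrict]
    exact (hχ.continuous.aestronglyMeasurable.mul hu.2.1.1).restrict
  have e2 : (volume.restrict (chartDomain (n := n) c)).withDensity
        (fun y => ENNReal.ofReal (Real.sqrt (metricMatrix g c y).det))
      = (volume.restrict (interior (extChartAt (𝓡∂ n) c).target)).withDensity
        (fun y => ENNReal.ofReal (dens (fun y => ρ ((extChartAt (𝓡∂ n) c).symm y))
          (metricMatrix gbar.inner c) y)) := by
    refine withDensity_congr_ae ?_
    filter_upwards [ae_restrict_mem (measurableSet_chartDomain c)] with y hy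
    rw [h.dens_eq hy]
  -- The W^{1,2} density is nonnegative, so its integral over one chart is at most the total.
  have e3 : ∫ y in interior (extChartAt (𝓡∂ n) c).target,
        (dens (fun y => ρ ((extChartAt (𝓡∂ n) c).symm y)) (metricMatrix gbar.inner c) y
          * u ((extChartAt (𝓡∂ n) c).symm y) ^ 2
        + gradDens (fun y => ρ ((extChartAt (𝓡∂ n) c).symm y)) (metricMatrix gbar.inner c)
          (fun i y => weakDifferential u ((extChartAt (𝓡∂ n) c).symm y) (coordVec c y i)) y)
      ≤ ∫ p, (u p ^ 2 + gradNormSq g u p) ∂(riemVolume g) := by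
    refine le_trans (le_of_eq ?_) (setIntegral_le_integral
      (s := (extChartAt (𝓡∂ n) c).source) hi ?_)
    · rw [h.setIntegral_source_eq c hi.1 (G := fun y => u ((extChartAt (𝓡∂ n) c).symm y) ^ 2
        + (ρ ((extChartAt (𝓡∂ n) c).symm y) ^ 2 * coNormSq (metricMatrix gbar.inner c y)
        (fun i => weakDifferential u ((extChartAt (𝓡∂ n) c).symm y) (coordVec c y i))))
        fun y hy => by rw [h.gradNormSq_eq hy]]
      refine integral_congr_ae (ae_of_all _ fun y => ?_)
      simp only [gradDens]
      ring
    · filter_upwards [ae_mem_interior g] with p hp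
      exact add_nonneg (sq_nonneg _) (h.gradNormSq_nonneg u hp)
  rw [e1, chartVolume, eLpNorm_map_measure hmeas (aemeasurable_symm c), e2]
  refine (hC _ _ (h.isSobolevModel hu c)).trans (ENNReal.ofReal_le_ofReal ?_)
  gcongr

end

end IsCompactification

end AHYamabe
end

/-! ### Global Hardy and Sobolev inequalities; lower bounds for the energy -/

noncomputable section

namespace AHYamabe

open Filter Topology

variable {n : ℕ} [NeZero n] {M : Type*} [TopologicalSpace M]
  [ChartedSpace (EuclideanHalfSpace n) M] [IsManifold (𝓡∂ n) ∞ M]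
  [CompactSpace M] [T2Space M]

theorem exists_finite_partition (n : ℕ) [NeZero n] (M : Type*) [TopologicalSpace M]
    [ChartedSpace (EuclideanHalfSpace n) M] [IsManifold (𝓡∂ n) ∞ M]
    [CompactSpace M] [T2Space M] : ∃ (t : Finset M) (χ : M → M → ℝ),
      (∀ c, ContMDiff (𝓡∂ n) 𝓘(ℝ, ℝ) ∞ (χ c)) ∧ (∀ c p, 0 ≤ χ c p) ∧
      (∀ c, tsupport (χ c) ⊆ (extChartAt (𝓡∂ n) c).source) ∧ ∀ p, ∑ c ∈ t, χ c p = 1 := by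
  obtain ⟨f, hf⟩ := SmoothPartitionOfUnity.exists_isSubordinate_chartAt_source (𝓡∂ n) M
  have hfin := f.locallyFinite.finite_nonempty_of_compact
  refine ⟨hfin.toFinset, fun c p => f c p, fun c => (f c).contMDiff, fun c p => f.nonneg c p,
    fun c => by rw [extChartAt_source]; exact hf c, fun p => ?_⟩
  rw [← f.sum_eq_one (mem_univ p)]
  refine (finsum_eq_sum_of_support_subset _ fun c hc => ?_).symm
  rw [Finite.coe_toFinset]
  exact ⟨p, hc⟩

theorem two_le_critExp (hn : 3 ≤ n) : 2 ≤ critExp n := by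
  have : (3 : ℝ) ≤ n := by exact_mod_cast hn
  rw [critExp, show (2 : ℝ≥0∞) = ENNReal.ofReal 2 by simp]
  refine ENNReal.ofReal_le_ofReal ?_
  rw [le_div_iff₀ (by linarith)]
  linarith

variable [MeasurableSpace M] [BorelSpace M]

namespace IsCompactification

variable {ρ : M → ℝ} {gbar : C2Metric n M} {g : BilinField n M}

/-- The Hardy inequality. -/
theorem exists_hardy (h : IsCompactification ρ gbar g) : ∃ C : ℝ, 0 ≤ C ∧
      ∀ u, MemW12 g u → ∀ t : ℝ, 0 < t →
        ((n : ℝ) - 1) * ∫ p, normSq ρ gbar p * u p ^ 2 ∂(riemVolume g)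
          ≤ t * (∫ p, normSq ρ gbar p * u p ^ 2 ∂(riemVolume g))
            + t⁻¹ * (∫ p, gradNormSq g u p ∂(riemVolume g))
            + C * ∫ p, ρ p * u p ^ 2 ∂(riemVolume g) := by
  obtain ⟨T, χ, hχ, hχ0, hχc, hsum⟩ := exists_finite_partition n M
  choose C hC0 hC using fun c => h.exists_hardy_of_tsupport c (hχ c) (hχ0 c) (hχc c)
  refine ⟨∑ c ∈ T, C c, Finset.sum_nonneg fun c _ => hC0 c, fun u hu t ht => ?_⟩
  have key : ∀ F : M → ℝ, Integrable F (riemVolume g) →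
      ∫ p, F p ∂(riemVolume g) = ∑ c ∈ T, ∫ p, χ c p * F p ∂(riemVolume g) := by
    intro F hF
    rw [← integral_finsetSum _ fun c _ => integrable_mul (hχ c).continuous hF]
    refine integral_congr_ae (ae_of_all _ fun p => ?_)
    simp only [← Finset.sum_mul, hsum, one_mul]
  rw [key _ (integrable_mul h.continuous_normSq hu.2.1.integrable_sq), key _ hu.2.2,
    Finset.mul_sum, Finset.mul_sum, Finset.mul_sum, Finset.sum_mul, ← Finset.sum_add_distrib,
    ← Finset.sum_add_distrib]
  exact Finset.sum_le_sum fun c _ => hC c u hu t ht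

/-- The Sobolev inequality. -/
theorem exists_sobolev (h : IsCompactification ρ gbar g) (hn : 3 ≤ n) : ∃ C : ℝ, 0 ≤ C ∧
      ∀ u, MemW12 g u → eLpNorm u (critExp n) (riemVolume g)
        ≤ ENNReal.ofReal (C * Real.sqrt (∫ p, (u p ^ 2 + gradNormSq g u p) ∂(riemVolume g))) := by
  obtain ⟨T, χ, hχ, hχ0, hχc, hsum⟩ := exists_finite_partition n M
  choose C hC0 hC using fun c => h.exists_sobolev_of_tsupport hn c (hχ c) (hχc c)
  refine ⟨∑ c ∈ T, C c, Finset.sum_nonneg fun c _ => hC0 c, fun u hu => ?_⟩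
  have e : u = ∑ c ∈ T, fun p => χ c p * u p := by
    funext p
    rw [Finset.sum_apply, ← Finset.sum_mul, hsum, one_mul]
  have h1 := eLpNorm_sum_le (s := T) (f := fun c p => χ c p * u p) (μ := riemVolume g)
    (p := critExp n) (fun c _ => (hχ c).continuous.aestronglyMeasurable.mul hu.2.1.1)
    (le_trans (by norm_num) (two_le_critExp hn))
  rw [← e] at h1
  refine h1.trans ((Finset.sum_le_sum fun c _ => hC c u hu).trans ?_)
  rw [← ENNReal.ofReal_sum_of_nonneg fun c _ => mul_nonneg (hC0 c) (Real.sqrt_nonneg _),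
    Finset.sum_mul]

omit [T2Space M] in
theorem aestronglyMeasurable_scal (h : IsCompactification ρ gbar g) :
    AEStronglyMeasurable (scal g) (riemVolume g) := by
  rw [← Measure.restrict_eq_self_of_ae_mem (ae_mem_interior g)]
  exact h.continuousOn_scal.aestronglyMeasurable
    ((𝓡∂ n).isOpen_interior (n := ∞) (by simp)).measurableSet

omit [T2Space M] in
theorem exists_abs_scal_le (h : IsCompactification ρ gbar g) :
    ∃ C : ℝ, 0 ≤ C ∧ ∀ p ∈ (𝓡∂ n).interior M, |scal g p| ≤ C := by
  obtain ⟨C, hC0, hC⟩ := h.exists_scal_bound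
  obtain ⟨R, hR0, hR⟩ := exists_abs_le h.continuous
  obtain ⟨S, hS0, hS⟩ := exists_abs_le
    (continuous_const.mul h.continuous_normSq : Continuous fun p =>
      (n : ℝ) * ((n : ℝ) - 1) * normSq ρ gbar p)
  refine ⟨C * R + S, by positivity, fun p hp => ?_⟩
  have h1 := hC p hp
  have h2 := (le_abs_self _).trans (hR p)
  have h3 := hS p
  calc |scal g p| = |(scal g p + (n : ℝ) * ((n : ℝ) - 1) * normSq ρ gbar p)
        - (n : ℝ) * ((n : ℝ) - 1) * normSq ρ gbar p| := by congr 1; ring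
    _ ≤ C * ρ p + S := (abs_sub _ _).trans (add_le_add h1 h3)
    _ ≤ C * R + S := by gcongr

omit [T2Space M] in
theorem integrable_scal (h : IsCompactification ρ gbar g) {u : M → ℝ} (hu : MemW12 g u) :
    Integrable (fun p => scal g p * u p ^ 2) (riemVolume g) := by
  obtain ⟨C, hC0, hC⟩ := h.exists_abs_scal_le
  refine hu.2.1.integrable_sq.bdd_mul (c := C) h.aestronglyMeasurable_scal ?_
  filter_upwards [ae_mem_interior g] with p hp using hC p hp

omit [T2Space M] in
theorem energy_eq (h : IsCompactification ρ gbar g) {u : M → ℝ} (hu : MemW12 g u) :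
    energy g u = 4 * ((n : ℝ) - 1) / ((n : ℝ) - 2) * ∫ p, gradNormSq g u p ∂(riemVolume g)
      + ∫ p, scal g p * u p ^ 2 ∂(riemVolume g) := by
  rw [energy, integral_add (hu.2.2.const_mul _) (h.integrable_scal hu), integral_const_mul]

omit [T2Space M] [CompactSpace M] [BorelSpace M] [IsManifold (𝓡∂ n) ∞ M] in
theorem integral_sq_eq {u : M → ℝ} {g : BilinField n M} (hu : MemLp u 2 (riemVolume g)) :
    ∫ p, u p ^ 2 ∂(riemVolume g) = (eLpNorm u 2 (riemVolume g)).toReal ^ 2 := by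
  rw [← ENNReal.toReal_pow, sq_eLpNorm_two, integral_eq_lintegral_of_nonneg_ae
    (ae_of_all _ fun p => sq_nonneg _) hu.integrable_sq.1]
  congr 1
  refine lintegral_congr fun p => ?_
  rw [← ofReal_norm, ← ENNReal.ofReal_pow (norm_nonneg _), Real.norm_eq_abs, sq_abs]

omit [T2Space M] in
/-- The energy controls the Dirichlet integral. -/
theorem exists_energy_ge_grad (h : IsCompactification ρ gbar g) : ∃ C : ℝ, 0 ≤ C ∧
    ∀ u, MemW12 g u →
      4 * ((n : ℝ) - 1) / ((n : ℝ) - 2) * ∫ p, gradNormSq g u p ∂(riemVolume g)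
        - C * (eLpNorm u 2 (riemVolume g)).toReal ^ 2 ≤ energy g u := by
  obtain ⟨C, hC0, hC⟩ := h.exists_abs_scal_le
  refine ⟨C, hC0, fun u hu => ?_⟩
  rw [h.energy_eq hu, ← integral_sq_eq hu.2.1]
  have : -(C * ∫ p, u p ^ 2 ∂(riemVolume g)) ≤ ∫ p, scal g p * u p ^ 2 ∂(riemVolume g) := by
    rw [← integral_const_mul, ← integral_neg]
    refine integral_mono_ae (hu.2.1.integrable_sq.const_mul C).neg (h.integrable_scal hu) ?_
    filter_upwards [ae_mem_interior g] with p hp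
    have := neg_le_of_abs_le (hC p hp)
    nlinarith [sq_nonneg (u p)]
  linarith

/-- Coercivity of the energy at infinity. -/
theorem exists_energy_ge_sub (h : IsCompactification ρ gbar g) (hn : 3 ≤ n) : ∃ C : ℝ, 0 ≤ C ∧
    ∀ u, MemW12 g u →
      ∫ p, (((n : ℝ) - 1) / ((n : ℝ) - 2) * normSq ρ gbar p - C * ρ p) * u p ^ 2 ∂(riemVolume g)
        ≤ energy g u := by
  have hn' : (3 : ℝ) ≤ n := by exact_mod_cast hn
  obtain ⟨C, hC0, hC⟩ := h.exists_scal_bound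
  obtain ⟨H, hH0, hH⟩ := h.exists_hardy
  have h2 : (0 : ℝ) < (n : ℝ) - 2 := by linarith
  set κ : ℝ := 4 * ((n : ℝ) - 1) / ((n : ℝ) - 2) with hκ
  have hκ0 : 0 < κ := div_pos (by linarith) h2
  refine ⟨κ * (((n : ℝ) - 1) / 2 * H) + C,
    add_nonneg (mul_nonneg hκ0.le (mul_nonneg (by linarith) hH0)) hC0, fun u hu => ?_⟩
  have hu2 := hu.2.1.integrable_sq
  have i1 := integrable_mul h.continuous hu2
  have i2 := integrable_mul h.continuous_normSq hu2
  have hsc : -((n : ℝ) * ((n : ℝ) - 1)) * (∫ p, normSq ρ gbar p * u p ^ 2 ∂(riemVolume g))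
      - C * ∫ p, ρ p * u p ^ 2 ∂(riemVolume g) ≤ ∫ p, scal g p * u p ^ 2 ∂(riemVolume g) := by
    rw [← integral_const_mul, ← integral_const_mul, ← integral_sub (i2.const_mul _) (i1.const_mul _)]
    refine integral_mono_ae ((i2.const_mul _).sub (i1.const_mul _)) (h.integrable_scal hu) ?_
    filter_upwards [ae_mem_interior g] with p hp
    have := neg_le_of_abs_le (hC p hp)
    nlinarith [sq_nonneg (u p)]
  -- The value t = (n-1)/2 maximizes t(n-1-t) and gives the constant (n-1)²/4.
  have hh := hH u hu (((n : ℝ) - 1) / 2) (by linarith)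
  rw [h.energy_eq hu]
  set A := ∫ p, normSq ρ gbar p * u p ^ 2 ∂(riemVolume g)
  set R := ∫ p, ρ p * u p ^ 2 ∂(riemVolume g)
  set B := ∫ p, gradNormSq g u p ∂(riemVolume g)
  have hB : ((n : ℝ) - 1) ^ 2 / 4 * A - ((n : ℝ) - 1) / 2 * H * R ≤ B := by
    have h3 : ((n : ℝ) - 1) / 2 * (((n : ℝ) - 1) * A) ≤ ((n : ℝ) - 1) / 2 * (((n : ℝ) - 1) / 2 * A
        + (((n : ℝ) - 1) / 2)⁻¹ * B + H * R) := mul_le_mul_of_nonneg_left hh (by linarith)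
    have h4 : ((n : ℝ) - 1) / 2 * ((((n : ℝ) - 1) / 2)⁻¹ * B) = B :=
      mul_inv_cancel_left₀ (by linarith) B
    nlinarith
  have hκB := mul_le_mul_of_nonneg_left hB hκ0.le
  have hint : ∫ p, (((n : ℝ) - 1) / ((n : ℝ) - 2) * normSq ρ gbar p
      - (κ * (((n : ℝ) - 1) / 2 * H) + C) * ρ p) * u p ^ 2 ∂(riemVolume g)
      = ((n : ℝ) - 1) / ((n : ℝ) - 2) * A - (κ * (((n : ℝ) - 1) / 2 * H) + C) * R := by
    rw [← integral_const_mul, ← integral_const_mul, ← integral_sub (i2.const_mul _) (i1.const_mul _)]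
    refine integral_congr_ae (ae_of_all _ fun p => ?_)
    simp only
    ring
  rw [hint]
  -- The gain of Hardy over the curvature: the left side is (n-1)/(n-2) times (n-1)² - n(n-2), which
  -- equals 1.
  have hcoef : κ * (((n : ℝ) - 1) ^ 2 / 4) - (n : ℝ) * ((n : ℝ) - 1)
      = ((n : ℝ) - 1) / ((n : ℝ) - 2) := by
    rw [hκ]
    field_simp
    ring
  have : ((n : ℝ) - 1) / ((n : ℝ) - 2) * A
      = κ * (((n : ℝ) - 1) ^ 2 / 4 * A) - (n : ℝ) * ((n : ℝ) - 1) * A := by rw [← hcoef]; ring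
  linarith

/-- Near the boundary the lower bound of `exists_energy_ge_sub` is positive, since |dρ| = 1 there;
the complement has finite volume, and Hölder's inequality trades L² for L^N on it. -/
theorem exists_energy_ge_sq (h : IsCompactification ρ gbar g) (hn : 3 ≤ n) :
    ∃ ε C : ℝ, 0 < ε ∧ 0 ≤ C ∧ ∀ u, MemW12 g u →
      ε * (eLpNorm u 2 (riemVolume g)).toReal ^ 2
        - C * (eLpNorm u (critExp n) (riemVolume g)).toReal ^ 2 ≤ energy g u := by
  have hn' : (3 : ℝ) ≤ n := by exact_mod_cast hn
  obtain ⟨C, hC0, hC⟩ := h.exists_energy_ge_sub hn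
  obtain ⟨S, hS0, hS⟩ := h.exists_sobolev hn
  obtain ⟨R, hR0, hR⟩ := exists_abs_le h.continuous
  set ε : ℝ := ((n : ℝ) - 1) / ((n : ℝ) - 2) with hε
  have hε0 : 0 < ε := div_pos (by linarith) (by linarith)
  set F : M → ℝ := fun p => ε * normSq ρ gbar p - C * ρ p with hF
  have hFc : Continuous F :=
    (continuous_const.mul h.continuous_normSq).sub (continuous_const.mul h.continuous)
  -- The number δ is the minimum of ρ on the compact set {F ≤ ε/2}. It is positive because F = ε on
  -- the boundary. If the set is empty, any δ works.
  obtain ⟨δ, hδ0, hδ⟩ : ∃ δ : ℝ, 0 < δ ∧ ∀ p, ρ p < δ → ε / 2 ≤ F p := by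
    have hK : IsCompact {p | F p ≤ ε / 2} := (isClosed_le hFc continuous_const).isCompact
    rcases eq_empty_or_nonempty {p | F p ≤ ε / 2} with he | hne
    · refine ⟨1, one_pos, fun p _ => ?_⟩
      have : p ∉ {p | F p ≤ ε / 2} := by rw [he]; simp
      exact (not_le.1 this).le
    · obtain ⟨q, hq, hmin⟩ := hK.exists_isMinOn hne h.continuous.continuousOn
      refine ⟨ρ q, lt_of_le_of_ne (h.defining.nonneg q) fun h0 => ?_, fun p hp => ?_⟩
      · have h1 := h.normSq_eq_one ((h.defining.eq_zero_iff q).1 h0.symm)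
        have h2 : ε * normSq ρ gbar q - C * ρ q ≤ ε / 2 := hq
        rw [h1, ← h0] at h2
        linarith
      · by_contra hlt
        exact absurd (hmin (show F p ≤ ε / 2 from (not_le.1 hlt).le)) (not_le.2 hp)
  set Q : Set M := {p | δ ≤ ρ p} with hQ
  have hQm : MeasurableSet Q := (isClosed_le continuous_const h.continuous).measurableSet
  have hμQ := h.measure_ge_lt_top hδ0
  set e : ℝ := 1 / (2 : ℝ≥0∞).toReal - 1 / (critExp n).toReal with he
  have he0 : 0 ≤ e := by
    rw [he, sub_nonneg]
    exact one_div_le_one_div_of_le (by simp)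
      (ENNReal.toReal_mono critExp_ne_top (two_le_critExp hn))
  set m : ℝ := ((riemVolume g Q) ^ e).toReal with hm
  refine ⟨ε / 2, (ε / 2 + C * R) * m ^ 2, by positivity, by positivity, fun u hu => ?_⟩
  have hu2 := hu.2.1.integrable_sq
  have hN : eLpNorm u (critExp n) (riemVolume g) ≠ ⊤ :=
    ne_top_of_le_ne_top ENNReal.ofReal_ne_top (hS u hu)
  have hQint : ∫ p in Q, u p ^ 2 ∂(riemVolume g)
      ≤ m ^ 2 * (eLpNorm u (critExp n) (riemVolume g)).toReal ^ 2 := by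
    have h1 : eLpNorm u 2 ((riemVolume g).restrict Q)
        ≤ eLpNorm u (critExp n) (riemVolume g) * (riemVolume g Q) ^ e := by
      refine (eLpNorm_le_eLpNorm_mul_rpow_measure_univ (two_le_critExp hn)
        hu.2.1.1.restrict).trans ?_
      rw [Measure.restrict_apply_univ]
      gcongr
      exact Measure.restrict_le_self
    have h2 : ∫ p in Q, u p ^ 2 ∂(riemVolume g)
        = (eLpNorm u 2 ((riemVolume g).restrict Q)).toReal ^ 2 := by
      rw [← ENNReal.toReal_pow, sq_eLpNorm_two, integral_eq_lintegral_of_nonneg_ae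
        (ae_of_all _ fun p => sq_nonneg _) hu2.1.restrict]
      congr 1
      refine lintegral_congr fun p => ?_
      rw [← ofReal_norm, ← ENNReal.ofReal_pow (norm_nonneg _), Real.norm_eq_abs, sq_abs]
    rw [h2, ← mul_pow]
    have h3 : (eLpNorm u 2 ((riemVolume g).restrict Q)).toReal
        ≤ m * (eLpNorm u (critExp n) (riemVolume g)).toReal := by
      rw [hm, mul_comm, ← ENNReal.toReal_mul]
      exact ENNReal.toReal_mono
        (ENNReal.mul_ne_top hN (ENNReal.rpow_ne_top_of_nonneg he0 hμQ.ne)) h1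
    gcongr
  refine le_trans ?_ (hC u hu)
  -- Off Q one has F ≥ ε/2. On Q only F ≥ -CR is known, and the subtracted multiple of the indicator
  -- of Q makes up the difference.
  have hlow : ε / 2 * (∫ p, u p ^ 2 ∂(riemVolume g))
      - (ε / 2 + C * R) * ∫ p in Q, u p ^ 2 ∂(riemVolume g)
      ≤ ∫ p, F p * u p ^ 2 ∂(riemVolume g) := by
    rw [← integral_indicator hQm, ← integral_const_mul, ← integral_const_mul,
      ← integral_sub (hu2.const_mul _) ((hu2.indicator hQm).const_mul _)]
    refine integral_mono ((hu2.const_mul _).sub ((hu2.indicator hQm).const_mul _))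
      (integrable_mul hFc hu2) fun p => ?_
    by_cases hp : p ∈ Q
    · simp only [indicator_of_mem hp]
      have h1 : -(C * R) ≤ F p := by
        have h2 := (le_abs_self _).trans (hR p)
        have h3 := mul_le_mul_of_nonneg_left h2 hC0
        have h4 := mul_nonneg hε0.le (h.normSq_nonneg p)
        simp only [hF]
        linarith
      nlinarith [sq_nonneg (u p)]
    · simp only [indicator_of_notMem hp]
      have h1 := hδ p (not_le.1 hp)
      nlinarith [sq_nonneg (u p)]
  have hfin : (ε / 2 + C * R) * ∫ p in Q, u p ^ 2 ∂(riemVolume g)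
      ≤ (ε / 2 + C * R) * (m ^ 2 * (eLpNorm u (critExp n) (riemVolume g)).toReal ^ 2) :=
    mul_le_mul_of_nonneg_left hQint (by positivity)
  rw [← integral_sq_eq hu.2.1]
  linarith

end IsCompactification

end AHYamabe
end

noncomputable section
namespace AHYamabe
open Filter Topology

/-! ### Comparison of the signs of the two invariants -/

/-- A positive denominator does not affect the sign, so the condition no longer involves A. -/
theorem biInf_div_neg_iff {ι : Type*} {S : Set ι} {E A : ι → ℝ} (hA : ∀ u ∈ S, 0 < A u) :
    (⨅ u ∈ S, ((E u / A u : ℝ) : EReal)) < 0 ↔ ∃ u ∈ S, E u < 0 := by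
  simp only [iInf_lt_iff, exists_prop]
  refine exists_congr fun u => and_congr_right fun hu => ?_
  rw [← EReal.coe_zero, EReal.coe_lt_coe_iff, div_lt_iff₀ (hA u hu), zero_mul]

/-- The empty family needs no separate treatment: its infimum is ⊤ and the right-hand condition is
vacuous. -/
theorem biInf_div_pos_iff {ι : Type*} {S : Set ι} {E A : ι → ℝ} (hA : ∀ u ∈ S, 0 < A u) :
    0 < (⨅ u ∈ S, ((E u / A u : ℝ) : EReal)) ↔ ∃ η : ℝ, 0 < η ∧ ∀ u ∈ S, η * A u ≤ E u := by
  constructor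
  · intro h
    obtain ⟨η, h0, h1⟩ := EReal.lt_iff_exists_real_btwn.1 h
    refine ⟨η, by exact_mod_cast h0, fun u hu => ?_⟩
    rw [← le_div_iff₀ (hA u hu), ← EReal.coe_le_coe_iff]
    exact h1.le.trans (iInf₂_le u hu)
  · rintro ⟨η, h0, h1⟩
    refine lt_of_lt_of_le (EReal.coe_pos.2 h0) (le_iInf₂ fun u hu => ?_)
    rw [EReal.coe_le_coe_iff, le_div_iff₀ (hA u hu)]
    exact h1 u hu

/-- If a functional `E` controls `B` up to `A`, controls `A` up to `P`, and `P` is controlled by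
`A + B`, then the infima of `E / A` and of `E / P` have the same sign. -/
theorem biInf_div_sign_eq {ι : Type*} {S : Set ι} {E A B P : ι → ℝ}
    (hA : ∀ u ∈ S, 0 < A u) (hP : ∀ u ∈ S, 0 < P u)
    {κ K ε L C : ℝ} (hκ : 0 < κ) (hK : 0 ≤ K) (hε : 0 < ε) (hL : 0 ≤ L) (hC : 0 ≤ C)
    (hEB : ∀ u ∈ S, κ * B u - K * A u ≤ E u) (hEA : ∀ u ∈ S, ε * A u - L * P u ≤ E u)
    (hPAB : ∀ u ∈ S, P u ≤ C * (A u + B u)) :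
    (0 < (⨅ u ∈ S, ((E u / A u : ℝ) : EReal)) ∧ 0 < (⨅ u ∈ S, ((E u / P u : ℝ) : EReal))) ∨
    ((⨅ u ∈ S, ((E u / A u : ℝ) : EReal)) < 0 ∧ (⨅ u ∈ S, ((E u / P u : ℝ) : EReal)) < 0) ∨
    ((⨅ u ∈ S, ((E u / A u : ℝ) : EReal)) = 0 ∧ (⨅ u ∈ S, ((E u / P u : ℝ) : EReal)) = 0) := by
  have hneg : (⨅ u ∈ S, ((E u / A u : ℝ) : EReal)) < 0 ↔
      (⨅ u ∈ S, ((E u / P u : ℝ) : EReal)) < 0 := by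
    rw [biInf_div_neg_iff hA, biInf_div_neg_iff hP]
  have hpos : 0 < (⨅ u ∈ S, ((E u / A u : ℝ) : EReal)) ↔
      0 < (⨅ u ∈ S, ((E u / P u : ℝ) : EReal)) := by
    rw [biInf_div_pos_iff hA, biInf_div_pos_iff hP]
    constructor
    · rintro ⟨η, h0, h1⟩
      -- The bounds A ≤ E/η and B ≤ (1 + K/η)E/κ are inserted into P ≤ C(A + B); the summand 1 keeps
      -- D positive when C = 0.
      set D : ℝ := C * (1 / η + (1 + K / η) / κ) + 1 with hD
      have hD0 : 0 < D := by positivity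
      refine ⟨1 / D, by positivity, fun u hu => ?_⟩
      have hE : 0 < E u := lt_of_lt_of_le (mul_pos h0 (hA u hu)) (h1 u hu)
      have hAu : A u ≤ 1 / η * E u := by
        rw [one_div_mul_eq_div, le_div_iff₀ h0, mul_comm]
        exact h1 u hu
      have hBu : B u ≤ (1 + K / η) / κ * E u := by
        rw [div_mul_eq_mul_div, le_div_iff₀ hκ]
        have h2 := mul_le_mul_of_nonneg_left hAu hK
        have h3 := hEB u hu
        have h4 : (1 + K / η) * E u = E u + K * (1 / η * E u) := by ring
        linarith
      have h5 := mul_le_mul_of_nonneg_left (add_le_add hAu hBu) hC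
      have h6 := hPAB u hu
      rw [one_div_mul_eq_div, div_le_iff₀ hD0, hD]
      linarith
    · rintro ⟨η, h0, h1⟩
      -- Here P ≤ E/η, so εA ≤ E + LP ≤ (1 + L/η)E.
      have hD0 : 0 < 1 + L / η := by positivity
      refine ⟨ε / (1 + L / η), by positivity, fun u hu => ?_⟩
      rw [div_mul_eq_mul_div, div_le_iff₀ hD0]
      have hPu : P u ≤ 1 / η * E u := by
        rw [one_div_mul_eq_div, le_div_iff₀ h0, mul_comm]
        exact h1 u hu
      have h2 := mul_le_mul_of_nonneg_left hPu hL
      have h3 := hEA u hu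
      have h4 : E u * (1 + L / η) = E u + L * (1 / η * E u) := by ring
      linarith
  -- The zero case follows by exclusion, once negativity and positivity have been matched.
  rcases lt_trichotomy (⨅ u ∈ S, ((E u / A u : ℝ) : EReal)) 0 with h | h | h
  · exact Or.inr (Or.inl ⟨h, hneg.1 h⟩)
  · refine Or.inr (Or.inr ⟨h, le_antisymm ?_ ?_⟩)
    · exact not_lt.1 fun h' => (hpos.2 h').ne' h
    · exact not_lt.1 fun h' => (hneg.2 h').ne h
  · exact Or.inl ⟨h, hpos.1 h⟩

namespace IsCompactification

variable {n : ℕ} [NeZero n] {M : Type*} [TopologicalSpace M]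
  [ChartedSpace (EuclideanHalfSpace n) M] [IsManifold (𝓡∂ n) ∞ M] [CompactSpace M] [T2Space M]
  [MeasurableSpace M] [BorelSpace M] {ρ : M → ℝ} {gbar : C2Metric n M} {g : BilinField n M}

/-- The abstract comparison with A = ‖u‖₂², B = ‖du‖², P = ‖u‖_N² on the nonzero elements of 𝓕(V).
The constants come from inequalities on all of W^{1,2}, so they do not depend on V. -/
theorem eigenvalue_yamabe_sign_eq (h : IsCompactification ρ gbar g) (hn : 3 ≤ n) (V : Set M) :
    (0 < firstConformalEigenvalue g V ∧ 0 < yamabeInvariant g V) ∨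
    (firstConformalEigenvalue g V < 0 ∧ yamabeInvariant g V < 0) ∨
    (firstConformalEigenvalue g V = 0 ∧ yamabeInvariant g V = 0) := by
  obtain ⟨S, hS0, hS⟩ := h.exists_sobolev hn
  obtain ⟨K, hK0, hK⟩ := h.exists_energy_ge_grad
  obtain ⟨ε, L, hε, hL0, hL⟩ := h.exists_energy_ge_sq hn
  have hn' : (3 : ℝ) ≤ n := by exact_mod_cast hn
  have hκ : 0 < 4 * ((n : ℝ) - 1) / ((n : ℝ) - 2) :=
    div_pos (by linarith) (by linarith)
  refine biInf_div_sign_eq (B := fun u => ∫ p, gradNormSq g u p ∂(riemVolume g))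
    (C := S ^ 2) (fun u hu => ?_) (fun u hu => ?_) hκ hK0 hε hL0 (sq_nonneg _)
    (fun u hu => hK u hu.1.1) (fun u hu => hL u hu.1.1) fun u hu => ?_
  · have hu2 := hu.1.1.2.1
    refine pow_pos (ENNReal.toReal_pos (fun h0 => hu.2 ?_) hu2.2.ne) 2
    exact (eLpNorm_eq_zero_iff hu2.1 two_ne_zero).1 h0
  · have hu2 := hu.1.1.2.1
    -- Finiteness of the L^N norm comes from the Sobolev inequality; an infinite norm would be sent
    -- to 0 by `toReal`.
    refine pow_pos (ENNReal.toReal_pos (fun h0 => hu.2 ?_)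
      (ne_top_of_le_ne_top ENNReal.ofReal_ne_top (hS u hu.1.1))) 2
    exact (eLpNorm_eq_zero_iff hu2.1 (critExp_ne_zero hn)).1 h0
  · obtain ⟨-, hu2, hug⟩ := hu.1.1
    have hnn : 0 ≤ ∫ p, (u p ^ 2 + gradNormSq g u p) ∂(riemVolume g) :=
      integral_nonneg_of_ae <| by
        filter_upwards [ae_mem_interior g] with p hp
        exact add_nonneg (sq_nonneg _) (h.gradNormSq_nonneg u hp)
    have h1 := pow_le_pow_left₀ ENNReal.toReal_nonneg (ENNReal.toReal_le_of_le_ofReal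
      (mul_nonneg hS0 (Real.sqrt_nonneg _)) (hS u hu.1.1)) 2
    rwa [mul_pow, Real.sq_sqrt hnn, integral_add hu2.integrable_sq hug,
      integral_sq_eq hu2] at h1

end IsCompactification

end AHYamabe
end

theorem proposition3p3 {n : ℕ} [NeZero n] (hn : 3 ≤ n)
    {M : Type*} [TopologicalSpace M] [T2Space M] [CompactSpace M]
    [ChartedSpace (EuclideanHalfSpace n) M] [IsManifold (𝓡∂ n) ∞ M]
    [MeasurableSpace M] [BorelSpace M]
    (g : AHYamabe.BilinField n M) (hg : AHYamabe.IsAsymptoticallyHyperbolic g)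
    (V : Set M) (hVM : V ⊆ (𝓡∂ n).interior M)
    (hV : NullMeasurableSet V (AHYamabe.riemVolume g)) :
    (0 < AHYamabe.firstConformalEigenvalue g V ∧ 0 < AHYamabe.yamabeInvariant g V) ∨
    (AHYamabe.firstConformalEigenvalue g V < 0 ∧ AHYamabe.yamabeInvariant g V < 0) ∨
    (AHYamabe.firstConformalEigenvalue g V = 0 ∧ AHYamabe.yamabeInvariant g V = 0) := by
  obtain ⟨ρ, hρ, gbar, hconf, hnorm⟩ := hg
  exact AHYamabe.IsCompactification.eigenvalue_yamabe_sign_eq (gbar := gbar)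
    ⟨hρ, hconf, hnorm⟩ hn V
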